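/- **Setting.** $\mathbb{R}[[X^*,Y]]$, with $X=(X_1,\dots,X_m)$ (generalised variables) and $Y=(Y_1,\dots,Y_n)$ (standard variables), is the ring of formal series $\sum c_{\alpha,\beta}X^\alpha Y^\beta$ with real coefficients, $\alpha\in[0,\infty)^m$, $\beta\in\mathbb{N}^n$, such that the exponents $\alpha$ occurring lie in a product of $m$ well-ordered subsets of $[0,\infty)$. A *generalised quasianalytic class* $\mathcal C$ consists of $\mathbb{R}$-algebras $\mathcal C_{m,n,r}$ ($m,n\in\mathbb N$, $r=(s,t)\in(0,\infty)^{m+n}$) of continuous functions on $I_{m,n,r}=\prod_i[0,s_i)\times\prod_j(-t_j,t_j)$, $C^1$ on the interior, containing the coordinate functions, stable under restriction to smaller polyradii, under adding dummy variables and under regarding standard variables as generalised (by restriction), and such that each element extends to an element of $\mathcal C_{m,n,r'}$ for some $r'>r$; together with injective $\mathbb{R}$-algebra morphisms $\mathcal T:\mathcal C_{m,n}\to\mathbb{R}[[X^*,Y]]$ on the algebras $\mathcal C_{m,n}$ of germs at $0$, compatible with adding dummy variables and with $\mathcal T(x_i)=X_i$, $\mathcal T(y_j)=Y_j$. Let $\mathbb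 A$ be the set of all components of exponents of supports of the series $\mathcal T(f)$; $\mathbb K=\mathbb N$ if $\mathbb A=\mathbb N$, otherwise $\mathbb K$ is the set of nonnegative elements of the field generated by $\mathbb A$. It is required that: (1) $x_i^\alpha\in\mathcal C_{m,0}$ and $\mathcal T(x_i^\alpha)=X_i^\alpha$ for $\alpha\in\mathbb K$, and $\mathcal C$ is closed under permuting the generalised variables, permuting the standard variables, and setting a variable equal to zero (which gives a germ in the remaining variables), $\mathcal T$ commuting with these operations; (2) if $X_i^\alpha$ ($\alpha\in\mathbb K$) or $Y_j^p$ ($p\in\mathbb N$) divides $\mathcal T(f)$, then $f=x_i^\alpha g$, respectively $f=y_j^pg$, with $g\in\mathcal C_{m,n}$; (3) for $f\in\mathcal C_{m,n}$ and every elementary transformation $\nu$ (below), $f\circ\nu\in\mathcal C_{m',n'}$ and $\mathcal T(f\circ\nu)=\mathcal T(f)\circ\nu$; (4) if $f\in\mathcal C_{m,n}$, $f(0)=0$ and $\frac{\partial f}{\partial y_n}(0)\ne0$, there is $g\in\mathcal C_{m,n-1}$ with $g(0)=0$ and $f(x,y_1,\dots,y_{n-1},g)=0$; (5) if $\mathcal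 T(f)=\sum_\alpha a_\alpha X_m^\alpha$, with the $a_\alpha$ free of $X_m$, and $\alpha_0\ge0$, there is $g\in\mathcal C_{m,n}$ with $\mathcal T(g)=\sum_{\alpha<\alpha_0}a_\alpha X_m^\alpha$. *Elementary transformations* $(x',y')\mapsto(x,y)$ (variables not mentioned are kept, up to renumbering): - ramifications $r_i^\gamma$: $x_i=x_i'^{\gamma}$ ($\gamma\in\mathbb K$, $\gamma>0$); - Tschirnhausen translations $\tau_H$: $y_n=y_n'+H(x',y'_1,\dots,y'_{n-1})$ ($H\in\mathcal C_{m,n-1}$, $H(0)=0$); - linear maps $L_{i,c}$: $y_k=y_k'+c_ky_i'$ for $k<i$ ($c_k\in\mathbb R$); - blow-up charts $\pi_{i,j}^\lambda$ ($j<i\le m$, $0<\lambda<\infty$): $x_i=x_j'(\lambda+y_1')$, with one generalised variable less and a new standard variable $y_1'$; $\pi_{i,j}^0=\pi_{j,i}^\infty$ ($i\neq j$): $x_i=x_j'x_i'$; $\pi_{m+i,j}^\lambda$ ($i\le n$, $j\le m$, $\lambda\in\mathbb R$): $y_i=x_j'(\lambda+y_i')$; $\pi_{m+i,j}^{\pm\infty}$: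 $x_j=x_{m+1}'x_j'$, $y_i=\pm x_{m+1}'$, with $y_i$ replaced by a new generalised variable $x'_{m+1}$; - reflections $\sigma_{m+i}^\pm$: $y_i=\pm x_{m+1}'$, likewise. *Elementary families* are $\{r_i^\gamma\}$, $\{\tau_H\}$, $\{L_{i,c}\}$, $\{\sigma^+_{m+i},\sigma^-_{m+i}\}$, $\{\pi_{i,j}^\lambda:\lambda\in[0,\infty]\}$, $\{\pi_{m+i,j}^\lambda:\lambda\in\mathbb R\cup\{\pm\infty\}\}$. *Admissible families* are defined inductively: $\{\mathrm{id}\}$ is admissible, and if $\mathcal F_0$ is an elementary family and, for each $\nu\in\mathcal F_0$, $\mathcal F_\nu$ is an admissible family acting on the source variables of $\nu$, then $\{\nu\circ\rho':\nu\in\mathcal F_0,\ \rho'\in\mathcal F_\nu\}$ is admissible (the number of factors of its members is finite, but not required to be uniformly bounded). A property holds for $F$ *after an admissible family* $\mathcal F$ if it holds for $F\circ\rho$ for every $\rho\in\mathcal F$. Let $\widehat{\mathcal C}_{m,n}=\mathcal T(\mathcal C_{m,n})$. A series $F\in\widehat{\mathcal C}_{m,n}$ is *normal* if $F=X^\alpha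 Y^\beta U$ with $\alpha\in[0,\infty)^m$, $\beta\in\mathbb N^n$ and $U$ a unit of $\widehat{\mathcal C}_{m,n}$. For a further single variable $Z$, let $\widehat{\mathcal C}_{m,n,1}$ be $\widehat{\mathcal C}_{m,n+1}$ ($Z$ standard) or $\widehat{\mathcal C}_{m+1,n}$ ($Z$ generalised). A series $F\in\widehat{\mathcal C}_{m,n,1}$ has a *finite presentation of order $d\geq1$* if there are $\alpha_1>\dots>\alpha_d$ in $\mathbb K$ (in $\mathbb N$ if $Z$ is standard), normal $H_1,\dots,H_d\in\widehat{\mathcal C}_{m,n}$ and units $U_1,\dots,U_d$ of $\widehat{\mathcal C}_{m,n,1}$ with $$F=H_1(X,Y)\bigl(Z^{\alpha_1}U_1(X,Y,Z)+H_2(X,Y)Z^{\alpha_2}U_2(X,Y,Z)+\dots+H_d(X,Y)Z^{\alpha_d}U_d(X,Y,Z)\bigr).$$ **Proposition.** Let $\mathcal C$ be a generalised quasianalytic class and $m,n\in\mathbb N$. Suppose that, for all $m',n'\in\mathbb N$ with $m'+n'=m+n$ and all finitely many nonzero $G_1,\dots,G_s\in\widehat{\mathcal C}_{m',n'}$, there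 is an admissible family after which $G_1,\dots,G_s$ are normal and linearly ordered by division. Then, whether $Z$ is standard or generalised, for every nonzero $F(X,Y,Z)\in\widehat{\mathcal C}_{m,n,1}$ there is an admissible family $\mathcal F$ of transformations of $(X,Y)$ such that, for every $\rho\in\mathcal F$ with source variables $(X',Y')$, the series $F\circ(\rho\times\mathrm{id}_Z)$ belongs to $\widehat{\mathcal C}_{m',n',1}$ ($Z$ being of the same kind) and has a finite presentation of some order $d\ge1$. -/

import Mathlib

open scoped NNReal Topology

noncomputable section

namespace GenQA

/-- Points `(x, y)` of `ℝ^{m+n}`: `m` generalised and `n` standard variables. -/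
abbrev Pt (m n : ℕ) : Type := (Fin m → ℝ) × (Fin n → ℝ)

/-- Exponents: nonnegative reals for the generalised variables, naturals for the standard ones. -/
abbrev Expo (m n : ℕ) : Type := (Fin m → ℝ≥0) × (Fin n → ℕ)

/-- The ring `ℝ⟦X*, Y⟧` of generalised power series: real families indexed by exponents, whose
support is partially well ordered for the product order, i.e. good (see `isPWO_iff_good`). -/
abbrev Series (m n : ℕ) : Type := HahnSeries (Expo m n) ℝ

/-- A set of exponents is partially well ordered iff its `X`-part is contained in a product of
well-ordered sets, i.e. iff it is a good set. -/
theorem isPWO_iff_good {m n : ℕ} (S : Set (Expo m n)) :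
    S.IsPWO ↔ ∃ T : Fin m → Set ℝ≥0, (∀ i, (T i).IsWF) ∧ ∀ e ∈ S, ∀ i, e.1 i ∈ T i := by
  constructor
  · intro h
    refine ⟨fun i => (fun e : Expo m n => e.1 i) '' S, fun i => ?_, fun e he i => ⟨e, he, rfl⟩⟩
    exact (h.image_of_monotone (fun a b hab => hab.1 i)).isWF
  · rintro ⟨T, hT, hS⟩
    have h1 : (Set.univ.pi T).IsPWO := Set.IsPWO.pi fun i => (hT i).isPWO
    have h2 : (Set.univ : Set (Fin n → ℕ)).IsPWO := Set.isPWO_of_wellQuasiOrderedLE _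
    exact (h1.prod h2).mono fun e he => ⟨fun i _ => hS e he i, trivial⟩

/-- A polyradius `r = (s, t) ∈ (0,∞)^{m+n}`. -/
abbrev Polyradius (m n : ℕ) : Type :=
  {r : Pt m n // (∀ i, 0 < r.1 i) ∧ ∀ j, 0 < r.2 j}

/-- The set `I_{m,n,r} = ∏ [0, s_i) × ∏ (-t_j, t_j)`. -/
def box {m n : ℕ} (r : Polyradius m n) : Set (Pt m n) :=
  {p | (∀ i, 0 ≤ p.1 i ∧ p.1 i < r.1.1 i) ∧ ∀ j, |p.2 j| < r.1.2 j}

/-- Neighbourhoods of the origin in `[0,∞)^m × ℝ^n`. Two functions have the same germ at the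
origin when they are eventually equal along this filter. -/
def atOrigin (m n : ℕ) : Filter (Pt m n) := 𝓝[{p | ∀ i, 0 ≤ p.1 i}] 0

/-- The algebras `C_{m,n,r}` of real functions on the boxes `I_{m,n,r}`. A function on a box is
represented by all its extensions to `ℝ^{m+n}` (field `congr`). -/
structure FunctionAlgebras where
  alg : ∀ m n : ℕ, Polyradius m n → Subalgebra ℝ (Pt m n → ℝ)
  congr : ∀ {m n : ℕ} (r : Polyradius m n) (f g : Pt m n → ℝ),
    Set.EqOn f g (box r) → f ∈ alg m n r → g ∈ alg m n r
  continuousOn : ∀ {m n : ℕ} (r : Polyradius m n), ∀ f ∈ alg m n r, ContinuousOn f (box r)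
  contDiffOn : ∀ {m n : ℕ} (r : Polyradius m n), ∀ f ∈ alg m n r,
    ContDiffOn ℝ 1 f (interior (box r))
  coord_gen : ∀ {m n : ℕ} (r : Polyradius m n) (i : Fin m), (fun p => p.1 i) ∈ alg m n r
  coord_std : ∀ {m n : ℕ} (r : Polyradius m n) (j : Fin n), (fun p => p.2 j) ∈ alg m n r
  restrict : ∀ {m n : ℕ} (r r' : Polyradius m n),
    (∀ i, r'.1.1 i ≤ r.1.1 i) → (∀ j, r'.1.2 j ≤ r.1.2 j) → alg m n r ≤ alg m n r'
  extend : ∀ {m n : ℕ} (r : Polyradius m n), ∀ f ∈ alg m n r,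
    ∃ r' : Polyradius m n, (∀ i, r.1.1 i < r'.1.1 i) ∧ (∀ j, r.1.2 j < r'.1.2 j) ∧
      ∃ g ∈ alg m n r', Set.EqOn g f (box r)
  /-- adding dummy variables: `C_{m,n,r} ⊆ C_{m+k,n+l,r'}` -/
  pad : ∀ {m n k l : ℕ} (r : Polyradius m n) (r' : Polyradius (m + k) (n + l)),
    (∀ i, r'.1.1 (Fin.castAdd k i) = r.1.1 i) → (∀ j, r'.1.2 (Fin.castAdd l j) = r.1.2 j) →
    ∀ f ∈ alg m n r,
      (fun p : Pt (m + k) (n + l) =>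
        f (fun i => p.1 (Fin.castAdd k i), fun j => p.2 (Fin.castAdd l j))) ∈
          alg (m + k) (n + l) r'
  /-- standard variables may be regarded as generalised: `C_{m,n,r} ⊆ C_{m+n,0,r}` -/
  std_to_gen : ∀ {m n : ℕ} (r : Polyradius m n) (r' : Polyradius (m + n) 0),
    (∀ i, r'.1.1 (Fin.castAdd n i) = r.1.1 i) → (∀ j, r'.1.1 (Fin.natAdd m j) = r.1.2 j) →
    ∀ f ∈ alg m n r,
      (fun p : Pt (m + n) 0 =>
        f (fun i => p.1 (Fin.castAdd n i), fun j => p.1 (Fin.natAdd m j))) ∈ alg (m + n) 0 r'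

namespace FunctionAlgebras

variable (A : FunctionAlgebras)

theorem exists_common {m n : ℕ} {f g f' g' : Pt m n → ℝ} {r s : Polyradius m n}
    (hf' : f' ∈ A.alg m n r) (hg' : g' ∈ A.alg m n s)
    (op : (Pt m n → ℝ) → (Pt m n → ℝ) → (Pt m n → ℝ))
    (hop : ∀ t : Polyradius m n, ∀ u ∈ A.alg m n t, ∀ v ∈ A.alg m n t, op u v ∈ A.alg m n t)
    (hev : op f g =ᶠ[atOrigin m n] op f' g') :
    ∃ t : Polyradius m n, ∃ h ∈ A.alg m n t, op f g =ᶠ[atOrigin m n] h := by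
  let t : Polyradius m n :=
    ⟨(fun i => min (r.1.1 i) (s.1.1 i), fun j => min (r.1.2 j) (s.1.2 j)),
      fun i => lt_min (r.2.1 i) (s.2.1 i), fun j => lt_min (r.2.2 j) (s.2.2 j)⟩
  refine ⟨t, op f' g', hop t _ ?_ _ ?_, hev⟩
  · exact A.restrict r t (fun i => min_le_left _ _) (fun j => min_le_left _ _) hf'
  · exact A.restrict s t (fun i => min_le_right _ _) (fun j => min_le_right _ _) hg'

/-- The functions whose germ at the origin belongs to the algebra of germs `C_{m,n}`. -/
def germ (m n : ℕ) : Subalgebra ℝ (Pt m n → ℝ) where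
  carrier := {f | ∃ r : Polyradius m n, ∃ g ∈ A.alg m n r, f =ᶠ[atOrigin m n] g}
  add_mem' := by
    rintro f g ⟨r, f', hf', hf⟩ ⟨s, g', hg', hg⟩
    exact A.exists_common hf' hg' (fun u v => u + v)
      (fun t u hu v hv => add_mem hu hv) (hf.add hg)
  mul_mem' := by
    rintro f g ⟨r, f', hf', hf⟩ ⟨s, g', hg', hg⟩
    exact A.exists_common hf' hg' (fun u v => u * v)
      (fun t u hu v hv => mul_mem hu hv) (hf.mul hg)
  algebraMap_mem' := fun c =>
    ⟨⟨(fun _ => 1, fun _ => 1), fun _ => one_pos, fun _ => one_pos⟩, _,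
      Subalgebra.algebraMap_mem _ c, Filter.EventuallyEq.rfl⟩

end FunctionAlgebras

/-- Quasianalytic algebras of germs: an injective algebra morphism `T` from germs to series. -/
structure QuasianalyticAlgebras extends FunctionAlgebras where
  T : ∀ m n : ℕ, toFunctionAlgebras.germ m n →ₐ[ℝ] Series m n
  /-- `T f` depends only on the germ of `f` -/
  T_congr : ∀ {m n : ℕ} (f g : toFunctionAlgebras.germ m n),
    f.1 =ᶠ[atOrigin m n] g.1 → T m n f = T m n g
  /-- quasianalyticity -/
  T_injective : ∀ {m n : ℕ} (f g : toFunctionAlgebras.germ m n),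
    T m n f = T m n g → f.1 =ᶠ[atOrigin m n] g.1
  T_coord_gen : ∀ {m n : ℕ} (i : Fin m),
    ∃ h : (fun p => p.1 i) ∈ toFunctionAlgebras.germ m n,
      T m n ⟨_, h⟩ = HahnSeries.single (Pi.single i 1, 0) 1
  T_coord_std : ∀ {m n : ℕ} (j : Fin n),
    ∃ h : (fun p => p.2 j) ∈ toFunctionAlgebras.germ m n,
      T m n ⟨_, h⟩ = HahnSeries.single (0, Pi.single j 1) 1
  /-- `T_{m+k,n+l}` extends `T_{m,n}` -/
  T_pad : ∀ {m n k l : ℕ} (f : toFunctionAlgebras.germ m n),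
    ∃ h : (fun p : Pt (m + k) (n + l) =>
        f.1 (fun i => p.1 (Fin.castAdd k i), fun j => p.2 (Fin.castAdd l j))) ∈
          toFunctionAlgebras.germ (m + k) (n + l),
      ∀ e : Expo (m + k) (n + l), (T (m + k) (n + l) ⟨_, h⟩).coeff e =
        if (∀ i, e.1 (Fin.natAdd m i) = 0) ∧ (∀ j, e.2 (Fin.natAdd n j) = 0) then
          (T m n f).coeff (fun i => e.1 (Fin.castAdd k i), fun j => e.2 (Fin.castAdd l j))
        else 0

/-- The exponent of `X^a Y^b Z^q`, for `Z` a standard variable placed after `Y`. -/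
def zStd {m n : ℕ} (e : Expo m n) (q : ℕ) : Expo m (n + 1) :=
  (e.1, Fin.snoc (α := fun _ => ℕ) e.2 q)

/-- The exponent of `X^a Y^b Z^q`, for `Z` a generalised variable placed after `X`. -/
def zGen {m n : ℕ} (e : Expo m n) (q : ℝ≥0) : Expo (m + 1) n :=
  (Fin.snoc (α := fun _ => ℝ≥0) e.1 q, e.2)

def embStd (m n : ℕ) : Expo m n ↪o Expo m (n + 1) where
  toFun e := zStd e 0
  inj' := fun a b h => by
    have h1 := congrArg Prod.fst h
    have h2 := congrArg (fun u : Expo m (n + 1) => Fin.init (α := fun _ => ℕ) u.2) h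
    simp only [zStd, Fin.init_snoc] at h1 h2
    exact Prod.ext h1 h2
  map_rel_iff' := by
    intro a b
    simp only [Function.Embedding.coeFn_mk, zStd, Prod.le_def, Pi.le_def, Fin.forall_fin_succ',
      Fin.snoc_castSucc, Fin.snoc_last, le_refl, and_true]

def embGen (m n : ℕ) : Expo m n ↪o Expo (m + 1) n where
  toFun e := zGen e 0
  inj' := fun a b h => by
    have h1 := congrArg Prod.snd h
    have h2 := congrArg (fun u : Expo (m + 1) n => Fin.init (α := fun _ => ℝ≥0) u.1) h
    simp only [zGen, Fin.init_snoc] at h1 h2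
    exact Prod.ext h2 h1
  map_rel_iff' := by
    intro a b
    simp only [Function.Embedding.coeFn_mk, zGen, Prod.le_def, Pi.le_def, Fin.forall_fin_succ',
      Fin.snoc_castSucc, Fin.snoc_last, le_refl, and_true]

/-- A series in `(X, Y)` as a series in `(X, Y, Z)`, with `Z` standard. -/
def liftStd {m n : ℕ} (F : Series m n) : Series m (n + 1) := HahnSeries.embDomain (embStd m n) F

/-- A series in `(X, Y)` as a series in `(X, Y, Z)`, with `Z` generalised. -/
def liftGen {m n : ℕ} (F : Series m n) : Series (m + 1) n := HahnSeries.embDomain (embGen m n) F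

/-- The series `Y_j`. -/
def varStd (m : ℕ) {n : ℕ} (j : Fin n) : Series m n := HahnSeries.single (0, Pi.single j 1) 1

/-- The exponents of the powers of `Y_1` in a ring with at least one standard variable. -/
def embFirst (m n : ℕ) : ℕ ↪o Expo m (n + 1) where
  toFun k := (0, Pi.single 0 k)
  inj' := fun a b h => by
    simpa using congrArg (fun u : Expo m (n + 1) => u.2 0) h
  map_rel_iff' := by
    intro a b
    change ((0 : Fin m → ℝ≥0) ≤ 0 ∧ (Pi.single 0 a : Fin (n + 1) → ℕ) ≤ Pi.single 0 b) ↔ a ≤ b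
    simp

/-- The binomial series `(l + Y_1)^a = ∑_k (a choose k) l^{a-k} Y_1^k`, for `l > 0`. -/
def binomSeries (m n : ℕ) (l : ℝ) (a : ℝ≥0) : Series m (n + 1) :=
  HahnSeries.embDomain (embFirst m n) (HahnSeries.toPowerSeries.symm
    (PowerSeries.mk fun k : ℕ =>
      (∏ i ∈ Finset.range k, ((a : ℝ) - i)) / (Nat.factorial k : ℝ) * l ^ ((a : ℝ) - k)))

namespace QuasianalyticAlgebras

variable (A : QuasianalyticAlgebras)

/-- The set of admissible exponents. -/
def admissibleExponents : Set ℝ≥0 :=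
  {a | ∃ (m n : ℕ) (f : A.germ m n) (e : Expo m n), (A.T m n f).coeff e ≠ 0 ∧
    ((∃ i, e.1 i = a) ∨ ∃ j, (e.2 j : ℝ≥0) = a)}

open Classical in
/-- The exponent set `𝕂`: the nonnegative elements of the field generated by the admissible
exponents, unless the admissible exponents are exactly the natural numbers; then `𝕂 = ℕ`. -/
def K : Set ℝ≥0 :=
  if A.admissibleExponents = Set.range (fun k : ℕ => (k : ℝ≥0)) then
    Set.range (fun k : ℕ => (k : ℝ≥0))
  else {a | (a : ℝ) ∈ Subfield.closure ((fun b : ℝ≥0 => (b : ℝ)) '' A.admissibleExponents)}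

/-- Elementary transformations `(x', y') ↦ (x, y)`. The indices `m' n' m n` are the numbers of
generalised and standard variables of the source and of the target. -/
inductive Elem : ℕ → ℕ → ℕ → ℕ → Type
  /-- `x_i = x_i'^γ` -/
  | ramification {m n : ℕ} (i : Fin m) (γ : ℝ≥0) (hK : γ ∈ A.K) (hpos : 0 < γ) : Elem m n m n
  /-- `y_n = y_n' + H(x', y_1', …, y_{n-1}')`, where `H(0) = 0` -/
  | tschirnhausen {m n : ℕ} (H : A.germ m n) (h0 : H.1 0 = 0) : Elem m (n + 1) m (n + 1)
  /-- `y_k = y_k' + c_k y_i'` for `k < i` -/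
  | linear {m n : ℕ} (i : Fin n) (c : Fin n → ℝ) : Elem m n m n
  /-- `π_{i,j}^l`, for `j < i` and `l ∈ (0,∞)`: `x_i = x_j' (l + y_1')` -/
  | blowUp {m n : ℕ} (i : Fin (m + 1)) (j : Fin m) (hji : j.castSucc < i) (l : ℝ) (hl : 0 < l) :
      Elem m (n + 1) (m + 1) n
  /-- `π_{i,j}^0 = π_{j,i}^∞`: `x_i = x_j' x_i'` -/
  | blowUpZero {m n : ℕ} (i j : Fin m) (hij : i ≠ j) : Elem m n m n
  /-- `π_{m+i,j}^l`, for `l ∈ ℝ`: `y_i = x_j' (l + y_i')` -/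
  | blowUpStd {m n : ℕ} (i : Fin n) (j : Fin m) (l : ℝ) : Elem m n m n
  /-- `π_{m+i,j}^{±∞}`: `x_j = x_{m+1}' x_j'`, `y_i = ± x_{m+1}'` -/
  | blowUpInfty {m n : ℕ} (s : ℤˣ) (i : Fin (n + 1)) (j : Fin m) : Elem (m + 1) n m (n + 1)
  /-- `σ_{m+i}^±`: `y_i = ± x_{m+1}'` -/
  | reflection {m n : ℕ} (s : ℤˣ) (i : Fin (n + 1)) : Elem (m + 1) n m (n + 1)

variable {A}

/-- The map `(x', y') ↦ (x, y)`. -/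
def Elem.toMap {m' n' m n : ℕ} : A.Elem m' n' m n → Pt m' n' → Pt m n
  | .ramification i γ _ _, p => (Function.update p.1 i (p.1 i ^ (γ : ℝ)), p.2)
  | .tschirnhausen H _, p =>
      (p.1, Function.update p.2 (Fin.last _)
        (p.2 (Fin.last _) + H.1 (p.1, Fin.init (α := fun _ => ℝ) p.2)))
  | .linear i c, p => (p.1, fun k => if k < i then p.2 k + c k * p.2 i else p.2 k)
  | .blowUp i j _ l _, p =>
      (i.insertNth (α := fun _ => ℝ) (p.1 j * (l + p.2 0)) p.1, Fin.tail (α := fun _ => ℝ) p.2)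
  | .blowUpZero i j _, p => (Function.update p.1 i (p.1 j * p.1 i), p.2)
  | .blowUpStd i j l, p => (p.1, Function.update p.2 i (p.1 j * (l + p.2 i)))
  | .blowUpInfty s i j, p =>
      (Function.update (Fin.init (α := fun _ => ℝ) p.1) j
          (p.1 (Fin.last _) * p.1 j.castSucc),
        i.insertNth (α := fun _ => ℝ) (((s : ℤ) : ℝ) * p.1 (Fin.last _)) p.2)
  | .reflection s i, p =>
      (Fin.init (α := fun _ => ℝ) p.1,
        i.insertNth (α := fun _ => ℝ) (((s : ℤ) : ℝ) * p.1 (Fin.last _)) p.2)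

/-- The series obtained from the monomial `X^a Y^b`, `e = (a, b)`, by the substitution. -/
def Elem.mono {m' n' m n : ℕ} : A.Elem m' n' m n → Expo m n → Series m' n'
  | .ramification i γ _ _, e =>
      HahnSeries.single (Function.update e.1 i (γ * e.1 i), e.2) 1
  | .tschirnhausen (m := m) (n := n) H _, e =>
      (HahnSeries.single (e.1, Function.update e.2 (Fin.last n) 0) 1 : Series m (n + 1)) *
        (varStd m (Fin.last n) + liftStd (A.T m n H)) ^ e.2 (Fin.last n)
  | .linear (m := m) (n := n) i c, e =>
      (HahnSeries.single (e.1, 0) 1 : Series m n) *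
        ∏ k, (if k < i then varStd m k + c k • varStd m i else varStd m k) ^ e.2 k
  | .blowUp (m := m) (n := n) i j _ l _, e =>
      (HahnSeries.single
          ((fun k => e.1 (i.succAbove k)) + Pi.single j (e.1 i),
            Fin.cons (α := fun _ => ℕ) 0 e.2) 1 : Series m (n + 1)) *
        binomSeries m n l (e.1 i)
  | .blowUpZero i j _, e => HahnSeries.single (Function.update e.1 j (e.1 j + e.1 i), e.2) 1
  | .blowUpStd (m := m) (n := n) i j l, e =>
      (HahnSeries.single (e.1 + Pi.single j (e.2 i : ℝ≥0), Function.update e.2 i 0) 1 :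
          Series m n) *
        (HahnSeries.C l + varStd m i) ^ e.2 i
  | .blowUpInfty s i j, e =>
      HahnSeries.single
        (Fin.snoc (α := fun _ => ℝ≥0) e.1 (e.1 j + (e.2 i : ℝ≥0)), fun k => e.2 (i.succAbove k))
        (((s : ℤ) : ℝ) ^ e.2 i)
  | .reflection s i, e =>
      HahnSeries.single
        (Fin.snoc (α := fun _ => ℝ≥0) e.1 (e.2 i : ℝ≥0), fun k => e.2 (i.succAbove k))
        (((s : ℤ) : ℝ) ^ e.2 i)

/-- The coefficients of `F ∘ ν = ∑_e c_e (X^a Y^b ∘ ν)`, where `c` are the coefficients of `F`.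
When the support of `c` is good, only finitely many terms contribute to each coefficient. -/
def Elem.pull {m' n' m n : ℕ} (ν : A.Elem m' n' m n) (c : Expo m n → ℝ) : Expo m' n' → ℝ :=
  fun e' => ∑ᶠ e, c e * (ν.mono e).coeff e'

variable (A)

/-- Admissible transformations: finite compositions `ν_1 ∘ … ∘ ν_k` of elementary
transformations (the empty composition being the identity). -/
inductive Adm : ℕ → ℕ → ℕ → ℕ → Type
  | refl (m n : ℕ) : Adm m n m n
  | comp {m'' n'' m' n' m n : ℕ} (ν : A.Elem m' n' m n) (ρ : Adm m'' n'' m' n') : Adm m'' n'' m n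

variable {A}

/-- The coefficients of `F ∘ ρ`, where `c` are the coefficients of `F`. -/
def Adm.pull {m' n' m n : ℕ} : A.Adm m' n' m n → (Expo m n → ℝ) → (Expo m' n' → ℝ)
  | .refl _ _, c => c
  | .comp ν ρ, c => ρ.pull (ν.pull c)

variable (A)

/-- An elementary transformation with target the space of the variables `(x, y)`. -/
structure ElemTo (m n : ℕ) where
  {m' n' : ℕ}
  map : A.Elem m' n' m n

/-- An admissible transformation with target the space of the variables `(x, y)`. -/
structure AdmTo (m n : ℕ) where
  {m' n' : ℕ}
  map : A.Adm m' n' m n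

/-- Elementary families. -/
inductive IsElementaryFamily : ∀ {m n : ℕ}, Set (A.ElemTo m n) → Prop
  | ramification {m n : ℕ} (i : Fin m) (γ : ℝ≥0) (hK : γ ∈ A.K) (hpos : 0 < γ) :
      IsElementaryFamily (m := m) (n := n) {⟨.ramification i γ hK hpos⟩}
  | reflection {m n : ℕ} (i : Fin (n + 1)) :
      IsElementaryFamily (m := m) (Set.range fun s : ℤˣ => ⟨.reflection s i⟩)
  | tschirnhausen {m n : ℕ} (H : A.germ m n) (h0 : H.1 0 = 0) :
      IsElementaryFamily {⟨.tschirnhausen H h0⟩}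
  | linear {m n : ℕ} (i : Fin n) (c : Fin n → ℝ) :
      IsElementaryFamily (m := m) {⟨.linear i c⟩}
  | blowUp {m n : ℕ} (i : Fin (m + 1)) (j : Fin m) (hji : j.castSucc < i) :
      IsElementaryFamily (n := n)
        (Set.range (fun l : {l : ℝ // 0 < l} => ⟨.blowUp i j hji l.1 l.2⟩) ∪
          {⟨.blowUpZero i j.castSucc hji.ne'⟩, ⟨.blowUpZero j.castSucc i hji.ne⟩})
  | blowUpStd {m n : ℕ} (i : Fin (n + 1)) (j : Fin m) :
      IsElementaryFamily
        (Set.range (fun l : ℝ => ⟨.blowUpStd i j l⟩) ∪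
          Set.range (fun s : ℤˣ => ⟨.blowUpInfty s i j⟩))

/-- Admissible families: the trivial family `{id}`, and the families
`{ν ∘ ρ' : ν ∈ E, ρ' ∈ 𝓕 ν}` with `E` elementary and every `𝓕 ν` admissible. -/
inductive IsAdmissibleFamily : ∀ {m n : ℕ}, Set (A.AdmTo m n) → Prop
  | refl (m n : ℕ) : IsAdmissibleFamily {⟨.refl m n⟩}
  | step {m n : ℕ} (E : Set (A.ElemTo m n)) (hE : A.IsElementaryFamily E)
      (𝓕 : ∀ ν : A.ElemTo m n, Set (A.AdmTo ν.m' ν.n'))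
      (h : ∀ ν ∈ E, IsAdmissibleFamily (𝓕 ν)) :
      IsAdmissibleFamily {ρ | ∃ ν ∈ E, ∃ ρ' ∈ 𝓕 ν, ρ = ⟨.comp ν.map ρ'.map⟩}

/-- The algebra `Ĉ_{m,n}`, the image of `C_{m,n}` under `T`. -/
def hat (m n : ℕ) : Subalgebra ℝ (Series m n) := (A.T m n).range

/-- `F ∈ Ĉ_{m,n}` is normal if `F = X^a Y^b U` with `U` a unit of `Ĉ_{m,n}`. -/
def IsNormal {m n : ℕ} (F : Series m n) : Prop :=
  F ∈ A.hat m n ∧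
    ∃ (e : Expo m n) (U : (A.hat m n)ˣ), F = HahnSeries.single e 1 * ((U : A.hat m n) : Series m n)

/-- `F ∈ Ĉ_{m,n,1}`, with `Z` standard, has a finite presentation of order `d + 1`. -/
def HasFinitePresentationStd {m n : ℕ} (d : ℕ) (F : Series m (n + 1)) : Prop :=
  F ∈ A.hat m (n + 1) ∧
  ∃ (α : Fin (d + 1) → ℕ) (H : Fin (d + 1) → Series m n) (U : Fin (d + 1) → (A.hat m (n + 1))ˣ),
    StrictAnti α ∧ (∀ i, (α i : ℝ≥0) ∈ A.K) ∧ (∀ i, A.IsNormal (H i)) ∧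
    F = liftStd (H 0) *
      (HahnSeries.single (zStd 0 (α 0)) 1 * ((U 0 : A.hat m (n + 1)) : Series m (n + 1)) +
        ∑ i : Fin d, liftStd (H i.succ) * HahnSeries.single (zStd 0 (α i.succ)) 1 *
          ((U i.succ : A.hat m (n + 1)) : Series m (n + 1)))

/-- `F ∈ Ĉ_{m,n,1}`, with `Z` generalised, has a finite presentation of order `d + 1`. -/
def HasFinitePresentationGen {m n : ℕ} (d : ℕ) (F : Series (m + 1) n) : Prop :=
  F ∈ A.hat (m + 1) n ∧
  ∃ (α : Fin (d + 1) → ℝ≥0) (H : Fin (d + 1) → Series m n) (U : Fin (d + 1) → (A.hat (m + 1) n)ˣ),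
    StrictAnti α ∧ (∀ i, α i ∈ A.K) ∧ (∀ i, A.IsNormal (H i)) ∧
    F = liftGen (H 0) *
      (HahnSeries.single (zGen 0 (α 0)) 1 * ((U 0 : A.hat (m + 1) n) : Series (m + 1) n) +
        ∑ i : Fin d, liftGen (H i.succ) * HahnSeries.single (zGen 0 (α i.succ)) 1 *
          ((U i.succ : A.hat (m + 1) n) : Series (m + 1) n))

variable {A}

/-- `G = F ∘ ρ`, for `ρ` acting on `(X, Y)`. -/
def IsPullback {m' n' m n : ℕ} (ρ : A.Adm m' n' m n) (F : Series m n) (G : Series m' n') : Prop :=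
  G.coeff = ρ.pull F.coeff

/-- `G = F ∘ (ρ × id_Z)`, for `ρ` acting on `(X, Y)` and a standard variable `Z`: the coefficient
of each `Z^q` in `F`, a series in `(X, Y)`, is composed with `ρ`. -/
def IsPullbackStd {m' n' m n : ℕ} (ρ : A.Adm m' n' m n) (F : Series m (n + 1))
    (G : Series m' (n' + 1)) : Prop :=
  ∀ q : ℕ, (fun e => G.coeff (zStd e q)) = ρ.pull (fun e => F.coeff (zStd e q))

/-- `G = F ∘ (ρ × id_Z)`, for `ρ` acting on `(X, Y)` and a generalised variable `Z`. -/
def IsPullbackGen {m' n' m n : ℕ} (ρ : A.Adm m' n' m n) (F : Series (m + 1) n)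
    (G : Series (m' + 1) n') : Prop :=
  ∀ q : ℝ≥0, (fun e => G.coeff (zGen e q)) = ρ.pull (fun e => F.coeff (zGen e q))

variable (A)

/-- The inductive hypothesis in `N` variables: finitely many nonzero series `G_1, …, G_s` in
`Ĉ_{m,n}`, `m + n = N`, become normal and linearly ordered by division after an admissible
family. -/
def InductiveHypothesis (N : ℕ) : Prop :=
  ∀ m n : ℕ, m + n = N → ∀ (s : ℕ) (G : Fin s → Series m n),
    (∀ i, G i ∈ A.hat m n) → (∀ i, G i ≠ 0) →
    ∃ 𝓕 : Set (A.AdmTo m n), A.IsAdmissibleFamily 𝓕 ∧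
      ∀ ρ ∈ 𝓕, ∃ G' : Fin s → Series ρ.m' ρ.n',
        (∀ i, IsPullback ρ.map (G i) (G' i)) ∧ (∀ i, A.IsNormal (G' i)) ∧
        ∀ i j, G' i ∣ G' j ∨ G' j ∣ G' i

end QuasianalyticAlgebras

/-- Generalised quasianalytic classes. -/
structure GeneralisedQuasianalyticClass extends QuasianalyticAlgebras where
  /-- real powers with exponents in `𝕂` -/
  rpow : ∀ {m : ℕ} (i : Fin m), ∀ a ∈ toQuasianalyticAlgebras.K,
    ∃ h : (fun p : Pt m 0 => p.1 i ^ (a : ℝ)) ∈ toFunctionAlgebras.germ m 0,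
      T m 0 ⟨_, h⟩ = HahnSeries.single (Pi.single i a, 0) 1
  /-- permutations of the generalised and of the standard variables -/
  perm : ∀ {m n : ℕ} (σ : Equiv.Perm (Fin m)) (τ : Equiv.Perm (Fin n)) (f : toFunctionAlgebras.germ m n),
    ∃ h : (fun p : Pt m n => f.1 (fun i => p.1 (σ i), fun j => p.2 (τ j))) ∈ toFunctionAlgebras.germ m n,
      ∀ e : Expo m n, (T m n ⟨_, h⟩).coeff e =
        (T m n f).coeff (fun i => e.1 (σ i), fun j => e.2 (τ j))
  /-- setting a generalised variable equal to zero -/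
  zero_gen : ∀ {m n : ℕ} (i : Fin (m + 1)) (f : toFunctionAlgebras.germ (m + 1) n),
    ∃ h : (fun p : Pt m n => f.1 (i.insertNth (α := fun _ => ℝ) 0 p.1, p.2)) ∈ toFunctionAlgebras.germ m n,
      ∀ e : Expo m n, (T m n ⟨_, h⟩).coeff e =
        (T (m + 1) n f).coeff (i.insertNth (α := fun _ => ℝ≥0) 0 e.1, e.2)
  /-- setting a standard variable equal to zero -/
  zero_std : ∀ {m n : ℕ} (j : Fin (n + 1)) (f : toFunctionAlgebras.germ m (n + 1)),
    ∃ h : (fun p : Pt m n => f.1 (p.1, j.insertNth (α := fun _ => ℝ) 0 p.2)) ∈ toFunctionAlgebras.germ m n,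
      ∀ e : Expo m n, (T m n ⟨_, h⟩).coeff e =
        (T m (n + 1) f).coeff (e.1, j.insertNth (α := fun _ => ℕ) 0 e.2)
  /-- division by a power of a generalised variable -/
  div_gen : ∀ {m n : ℕ} (f : toFunctionAlgebras.germ m n) (i : Fin m), ∀ a ∈ toQuasianalyticAlgebras.K,
    ∀ G : Series m n, T m n f = HahnSeries.single (Pi.single i a, 0) 1 * G →
      ∃ g : toFunctionAlgebras.germ m n, f.1 =ᶠ[atOrigin m n] fun p => p.1 i ^ (a : ℝ) * g.1 p
  /-- division by a power of a standard variable -/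
  div_std : ∀ {m n : ℕ} (f : toFunctionAlgebras.germ m n) (j : Fin n) (k : ℕ) (G : Series m n),
    T m n f = HahnSeries.single (0, Pi.single j k) 1 * G →
      ∃ g : toFunctionAlgebras.germ m n, f.1 =ᶠ[atOrigin m n] fun p => p.2 j ^ k * g.1 p
  /-- elementary transformations -/
  elem : ∀ {m' n' m n : ℕ} (ν : toQuasianalyticAlgebras.Elem m' n' m n) (f : toFunctionAlgebras.germ m n),
    ∃ h : (fun p => f.1 (ν.toMap p)) ∈ toFunctionAlgebras.germ m' n',
      (T m' n' ⟨_, h⟩).coeff = ν.pull (T m n f).coeff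
  /-- implicit functions in the standard variables -/
  implicit : ∀ {m n : ℕ} (f : toFunctionAlgebras.germ m (n + 1)), f.1 0 = 0 →
    deriv (fun t : ℝ => f.1 (0, Pi.single (Fin.last n) t)) 0 ≠ 0 →
    ∃ g : toFunctionAlgebras.germ m n, g.1 0 = 0 ∧
      ∀ᶠ p in atOrigin m n, f.1 (p.1, Fin.snoc (α := fun _ => ℝ) p.2 (g.1 p)) = 0
  /-- truncation with respect to the last generalised variable -/
  truncation : ∀ {m n : ℕ} (f : toFunctionAlgebras.germ (m + 1) n) (a : ℝ≥0),
    ∃ g : toFunctionAlgebras.germ (m + 1) n, ∀ e : Expo (m + 1) n, (T (m + 1) n g).coeff e =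
      if e.1 (Fin.last m) < a then (T (m + 1) n f).coeff e else 0

end GenQA

end

open scoped NNReal Topology Pointwise
set_option linter.unusedSectionVars false

noncomputable section

namespace GenQA

section Substitution

variable {Γ Γ' : Type*} [AddCommMonoid Γ] [PartialOrder Γ] [IsOrderedCancelAddMonoid Γ]
  [AddCommMonoid Γ'] [PartialOrder Γ'] [IsOrderedCancelAddMonoid Γ']

/-- A family of series indexed by exponents that can be substituted for the monomials. -/
structure IsSubst (mono : Γ → HahnSeries Γ' ℝ) : Prop where
  map_zero : mono 0 = 1
  map_add : ∀ a b, mono (a + b) = mono a * mono b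
  isPWO : ∀ S : Set Γ, S.IsPWO → (⋃ e ∈ S, (mono e).support).IsPWO
  finite : ∀ S : Set Γ, S.IsPWO → ∀ e', {e ∈ S | (mono e).coeff e' ≠ 0}.Finite

namespace IsSubst

variable {mono : Γ → HahnSeries Γ' ℝ} (h : IsSubst mono)
include h

/-- The summable family of the terms of the substituted series. -/
def family (f : HahnSeries Γ ℝ) : HahnSeries.SummableFamily Γ' ℝ Γ where
  toFun e := f.coeff e • mono e
  isPWO_iUnion_support' := by
    refine (h.isPWO f.support f.isPWO_support).mono ?_
    intro e' he'
    obtain ⟨e, he⟩ := Set.mem_iUnion.1 he'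
    rw [HahnSeries.mem_support, HahnSeries.coeff_smul] at he
    simp only [Set.mem_iUnion]
    exact ⟨e, left_ne_zero_of_smul he, right_ne_zero_of_smul he⟩
  finite_co_support' e' := by
    refine (h.finite f.support f.isPWO_support e').subset ?_
    intro e he
    rw [Set.mem_ofPred_eq, HahnSeries.coeff_smul] at he
    exact ⟨left_ne_zero_of_smul he, right_ne_zero_of_smul he⟩

theorem family_apply (f : HahnSeries Γ ℝ) (e : Γ) : h.family f e = f.coeff e • mono e := rfl

theorem coeff_hsum_family (f : HahnSeries Γ ℝ) (e' : Γ') :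
    (h.family f).hsum.coeff e' = ∑ᶠ e, f.coeff e * (mono e).coeff e' := by
  rw [HahnSeries.SummableFamily.coeff_hsum]
  simp only [family_apply, HahnSeries.coeff_smul, smul_eq_mul]

theorem hsum_family_single (a : Γ) (c : ℝ) :
    (h.family (HahnSeries.single a c)).hsum = c • mono a := by
  ext e'
  rw [coeff_hsum_family, finsum_eq_single _ a]
  · simp
  · intro e he
    rw [HahnSeries.coeff_single_of_ne he, zero_mul]

theorem hsum_family_mul (f g : HahnSeries Γ ℝ) :
    (h.family (f * g)).hsum = (h.family f).hsum * (h.family g).hsum := by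
  classical
  rw [← HahnSeries.SummableFamily.hsum_mul]
  ext e'
  rw [coeff_hsum_family, HahnSeries.SummableFamily.coeff_hsum]
  have hS : (f.support + g.support).IsPWO := f.isPWO_support.add g.isPWO_support
  set T := (h.finite _ hS e').toFinset with hT
  have hmem : ∀ c, c ∈ T ↔ c ∈ f.support + g.support ∧ (mono c).coeff e' ≠ 0 := by
    intro c; simp [hT]
  rw [finsum_eq_sum_of_support_subset (s := T)]
  swap
  · intro c hc
    rw [Function.mem_support] at hc
    rw [Finset.mem_coe, hmem]
    exact ⟨HahnSeries.support_mul_subset (left_ne_zero_of_mul hc), right_ne_zero_of_mul hc⟩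
  rw [finsum_eq_sum_of_support_subset (s := T.biUnion fun c =>
    Finset.antidiagonal f.isPWO_support g.isPWO_support c)]
  · rw [Finset.sum_biUnion]
    · refine Finset.sum_congr rfl fun c _ => ?_
      rw [HahnSeries.coeff_mul, Finset.sum_mul]
      refine Finset.sum_congr rfl fun p hp => ?_
      rw [Finset.mem_antidiagonal] at hp
      rw [HahnSeries.SummableFamily.mul_toFun, family_apply, family_apply, smul_mul_smul_comm,
        ← h.map_add, hp.2.2, HahnSeries.coeff_smul, smul_eq_mul]
    · intro c _ c' _ hcc
      rw [Function.onFun, Finset.disjoint_left]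
      intro p hp hp'
      rw [Finset.mem_antidiagonal] at hp hp'
      exact hcc (hp.2.2.symm.trans hp'.2.2)
  · intro p hp
    rw [Function.mem_support, HahnSeries.SummableFamily.mul_toFun, family_apply, family_apply,
      smul_mul_smul_comm, ← h.map_add, HahnSeries.coeff_smul] at hp
    have h1 := left_ne_zero_of_smul hp
    have h2 := right_ne_zero_of_smul hp
    simp only [Finset.coe_biUnion, Set.mem_iUnion, Finset.mem_coe, Finset.mem_antidiagonal]
    refine ⟨p.1 + p.2, (hmem _).2 ⟨Set.add_mem_add ?_ ?_, h2⟩, ?_, ?_, rfl⟩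
    · exact left_ne_zero_of_mul h1
    · exact right_ne_zero_of_mul h1
    · exact left_ne_zero_of_mul h1
    · exact right_ne_zero_of_mul h1

/-- The algebra morphism `∑ c_e X^e ↦ ∑ c_e mono e`. -/
def hom : HahnSeries Γ ℝ →ₐ[ℝ] HahnSeries Γ' ℝ where
  toFun f := (h.family f).hsum
  map_one' := by
    change (h.family (HahnSeries.single 0 1)).hsum = 1
    rw [hsum_family_single, h.map_zero, one_smul]
  map_mul' := h.hsum_family_mul
  map_zero' := by
    ext e'
    rw [coeff_hsum_family]
    simp
  map_add' f g := by
    rw [← HahnSeries.SummableFamily.hsum_add]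
    congr 1
    ext e e'
    simp [family_apply, add_mul]
  commutes' r := by
    change (h.family (HahnSeries.single 0 r)).hsum = _
    rw [hsum_family_single, h.map_zero, Algebra.algebraMap_eq_smul_one]

theorem coeff_hom (f : HahnSeries Γ ℝ) (e' : Γ') :
    (h.hom f).coeff e' = ∑ᶠ e, f.coeff e * (mono e).coeff e' :=
  h.coeff_hsum_family f e'

theorem exists_of_coeff_hom_ne {f : HahnSeries Γ ℝ} {e' : Γ'} (hf : (h.hom f).coeff e' ≠ 0) :
    ∃ e, f.coeff e ≠ 0 ∧ (mono e).coeff e' ≠ 0 := by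
  by_contra hcon
  push Not at hcon
  apply hf
  rw [coeff_hom]
  refine finsum_eq_zero_of_forall_eq_zero fun e => ?_
  by_cases he : f.coeff e = 0
  · rw [he, zero_mul]
  · rw [hcon e he, mul_zero]

end IsSubst

theorem IsSubst.mk' {mono : Γ → HahnSeries Γ' ℝ} (h0 : mono 0 = 1)
    (hadd : ∀ a b, mono (a + b) = mono a * mono b) (φ : Γ → Γ') (hφ : Monotone φ)
    (T : Set Γ') (hT : T.IsPWO)
    (hsupp : ∀ e e', (mono e).coeff e' ≠ 0 → ∃ t ∈ T, φ e + t = e')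
    (hfin : ∀ S : Set Γ, S.IsPWO → ∀ x e', {e ∈ S | φ e = x ∧ (mono e).coeff e' ≠ 0}.Finite) :
    IsSubst mono where
  map_zero := h0
  map_add := hadd
  isPWO S hS := by
    refine ((hS.image_of_monotone hφ).add hT).mono ?_
    intro e' he'
    simp only [Set.mem_iUnion] at he'
    obtain ⟨e, heS, he⟩ := he'
    obtain ⟨t, ht, rfl⟩ := hsupp e e' he
    exact Set.add_mem_add (Set.mem_image_of_mem _ heS) ht
  finite S hS e' := by
    have hfinA : (Set.antidiagonal (φ '' S) T e').Finite :=
      Set.AddAntidiagonal.finite_of_isPWO (hS.image_of_monotone hφ) hT e'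
    refine (hfinA.biUnion (fun p _ => hfin S hS p.1 e')).subset ?_
    rintro e ⟨heS, he⟩
    obtain ⟨t, ht, hte⟩ := hsupp e e' he
    simp only [Set.mem_iUnion]
    exact ⟨(φ e, t), ⟨Set.mem_image_of_mem _ heS, ht, hte⟩, heS, rfl, he⟩

/-- The fibres of a map that is injective on chains are finite on partially well-ordered sets. -/
theorem finite_fiber_of_isPWO {Γ Γ' : Type*} [PartialOrder Γ] {φ : Γ → Γ'}
    (hφ : ∀ a b, a ≤ b → φ a = φ b → a = b) {S : Set Γ} (hS : S.IsPWO) (x : Γ') :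
    {e ∈ S | φ e = x}.Finite := by
  by_contra hinf
  have hinf : {e ∈ S | φ e = x}.Infinite := hinf
  obtain ⟨g, hg⟩ := hS.exists_monotone_subseq (f := fun k => (hinf.natEmbedding _ k : Γ))
    (fun k => (hinf.natEmbedding _ k).2.1)
  have h01 := hφ _ _ (hg (Nat.zero_le 1)) (((hinf.natEmbedding _ (g 0)).2.2).trans
    ((hinf.natEmbedding _ (g 1)).2.2).symm)
  have := g.injective ((hinf.natEmbedding _).injective (Subtype.ext h01))
  omega

end Substitution

/-- The sum of all the components of an exponent. -/
def wt {m n : ℕ} (e : Expo m n) : ℝ≥0 := ∑ i, e.1 i + ∑ j, (e.2 j : ℝ≥0)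

theorem wt_add {m n : ℕ} (a b : Expo m n) : wt (a + b) = wt a + wt b := by
  simp only [wt, Prod.fst_add, Prod.snd_add, Pi.add_apply, Finset.sum_add_distrib, Nat.cast_add]
  ring

theorem wt_mono {m n : ℕ} : Monotone (wt : Expo m n → ℝ≥0) := by
  intro a b h
  refine add_le_add (Finset.sum_le_sum fun i _ => h.1 i) (Finset.sum_le_sum fun j _ => ?_)
  exact_mod_cast h.2 j

theorem le_wt_fst {m n : ℕ} (e : Expo m n) (i : Fin m) : e.1 i ≤ wt e :=
  (Finset.single_le_sum (f := fun i => e.1 i) (fun _ _ => zero_le) (Finset.mem_univ i)).trans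
    le_self_add

theorem le_wt_snd {m n : ℕ} (e : Expo m n) (j : Fin n) : (e.2 j : ℝ≥0) ≤ wt e :=
  (Finset.single_le_sum (f := fun j => (e.2 j : ℝ≥0)) (fun _ _ => zero_le)
    (Finset.mem_univ j)).trans le_add_self

theorem wt_eq_zero {m n : ℕ} {e : Expo m n} (h : wt e = 0) : e = 0 := by
  refine Prod.ext (funext fun i => ?_) (funext fun j => ?_)
  · exact le_antisymm ((le_wt_fst e i).trans_eq h) zero_le
  · exact_mod_cast le_antisymm ((le_wt_snd e j).trans_eq h) zero_le

theorem eq_of_le_of_wt_eq {m n : ℕ} {a b : Expo m n} (h : a ≤ b) (hw : wt a = wt b) : a = b := by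
  obtain ⟨c, rfl⟩ := exists_add_of_le h
  rw [wt_add] at hw
  rw [wt_eq_zero (left_eq_add.1 hw), add_zero]

theorem exists_wt_lower_bound {m n : ℕ} {S : Set (Expo m n)} (hS : S.IsPWO) (h0 : 0 ∉ S) :
    ∃ δ : ℝ≥0, 0 < δ ∧ ∀ e ∈ S, δ ≤ wt e := by
  rcases S.eq_empty_or_nonempty with rfl | hne
  · exact ⟨1, one_pos, fun e he => he.elim⟩
  · have hw : (wt '' S).IsWF := (hS.image_of_monotone wt_mono).isWF
    refine ⟨hw.min (hne.image _), ?_, fun e he => hw.min_le _ (Set.mem_image_of_mem _ he)⟩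
    obtain ⟨e, he, hee⟩ := hw.min_mem (hne.image _)
    rw [← hee]
    refine pos_iff_ne_zero.2 fun h => h0 ?_
    rwa [wt_eq_zero h] at he

theorem monotone_of_additive {m n m' n' : ℕ} {φ : Expo m n → Expo m' n'}
    (hφ : ∀ a b, φ (a + b) = φ a + φ b) : Monotone φ := by
  intro a b h
  obtain ⟨c, rfl⟩ := exists_add_of_le h
  rw [hφ]
  exact le_self_add

theorem coeff_single_ne_zero {Γ : Type*} [PartialOrder Γ] {a b : Γ} {c : ℝ}
    (h : (HahnSeries.single a c : HahnSeries Γ ℝ).coeff b ≠ 0) : b = a := by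
  by_contra hne
  exact h (HahnSeries.coeff_single_of_ne hne)

theorem isSubst_single {m n m' n' : ℕ} (φ : Expo m n → Expo m' n') (χ : Expo m n → ℝ)
    (h0 : φ 0 = 0) (hφ : ∀ a b, φ (a + b) = φ a + φ b) (hinj : Function.Injective φ)
    (hχ0 : χ 0 = 1) (hχ : ∀ a b, χ (a + b) = χ a * χ b) :
    IsSubst fun e => (HahnSeries.single (φ e) (χ e) : Series m' n') := by
  refine IsSubst.mk' ?_ ?_ φ (monotone_of_additive hφ) {0} (Set.isPWO_singleton 0) ?_ ?_
  · rw [h0, hχ0]; rfl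
  · intro a b
    rw [HahnSeries.single_mul_single, hφ, hχ]
  · intro e e' h
    exact ⟨0, rfl, by rw [coeff_single_ne_zero h, add_zero]⟩
  · intro S hS x e'
    refine (Set.Subsingleton.finite (s := {e | φ e = x}) ?_).subset fun e he => he.2.1
    intro a ha b hb
    exact hinj (ha.trans hb.symm)

theorem snoc_add {M : Type*} [Add M] {n : ℕ} (a b : Fin n → M) (x y : M) :
    (Fin.snoc (α := fun _ => M) (a + b) (x + y) : Fin (n + 1) → M) =
      Fin.snoc (α := fun _ => M) a x + Fin.snoc (α := fun _ => M) b y := by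
  ext k
  refine Fin.lastCases ?_ (fun k => ?_) k <;> simp

theorem cons_add {M : Type*} [Add M] {n : ℕ} (a b : Fin n → M) (x y : M) :
    (Fin.cons (α := fun _ => M) (x + y) (a + b) : Fin (n + 1) → M) =
      Fin.cons (α := fun _ => M) x a + Fin.cons (α := fun _ => M) y b := by
  ext k
  refine Fin.cases ?_ (fun k => ?_) k <;> simp

theorem snoc_zero_zero {M : Type*} [Zero M] {n : ℕ} :
    (Fin.snoc (α := fun _ => M) (0 : Fin n → M) (0 : M) : Fin (n + 1) → M) = 0 := by
  ext k
  refine Fin.lastCases ?_ (fun k => ?_) k <;> simp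

theorem cons_zero_zero {M : Type*} [Zero M] {n : ℕ} :
    (Fin.cons (α := fun _ => M) (0 : M) (0 : Fin n → M) : Fin (n + 1) → M) = 0 := by
  ext k
  refine Fin.cases ?_ (fun k => ?_) k <;> simp

theorem isPWO_fst_eq_zero {m n : ℕ} : {e : Expo m n | e.1 = 0}.IsPWO := by
  have h : (Set.univ : Set (Fin n → ℕ)).IsPWO := Set.isPWO_of_wellQuasiOrderedLE _
  refine (h.image_of_monotone (f := fun b => ((0 : Fin m → ℝ≥0), b)) ?_).mono ?_
  · exact fun a b hab => ⟨le_rfl, hab⟩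
  · intro e he
    exact ⟨e.2, trivial, Prod.ext he.symm rfl⟩

variable {A : QuasianalyticAlgebras}

theorem isSubst_ramification {m n : ℕ} (i : Fin m) (γ : ℝ≥0) (hK : γ ∈ A.K) (hpos : 0 < γ) :
    IsSubst (QuasianalyticAlgebras.Elem.ramification (n := n) i γ hK hpos).mono := by
  refine isSubst_single _ (fun _ => 1) ?_ ?_ ?_ rfl (fun _ _ => (one_mul 1).symm)
  · simp
  · intro a b
    refine Prod.ext (funext fun k => ?_) rfl
    by_cases hk : k = i
    · subst hk; simp [mul_add]
    · simp [hk]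
  · intro a b hab
    simp only [Prod.mk.injEq] at hab
    refine Prod.ext (funext fun k => ?_) hab.2
    have := congrFun hab.1 k
    by_cases hk : k = i
    · subst hk; simpa [hpos.ne'] using this
    · simpa [hk] using this

theorem isSubst_blowUpZero {m n : ℕ} (i j : Fin m) (hij : i ≠ j) :
    IsSubst (QuasianalyticAlgebras.Elem.blowUpZero (A := A) (n := n) i j hij).mono := by
  refine isSubst_single _ (fun _ => 1) ?_ ?_ ?_ rfl (fun _ _ => (one_mul 1).symm)
  · simp
  · intro a b
    refine Prod.ext (funext fun k => ?_) rfl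
    by_cases hk : k = j
    · subst hk; simp; ring
    · simp [hk]
  · intro a b hab
    simp only [Prod.mk.injEq] at hab
    have hi : a.1 i = b.1 i := by simpa [hij] using congrFun hab.1 i
    refine Prod.ext (funext fun k => ?_) hab.2
    have := congrFun hab.1 k
    by_cases hk : k = j
    · subst hk; simpa [hi] using this
    · simpa [hk] using this

theorem succAbove_ext {M : Type*} {n : ℕ} {i : Fin (n + 1)} {a b : Fin (n + 1) → M}
    (hi : a i = b i) (h : ∀ k, a (i.succAbove k) = b (i.succAbove k)) : a = b := by
  ext k
  rcases Fin.eq_self_or_eq_succAbove i k with rfl | ⟨k, rfl⟩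
  · exact hi
  · exact h k

theorem isSubst_blowUpInfty {m n : ℕ} (s : ℤˣ) (i : Fin (n + 1)) (j : Fin m) :
    IsSubst (QuasianalyticAlgebras.Elem.blowUpInfty (A := A) s i j).mono := by
  refine isSubst_single _ (fun e => (((s : ℤ) : ℝ) ^ e.2 i)) ?_ ?_ ?_ ?_ ?_
  · exact Prod.ext (by simpa using snoc_zero_zero) rfl
  · intro a b
    refine Prod.ext ?_ rfl
    dsimp only [Prod.fst_add, Prod.snd_add]
    rw [← snoc_add]
    congr 1
    simp; ring
  · intro a b hab
    simp only [Prod.mk.injEq] at hab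
    have h1 : a.1 = b.1 := by
      have := congrArg (Fin.init (α := fun _ => ℝ≥0)) hab.1
      simpa only [Fin.init_snoc] using this
    have h2 : a.2 i = b.2 i := by
      have := congrFun hab.1 (Fin.last _)
      simpa [h1] using this
    exact Prod.ext h1 (succAbove_ext h2 fun k => congrFun hab.2 k)
  · simp
  · intro a b; exact pow_add _ _ _

theorem isSubst_reflection {m n : ℕ} (s : ℤˣ) (i : Fin (n + 1)) :
    IsSubst (QuasianalyticAlgebras.Elem.reflection (A := A) (m := m) s i).mono := by
  refine isSubst_single _ (fun e => (((s : ℤ) : ℝ) ^ e.2 i)) ?_ ?_ ?_ ?_ ?_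
  · exact Prod.ext (by simpa using snoc_zero_zero) rfl
  · intro a b
    refine Prod.ext ?_ rfl
    dsimp only [Prod.fst_add, Prod.snd_add]
    rw [← snoc_add]
    congr 1
    simp
  · intro a b hab
    simp only [Prod.mk.injEq] at hab
    have h1 : a.1 = b.1 := by
      have := congrArg (Fin.init (α := fun _ => ℝ≥0)) hab.1
      simpa only [Fin.init_snoc] using this
    have h2 : a.2 i = b.2 i := by
      have := congrFun hab.1 (Fin.last _)
      simpa using this
    exact Prod.ext h1 (succAbove_ext h2 fun k => congrFun hab.2 k)
  · simp
  · intro a b; exact pow_add _ _ _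

/-- A product of a monomial and another series has its support in a translate. -/
theorem exists_add_of_coeff_single_mul {Γ : Type*} [AddCommMonoid Γ] [PartialOrder Γ]
    [IsOrderedCancelAddMonoid Γ] {a e : Γ} {c : ℝ} {f : HahnSeries Γ ℝ}
    (h : (HahnSeries.single a c * f).coeff e ≠ 0) : ∃ t, f.coeff t ≠ 0 ∧ a + t = e := by
  have h1 : e ∈ (HahnSeries.single a c * f).support := h
  obtain ⟨x, hx, t, ht, rfl⟩ := Set.mem_add.1 (HahnSeries.support_mul_subset h1)
  exact ⟨t, ht, by rw [HahnSeries.eq_of_mem_support_single hx]⟩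

theorem binomSeries_eq (m n : ℕ) {l : ℝ} (hl : 0 < l) (a : ℝ≥0) :
    binomSeries m n l a = HahnSeries.embDomain (embFirst m n) (HahnSeries.toPowerSeries.symm
      (PowerSeries.C (l ^ (a : ℝ)) *
        PowerSeries.rescale l⁻¹ (PowerSeries.binomialSeries ℝ (a : ℝ)))) := by
  rw [binomSeries]
  congr 2
  ext k
  rw [PowerSeries.coeff_mk, PowerSeries.coeff_C_mul, PowerSeries.coeff_rescale,
    PowerSeries.binomialSeries_coeff, smul_eq_mul, mul_one, Real.rpow_sub hl, Real.rpow_natCast]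
  have h1 : (Nat.factorial k : ℝ) * Ring.choose (a : ℝ) k = ∏ i ∈ Finset.range k, ((a : ℝ) - i) := by
    rw [← descPochhammer_eval_eq_prod_range, ← nsmul_eq_mul,
      ← Ring.descPochhammer_eq_factorial_smul_choose, ← Polynomial.aeval_eq_smeval,
      Polynomial.aeval_def, Polynomial.eval₂_eq_eval_map, descPochhammer_map]
  rw [← h1, inv_pow]
  have : (Nat.factorial k : ℝ) ≠ 0 := by positivity
  field_simp

theorem embFirst_add (m n : ℕ) (a b : ℕ) : embFirst m n (a + b) = embFirst m n a + embFirst m n b := by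
  refine Prod.ext (add_zero _).symm ?_
  exact Pi.single_add (f := fun _ => ℕ) (0 : Fin (n + 1)) a b

theorem binomSeries_add (m n : ℕ) {l : ℝ} (hl : 0 < l) (a b : ℝ≥0) :
    binomSeries m n l (a + b) = binomSeries m n l a * binomSeries m n l b := by
  rw [binomSeries_eq m n hl, binomSeries_eq m n hl, binomSeries_eq m n hl,
    ← HahnSeries.embDomain_mul _ (embFirst_add m n), ← map_mul]
  congr 2
  rw [NNReal.coe_add, PowerSeries.binomialSeries_add, Real.rpow_add hl, map_mul, map_mul]
  ring

theorem binomSeries_zero (m n : ℕ) {l : ℝ} (hl : 0 < l) : binomSeries m n l 0 = 1 := by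
  rw [binomSeries_eq m n hl, NNReal.coe_zero, PowerSeries.binomialSeries_zero, Real.rpow_zero,
    map_one, map_one, one_mul, map_one]
  exact HahnSeries.embDomain_one _ (Prod.ext rfl (Pi.single_zero _))

theorem fst_eq_zero_of_coeff_binomSeries {m n : ℕ} {l : ℝ} {a : ℝ≥0} {e : Expo m (n + 1)}
    (h : (binomSeries m n l a).coeff e ≠ 0) : ∃ k, e = embFirst m n k := by
  by_contra hcon
  push Not at hcon
  exact h (HahnSeries.embDomain_of_notMem_range fun ⟨k, hk⟩ => hcon k hk.symm)

theorem coeff_binomSeries (m n : ℕ) (l : ℝ) (a : ℝ≥0) (k : ℕ) :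
    (binomSeries m n l a).coeff (embFirst m n k) =
      (∏ i ∈ Finset.range k, ((a : ℝ) - i)) / (Nat.factorial k : ℝ) * l ^ ((a : ℝ) - k) := by
  rw [binomSeries, HahnSeries.embDomain_coeff, HahnSeries.coeff_toPowerSeries_symm,
    PowerSeries.coeff_mk]

theorem sum_pi_single_cast {m : ℕ} (j : Fin m) (x : ℝ≥0) :
    ∑ k, (Pi.single j x : Fin m → ℝ≥0) k = x := by
  simp

theorem isSubst_blowUp {m n : ℕ} (i : Fin (m + 1)) (j : Fin m) (hji : j.castSucc < i) (l : ℝ)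
    (hl : 0 < l) :
    IsSubst (QuasianalyticAlgebras.Elem.blowUp (A := A) (n := n) i j hji l hl).mono := by
  set φ : Expo (m + 1) n → Expo m (n + 1) := fun e =>
    ((fun k => e.1 (i.succAbove k)) + Pi.single j (e.1 i), Fin.cons (α := fun _ => ℕ) 0 e.2) with hφ
  have hadd : ∀ a b, φ (a + b) = φ a + φ b := by
    intro a b
    refine Prod.ext ?_ ?_
    · ext k
      simp only [hφ, Prod.fst_add, Pi.add_apply, Pi.single_add, NNReal.coe_add]
      ring
    · change (Fin.cons (α := fun _ => ℕ) (0 + 0) (a.2 + b.2) : Fin (n + 1) → ℕ) = _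
      rw [cons_add]; rfl
  have h0 : φ 0 = 0 := by
    refine Prod.ext ?_ ?_
    · ext k; simp [hφ]
    · exact cons_zero_zero
  have hwt : ∀ e, wt (φ e) = wt e := by
    intro e
    simp only [wt, hφ, Pi.add_apply, Finset.sum_add_distrib, Fin.sum_univ_succ (n := n),
      Fin.cons_zero, Fin.cons_succ, Nat.cast_zero, zero_add, sum_pi_single_cast,
      Fin.sum_univ_succAbove (fun k => e.1 k) i]
    ring
  refine IsSubst.mk' ?_ ?_ φ (monotone_of_additive hadd) {e | e.1 = 0} isPWO_fst_eq_zero ?_ ?_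
  · change HahnSeries.single (φ 0) 1 * binomSeries m n l 0 = 1
    rw [binomSeries_zero m n hl, h0, mul_one]; rfl
  · intro a b
    change HahnSeries.single (φ (a + b)) 1 * binomSeries m n l (a.1 i + b.1 i) =
      (HahnSeries.single (φ a) 1 * binomSeries m n l (a.1 i)) *
        (HahnSeries.single (φ b) 1 * binomSeries m n l (b.1 i))
    rw [binomSeries_add m n hl, hadd, mul_mul_mul_comm, HahnSeries.single_mul_single, one_mul]
  · intro e e' h
    obtain ⟨t, ht, hte⟩ := exists_add_of_coeff_single_mul (a := φ e) (c := 1) h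
    obtain ⟨k, rfl⟩ := fst_eq_zero_of_coeff_binomSeries ht
    exact ⟨_, rfl, hte⟩
  · intro S hS x e'
    refine (finite_fiber_of_isPWO (φ := φ) ?_ hS x).subset fun e he => ⟨he.1, he.2.1⟩
    intro a b hab h
    exact eq_of_le_of_wt_eq hab (by rw [← hwt a, ← hwt b, h])

section Graded

variable {Γ M : Type*} [AddCommMonoid Γ] [PartialOrder Γ] [IsOrderedCancelAddMonoid Γ]
  [AddCommMonoid M]

/-- A series is homogeneous of degree `a` for the grading `g` of the exponents. -/
def IsHomog (g : Γ →+ M) (a : M) (f : HahnSeries Γ ℝ) : Prop := ∀ e, f.coeff e ≠ 0 → g e = a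

variable {g : Γ →+ M}

theorem isHomog_single (e : Γ) (c : ℝ) : IsHomog g (g e) (HahnSeries.single e c) := by
  intro e' h
  rw [coeff_single_ne_zero h]

theorem isHomog_one : IsHomog g 0 (1 : HahnSeries Γ ℝ) := by
  rw [← g.map_zero]
  exact isHomog_single 0 1

theorem IsHomog.add {a : M} {f f' : HahnSeries Γ ℝ} (h : IsHomog g a f) (h' : IsHomog g a f') :
    IsHomog g a (f + f') := by
  intro e he
  by_contra hcon
  apply he
  rw [HahnSeries.coeff_add, not_not.1 fun h1 => hcon (h e h1), not_not.1 fun h1 => hcon (h' e h1),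
    add_zero]

theorem IsHomog.smul {a : M} {f : HahnSeries Γ ℝ} (h : IsHomog g a f) (c : ℝ) :
    IsHomog g a (c • f) := by
  intro e he
  rw [HahnSeries.coeff_smul] at he
  exact h e (right_ne_zero_of_smul he)

theorem IsHomog.mul {a b : M} {f f' : HahnSeries Γ ℝ} (h : IsHomog g a f) (h' : IsHomog g b f') :
    IsHomog g (a + b) (f * f') := by
  intro e he
  obtain ⟨x, hx, y, hy, rfl⟩ := Set.mem_add.1 (HahnSeries.support_mul_subset he)
  rw [map_add, h x hx, h' y hy]

theorem IsHomog.pow {a : M} {f : HahnSeries Γ ℝ} (h : IsHomog g a f) (k : ℕ) :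
    IsHomog g (k • a) (f ^ k) := by
  induction k with
  | zero => rw [pow_zero, zero_nsmul]; exact isHomog_one
  | succ k ih => rw [pow_succ, succ_nsmul]; exact ih.mul h

theorem IsHomog.prod {ι : Type*} (s : Finset ι) {a : ι → M} {f : ι → HahnSeries Γ ℝ}
    (h : ∀ i, IsHomog g (a i) (f i)) : IsHomog g (∑ i ∈ s, a i) (∏ i ∈ s, f i) := by
  classical
  induction s using Finset.induction_on with
  | empty => exact isHomog_one
  | insert i s hi ih => rw [Finset.sum_insert hi, Finset.prod_insert hi]; exact (h i).mul ih

end Graded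

/-- The bidegree: exponents of the generalised variables, total degree in the standard ones. -/
def bideg (m n : ℕ) : Expo m n →+ (Fin m → ℝ≥0) × ℕ where
  toFun e := (e.1, ∑ j, e.2 j)
  map_zero' := by simp
  map_add' a b := by simp [Finset.sum_add_distrib]

theorem isHomog_varStd {m n : ℕ} (j : Fin n) : IsHomog (bideg m n) (0, 1) (varStd m j) := by
  have : bideg m n (0, Pi.single j 1) = (0, 1) := by simp [bideg]
  rw [← this]
  exact isHomog_single _ _

variable {A : QuasianalyticAlgebras}

/-- The linear form substituted for `Y_k` by the linear map `L_{i,c}`. -/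
def linForm (m : ℕ) {n : ℕ} (i : Fin n) (c : Fin n → ℝ) (k : Fin n) : Series m n :=
  if k < i then varStd m k + c k • varStd m i else varStd m k

theorem isHomog_linForm {m n : ℕ} (i : Fin n) (c : Fin n → ℝ) (k : Fin n) :
    IsHomog (bideg m n) (0, 1) (linForm m i c k) := by
  rw [linForm]
  split_ifs
  · exact (isHomog_varStd k).add ((isHomog_varStd i).smul _)
  · exact isHomog_varStd k

theorem isHomog_linear_mono {m n : ℕ} (i : Fin n) (c : Fin n → ℝ) (e : Expo m n) :
    IsHomog (bideg m n) (e.1, ∑ k, e.2 k)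
      ((QuasianalyticAlgebras.Elem.linear (A := A) i c).mono e) := by
  have h1 : IsHomog (bideg m n) (e.1, 0) (HahnSeries.single ((e.1, 0) : Expo m n) (1 : ℝ)) := by
    have : bideg m n (e.1, 0) = (e.1, 0) := by simp [bideg]
    rw [← this]
    exact isHomog_single _ _
  have h2 := IsHomog.prod Finset.univ fun k => (isHomog_linForm (m := m) i c k).pow (e.2 k)
  have h3 : ((e.1, ∑ k, e.2 k) : (Fin m → ℝ≥0) × ℕ) = (e.1, 0) + ∑ k, e.2 k • (0, 1) := by
    refine Prod.ext ?_ ?_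
    · simp [Prod.fst_sum]
    · simp [Prod.snd_sum]
  rw [h3]
  exact h1.mul h2

theorem isSubst_linear {m n : ℕ} (i : Fin n) (c : Fin n → ℝ) :
    IsSubst (QuasianalyticAlgebras.Elem.linear (A := A) (m := m) i c).mono := by
  refine IsSubst.mk' ?_ ?_ (fun e => (e.1, 0)) (fun a b h => ⟨h.1, le_rfl⟩) {e | e.1 = 0}
    isPWO_fst_eq_zero ?_ ?_
  · change HahnSeries.single (0 : Expo m n) (1 : ℝ) * _ = 1
    simp
  · intro a b
    change HahnSeries.single ((a.1 + b.1, 0) : Expo m n) (1 : ℝ) *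
        ∏ k, (linForm m i c k) ^ (a.2 k + b.2 k) =
      (HahnSeries.single ((a.1, 0) : Expo m n) (1 : ℝ) * ∏ k, (linForm m i c k) ^ a.2 k) *
      (HahnSeries.single ((b.1, 0) : Expo m n) (1 : ℝ) * ∏ k, (linForm m i c k) ^ b.2 k)
    rw [mul_mul_mul_comm, HahnSeries.single_mul_single, one_mul, ← Finset.prod_mul_distrib]
    simp only [pow_add]
    congr 2
  · intro e e' h
    have := isHomog_linear_mono (A := A) i c e e' h
    refine ⟨(0, e'.2), rfl, Prod.ext ?_ (zero_add _)⟩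
    exact (add_zero _).trans (congrArg Prod.fst this).symm
  · intro S hS x e'
    refine (Set.Finite.prod (Set.finite_singleton x.1)
      (Set.finite_Iic (fun _ : Fin n => ∑ k, e'.2 k))).subset ?_
    rintro e ⟨-, rfl, h⟩
    refine ⟨rfl, fun k => ?_⟩
    have := congrArg Prod.snd (isHomog_linear_mono (A := A) i c e e' h)
    change ∑ k, e'.2 k = ∑ k, e.2 k at this
    rw [this]
    exact Finset.single_le_sum (f := e.2) (fun _ _ => Nat.zero_le _) (Finset.mem_univ k)

theorem update_add_zero {n : ℕ} (a b : Fin n → ℕ) (i : Fin n) :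
    Function.update (a + b) i 0 = Function.update a i 0 + Function.update b i 0 := by
  ext k
  by_cases hk : k = i
  · subst hk; simp
  · simp [hk]

theorem isSubst_blowUpStd {m n : ℕ} (i : Fin n) (j : Fin m) (l : ℝ) :
    IsSubst (QuasianalyticAlgebras.Elem.blowUpStd (A := A) i j l).mono := by
  set φ : Expo m n → Expo m n := fun e =>
    (e.1 + Pi.single j (e.2 i : ℝ≥0), Function.update e.2 i 0) with hφ
  have hadd : ∀ a b, φ (a + b) = φ a + φ b := by
    intro a b
    refine Prod.ext ?_ (update_add_zero _ _ _)
    ext k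
    simp only [hφ, Prod.fst_add, Prod.snd_add, Pi.add_apply, Nat.cast_add, Pi.single_add,
      NNReal.coe_add]
    ring
  have h0 : φ 0 = 0 := by
    refine Prod.ext ?_ ?_
    · ext k; simp [hφ]
    · simp [hφ]
  have hwt : ∀ e, wt (φ e) = wt e := by
    intro e
    have h1 : ∑ k, ((Function.update e.2 i 0 k : ℕ) : ℝ≥0) + (e.2 i : ℝ≥0) =
        ∑ k, (e.2 k : ℝ≥0) := by
      rw [← Finset.add_sum_erase _ _ (Finset.mem_univ i),
        ← Finset.add_sum_erase Finset.univ (fun k => (e.2 k : ℝ≥0)) (Finset.mem_univ i)]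
      rw [Finset.sum_congr rfl fun k hk => by
        rw [Function.update_of_ne (Finset.ne_of_mem_erase hk)]]
      simp [add_comm]
    simp only [wt, hφ, Pi.add_apply, Finset.sum_add_distrib, sum_pi_single_cast]
    rw [← h1]
    ring
  set L : Series m n := HahnSeries.C l + varStd m i with hL
  have hLh : IsHomog (AddMonoidHom.fst (Fin m → ℝ≥0) (Fin n → ℕ)) 0 L := by
    refine IsHomog.add ?_ ?_
    · exact isHomog_single (g := AddMonoidHom.fst (Fin m → ℝ≥0) (Fin n → ℕ)) 0 l
    · exact isHomog_single (g := AddMonoidHom.fst (Fin m → ℝ≥0) (Fin n → ℕ)) (0, Pi.single i 1) 1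
  refine IsSubst.mk' ?_ ?_ φ (monotone_of_additive hadd) {e | e.1 = 0} isPWO_fst_eq_zero ?_ ?_
  · change HahnSeries.single (φ 0) 1 * L ^ 0 = 1
    rw [h0, pow_zero, mul_one]; rfl
  · intro a b
    change HahnSeries.single (φ (a + b)) 1 * L ^ (a.2 i + b.2 i) =
      (HahnSeries.single (φ a) 1 * L ^ (a.2 i)) * (HahnSeries.single (φ b) 1 * L ^ (b.2 i))
    rw [pow_add, hadd, mul_mul_mul_comm, HahnSeries.single_mul_single, one_mul]
  · intro e e' h
    obtain ⟨t, ht, hte⟩ := exists_add_of_coeff_single_mul (a := φ e) (c := 1) h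
    refine ⟨t, ?_, hte⟩
    have := hLh.pow _ t ht
    rwa [nsmul_zero] at this
  · intro S hS x e'
    refine (finite_fiber_of_isPWO (φ := φ) ?_ hS x).subset fun e he => ⟨he.1, he.2.1⟩
    intro a b hab h
    exact eq_of_le_of_wt_eq hab (by rw [← hwt a, ← hwt b, h])

theorem wt_pow_lower_bound {m n : ℕ} {f : Series m n} {δ : ℝ≥0}
    (h : ∀ e, f.coeff e ≠ 0 → δ ≤ wt e) (k : ℕ) : ∀ e, (f ^ k).coeff e ≠ 0 → k * δ ≤ wt e := by
  induction k with
  | zero => intro e _; simp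
  | succ k ih =>
    intro e he
    rw [pow_succ] at he
    obtain ⟨x, hx, y, hy, rfl⟩ := Set.mem_add.1 (HahnSeries.support_mul_subset he)
    rw [wt_add, Nat.cast_succ, add_mul, one_mul]
    exact add_le_add (ih x hx) (h y hy)

theorem isSubst_tschirnhausen {m n : ℕ} (H : A.germ m n) (h0 : H.1 0 = 0)
    (hc : (A.T m n H).coeff 0 = 0) :
    IsSubst (QuasianalyticAlgebras.Elem.tschirnhausen H h0).mono := by
  set L : Series m (n + 1) := varStd m (Fin.last n) + liftStd (A.T m n H) with hL
  set φ : Expo m (n + 1) → Expo m (n + 1) := fun e =>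
    (e.1, Function.update e.2 (Fin.last n) 0) with hφ
  have hadd : ∀ a b, φ (a + b) = φ a + φ b := by
    intro a b
    exact Prod.ext rfl (update_add_zero _ _ _)
  have hL0 : L.coeff 0 = 0 := by
    rw [hL, HahnSeries.coeff_add]
    have h1 : (varStd m (Fin.last n) : Series m (n + 1)).coeff 0 = 0 := by
      refine HahnSeries.coeff_single_of_ne fun h => ?_
      have := congrFun (congrArg Prod.snd h) (Fin.last n)
      simp at this
    have h2 : (0 : Expo m (n + 1)) = embStd m n 0 := Prod.ext rfl snoc_zero_zero.symm
    rw [h1, h2, liftStd, HahnSeries.embDomain_coeff, hc, add_zero]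
  obtain ⟨δ, hδ, hδL⟩ := exists_wt_lower_bound L.isPWO_support
    (by rw [HahnSeries.mem_support]; exact fun h => h hL0)
  refine IsSubst.mk' ?_ ?_ φ (monotone_of_additive hadd) (AddSubmonoid.closure L.support)
    (Set.IsPWO.addSubmonoid_closure (fun _ _ => zero_le) L.isPWO_support) ?_ ?_
  · change HahnSeries.single (φ 0) 1 * L ^ 0 = 1
    rw [pow_zero, mul_one, show φ 0 = 0 from Prod.ext rfl (by simp [hφ])]; rfl
  · intro a b
    change HahnSeries.single (φ (a + b)) 1 * L ^ (a.2 (Fin.last n) + b.2 (Fin.last n)) =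
      (HahnSeries.single (φ a) 1 * L ^ (a.2 (Fin.last n))) *
        (HahnSeries.single (φ b) 1 * L ^ (b.2 (Fin.last n)))
    rw [pow_add, hadd, mul_mul_mul_comm, HahnSeries.single_mul_single, one_mul]
  · intro e e' h
    obtain ⟨t, ht, hte⟩ := exists_add_of_coeff_single_mul (a := φ e) (c := 1) h
    exact ⟨t, HahnSeries.SummableFamily.support_pow_subset_closure _ _ ht, hte⟩
  · intro S hS x e'
    obtain ⟨N, hN⟩ := exists_nat_gt (wt e' / δ)
    refine ((Set.finite_Iio N).image fun k => ((x.1, Function.update x.2 (Fin.last n) k) :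
      Expo m (n + 1))).subset ?_
    rintro e ⟨-, rfl, h⟩
    refine ⟨e.2 (Fin.last n), ?_, ?_⟩
    · obtain ⟨t, ht, hte⟩ := exists_add_of_coeff_single_mul (a := φ e) (c := 1) h
      have h1 := wt_pow_lower_bound hδL _ t ht
      have h2 : (e.2 (Fin.last n) : ℝ≥0) * δ ≤ wt e' :=
        h1.trans (wt_mono (hte ▸ le_add_self))
      have h3 : (e.2 (Fin.last n) : ℝ≥0) < N := ((le_div_iff₀ hδ).2 h2).trans_lt hN
      exact_mod_cast h3
    · exact Prod.ext rfl (by simp [hφ])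

namespace QuasianalyticAlgebras

variable (A : QuasianalyticAlgebras)

theorem natCast_mem_K (k : ℕ) : (k : ℝ≥0) ∈ A.K := by
  rw [K]
  split_ifs
  · exact ⟨k, rfl⟩
  · change ((k : ℝ≥0) : ℝ) ∈ Subfield.closure _
    rw [NNReal.coe_natCast]
    exact natCast_mem _ k

theorem add_mem_K {a b : ℝ≥0} (ha : a ∈ A.K) (hb : b ∈ A.K) : a + b ∈ A.K := by
  rw [K] at *
  split_ifs at *
  · obtain ⟨k, rfl⟩ := ha
    obtain ⟨l, rfl⟩ := hb
    exact ⟨k + l, by push_cast; rfl⟩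
  · change ((a + b : ℝ≥0) : ℝ) ∈ Subfield.closure _
    rw [NNReal.coe_add]
    exact add_mem ha hb

theorem mul_mem_K {a b : ℝ≥0} (ha : a ∈ A.K) (hb : b ∈ A.K) : a * b ∈ A.K := by
  rw [K] at *
  split_ifs at *
  · obtain ⟨k, rfl⟩ := ha
    obtain ⟨l, rfl⟩ := hb
    exact ⟨k * l, by push_cast; rfl⟩
  · change ((a * b : ℝ≥0) : ℝ) ∈ Subfield.closure _
    rw [NNReal.coe_mul]
    exact mul_mem ha hb

theorem sub_mem_K {a b : ℝ≥0} (ha : a ∈ A.K) (hb : b ∈ A.K) : a - b ∈ A.K := by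
  rcases le_total a b with h | h
  · rw [tsub_eq_zero_of_le h]
    exact_mod_cast A.natCast_mem_K 0
  rw [K] at *
  split_ifs at *
  · obtain ⟨k, rfl⟩ := ha
    obtain ⟨l, rfl⟩ := hb
    refine ⟨k - l, ?_⟩
    exact Nat.cast_tsub k l
  · change ((a - b : ℝ≥0) : ℝ) ∈ Subfield.closure _
    rw [NNReal.coe_sub h]
    exact sub_mem ha hb

theorem admissibleExponents_subset_K : A.admissibleExponents ⊆ A.K := by
  intro a ha
  rw [K]
  split_ifs with h
  · exact h ▸ ha
  · exact Subfield.subset_closure ⟨a, ha, rfl⟩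

/-- The exponents with components in `𝕂`. -/
def KExpo (m n : ℕ) : AddSubmonoid (Expo m n) where
  carrier := {e | ∀ i, e.1 i ∈ A.K}
  zero_mem' i := by exact_mod_cast A.natCast_mem_K 0
  add_mem' ha hb i := A.add_mem_K (ha i) (hb i)

/-- Tame monoids of exponents: partially well ordered, with components in `𝕂`. -/
structure Tame {m n : ℕ} (M : AddSubmonoid (Expo m n)) : Prop where
  isPWO : (M : Set (Expo m n)).IsPWO
  le_K : M ≤ A.KExpo m n

variable {A}

theorem tame_closure {m n : ℕ} {S : Set (Expo m n)} (hS : S.IsPWO) (hK : S ⊆ A.KExpo m n) :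
    A.Tame (AddSubmonoid.closure S) :=
  ⟨Set.IsPWO.addSubmonoid_closure (fun _ _ => zero_le) hS, (AddSubmonoid.closure_le).2 hK⟩

end QuasianalyticAlgebras

open QuasianalyticAlgebras

namespace GeneralisedQuasianalyticClass

variable (C : GeneralisedQuasianalyticClass)

theorem coeff_zero_T_zero_zero (f : C.germ 0 0) : (C.T 0 0 f).coeff 0 = f.1 0 := by
  have h1 : C.T 0 0 f = C.T 0 0 (algebraMap ℝ _ (f.1 0)) := by
    refine C.T_congr _ _ (Filter.Eventually.of_forall fun p => ?_)
    change f.1 p = f.1 0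
    rw [Subsingleton.elim p 0]
  rw [h1, AlgHom.commutes, HahnSeries.algebraMap_apply, Algebra.algebraMap_self_apply,
    HahnSeries.C_apply, HahnSeries.coeff_single_same]

theorem insertNth_zero_zero {M : Type*} [Zero M] {n : ℕ} (i : Fin (n + 1)) :
    (i.insertNth (α := fun _ => M) 0 (0 : Fin n → M) : Fin (n + 1) → M) = 0 := by
  refine succAbove_ext (i := i) ?_ fun k => ?_ <;> simp

theorem coeff_zero_T {m n : ℕ} (f : C.germ m n) : (C.T m n f).coeff 0 = f.1 0 := by
  induction m with
  | zero =>
    induction n with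
    | zero => exact C.coeff_zero_T_zero_zero f
    | succ n ih =>
      obtain ⟨h, hT⟩ := C.zero_std 0 f
      have := ih ⟨_, h⟩
      rw [hT] at this
      simpa only [Prod.snd_zero, Prod.fst_zero, insertNth_zero_zero, Prod.mk_zero_zero] using this
  | succ m ih =>
    obtain ⟨h, hT⟩ := C.zero_gen 0 f
    have := ih ⟨_, h⟩
    rw [hT] at this
    simpa only [Prod.snd_zero, Prod.fst_zero, insertNth_zero_zero, Prod.mk_zero_zero] using this

variable {C}

theorem isSubst {m' n' m n : ℕ} (ν : C.Elem m' n' m n) : IsSubst ν.mono := by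
  cases ν with
  | ramification i γ hK hpos => exact isSubst_ramification i γ hK hpos
  | tschirnhausen H h0 => exact isSubst_tschirnhausen H h0 ((C.coeff_zero_T H).trans h0)
  | linear i c => exact isSubst_linear i c
  | blowUp i j hji l hl => exact isSubst_blowUp i j hji l hl
  | blowUpZero i j hij => exact isSubst_blowUpZero i j hij
  | blowUpStd i j l => exact isSubst_blowUpStd i j l
  | blowUpInfty s i j => exact isSubst_blowUpInfty s i j
  | reflection s i => exact isSubst_reflection s i

/-- The substitution morphism `F ↦ F ∘ ν` on all series. -/
def elemHom {m' n' m n : ℕ} (ν : C.Elem m' n' m n) : Series m n →ₐ[ℝ] Series m' n' :=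
  (isSubst ν).hom

theorem coeff_elemHom {m' n' m n : ℕ} (ν : C.Elem m' n' m n) (f : Series m n) :
    (elemHom ν f).coeff = ν.pull f.coeff :=
  funext fun e' => (isSubst ν).coeff_hom f e'

/-- The substitution morphism `F ↦ F ∘ ρ` on all series. -/
def admHom {m' n' m n : ℕ} : C.Adm m' n' m n → (Series m n →ₐ[ℝ] Series m' n')
  | .refl _ _ => AlgHom.id ℝ _
  | .comp ν ρ => (admHom ρ).comp (elemHom ν)

theorem coeff_admHom {m' n' m n : ℕ} (ρ : C.Adm m' n' m n) (f : Series m n) :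
    (admHom ρ f).coeff = ρ.pull f.coeff := by
  induction ρ with
  | refl => rfl
  | comp ν ρ ih =>
    change (admHom ρ (elemHom ν f)).coeff = ρ.pull (ν.pull f.coeff)
    rw [ih, coeff_elemHom]

/-- The elementary transformations used to make a family of series finitely generated. -/
inductive IsToric : ∀ {m' n' m n : ℕ}, C.Elem m' n' m n → Prop
  | ramification {m n : ℕ} (i : Fin m) (γ : ℝ≥0) (hK : γ ∈ C.K) (hpos : 0 < γ) :
      IsToric (n := n) (.ramification i γ hK hpos)
  | linear {m n : ℕ} (i : Fin n) (c : Fin n → ℝ) : IsToric (m := m) (.linear i c)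
  | blowUp {m n : ℕ} (i : Fin (m + 1)) (j : Fin m) (hji : j.castSucc < i) (l : ℝ) (hl : 0 < l) :
      IsToric (n := n) (.blowUp i j hji l hl)
  | blowUpZero {m n : ℕ} (i j : Fin m) (hij : i ≠ j) : IsToric (n := n) (.blowUpZero i j hij)

theorem IsToric.eq_zero {m' n' m n : ℕ} {ν : C.Elem m' n' m n} (hν : IsToric ν) {e : Expo m n}
    (h : (ν.mono e).coeff 0 ≠ 0) : e = 0 := by
  cases hν with
  | ramification i γ hK hpos =>
    have h := coeff_single_ne_zero h
    refine Prod.ext (funext fun k => ?_) (congrArg Prod.snd h).symm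
    have := congrFun (congrArg Prod.fst h) k
    by_cases hk : k = i
    · subst hk; simpa [hpos.ne'] using this
    · simpa [hk] using this.symm
  | linear i c =>
    have h := isHomog_linear_mono i c e 0 h
    rw [map_zero] at h
    refine Prod.ext (congrArg Prod.fst h).symm (funext fun k => ?_)
    have h2 : 0 = ∑ k, e.2 k := (congrArg Prod.snd h)
    exact (Finset.sum_eq_zero_iff.1 h2.symm) k (Finset.mem_univ k)
  | blowUp i j hji l hl =>
    obtain ⟨t, ht, hte⟩ := exists_add_of_coeff_single_mul h
    have h1 := (add_eq_zero.1 hte).1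
    refine Prod.ext (succAbove_ext (i := i) ?_ fun k => ?_) (funext fun k => ?_)
    · have := congrFun (congrArg Prod.fst h1) j
      simpa using (add_eq_zero.1 this).2
    · have := congrFun (congrArg Prod.fst h1) k
      exact (add_eq_zero.1 this).1
    · exact congrFun (congrArg Prod.snd h1) k.succ
  | blowUpZero i j hij =>
    have h := coeff_single_ne_zero h
    refine Prod.ext (funext fun k => ?_) (congrArg Prod.snd h).symm
    have := congrFun (congrArg Prod.fst h) k
    by_cases hk : k = j
    · subst hk
      simp only [Prod.fst_zero, Pi.zero_apply, Function.update_self] at this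
      exact (add_eq_zero.1 this.symm).1
    · simpa [hk] using this.symm

theorem IsToric.coeff_zero {m' n' m n : ℕ} {ν : C.Elem m' n' m n} (hν : IsToric ν)
    (f : Series m n) : (elemHom ν f).coeff 0 = f.coeff 0 := by
  rw [elemHom, IsSubst.coeff_hom, finsum_eq_single _ 0]
  · rw [(isSubst ν).map_zero, HahnSeries.coeff_one, if_pos rfl, mul_one]
  · intro e he
    rw [not_not.1 fun h => he (hν.eq_zero h), mul_zero]

theorem IsToric.mem_KExpo {m' n' m n : ℕ} {ν : C.Elem m' n' m n} (hν : IsToric ν) {e : Expo m n}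
    (he : e ∈ C.KExpo m n) {e' : Expo m' n'} (h : (ν.mono e).coeff e' ≠ 0) :
    e' ∈ C.KExpo m' n' := by
  cases hν with
  | ramification i γ hK hpos =>
    rw [coeff_single_ne_zero h]
    intro k
    by_cases hk : k = i
    · subst hk; simpa using C.mul_mem_K hK (he k)
    · simpa [hk] using he k
  | linear i c =>
    have h := isHomog_linear_mono i c e e' h
    intro k
    have h1 : (bideg _ _ e').1 = e.1 := congrArg Prod.fst h
    change e'.1 = e.1 at h1
    rw [h1]
    exact he k
  | blowUp i j hji l hl =>
    obtain ⟨t, ht, rfl⟩ := exists_add_of_coeff_single_mul h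
    obtain ⟨d, rfl⟩ := fst_eq_zero_of_coeff_binomSeries ht
    intro k
    change e.1 (i.succAbove k) + (Pi.single j (e.1 i) : _ → ℝ≥0) k + 0 ∈ C.K
    rw [add_zero]
    refine C.add_mem_K (he _) ?_
    by_cases hk : k = j
    · subst hk; simpa using he _
    · simpa [hk] using C.natCast_mem_K 0
  | blowUpZero i j hij =>
    rw [coeff_single_ne_zero h]
    intro k
    by_cases hk : k = j
    · subst hk; simpa using C.add_mem_K (he k) (he i)
    · simpa [hk] using he k

/-- A morphism of series rings that preserves tameness of families and constant terms. -/
structure TameHom {m n m' n' : ℕ} (θ : Series m n →ₐ[ℝ] Series m' n') : Prop where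
  exists_tame : ∀ M : AddSubmonoid (Expo m n), C.Tame M → ∃ M' : AddSubmonoid (Expo m' n'),
    C.Tame M' ∧ ∀ f : Series m n, f.support ⊆ M → (θ f).support ⊆ M'
  coeff_zero : ∀ f, (θ f).coeff 0 = f.coeff 0

theorem TameHom.id {m n : ℕ} : TameHom (C := C) (AlgHom.id ℝ (Series m n)) :=
  ⟨fun M hM => ⟨M, hM, fun _ h => h⟩, fun _ => rfl⟩

theorem TameHom.comp {m n m' n' m'' n'' : ℕ} {θ : Series m n →ₐ[ℝ] Series m' n'}
    {θ' : Series m' n' →ₐ[ℝ] Series m'' n''} (h' : TameHom (C := C) θ') (h : TameHom (C := C) θ) :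
    TameHom (C := C) (θ'.comp θ) := by
  refine ⟨fun M hM => ?_, fun f => (h'.coeff_zero _).trans (h.coeff_zero _)⟩
  obtain ⟨M₁, hM₁, h₁⟩ := h.exists_tame M hM
  obtain ⟨M₂, hM₂, h₂⟩ := h'.exists_tame M₁ hM₁
  exact ⟨M₂, hM₂, fun f hf => h₂ _ (h₁ f hf)⟩

theorem IsToric.tameHom {m' n' m n : ℕ} {ν : C.Elem m' n' m n} (hν : IsToric ν) :
    TameHom (C := C) (elemHom ν) := by
  refine ⟨fun M hM => ?_, hν.coeff_zero⟩
  refine ⟨_, tame_closure ((isSubst ν).isPWO M hM.isPWO) ?_, ?_⟩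
  · intro e' he'
    simp only [Set.mem_iUnion] at he'
    obtain ⟨e, heM, he⟩ := he'
    exact hν.mem_KExpo (hM.le_K heM) he
  · intro f hf e' he'
    obtain ⟨e, he1, he2⟩ := (isSubst ν).exists_of_coeff_hom_ne he'
    refine AddSubmonoid.subset_closure ?_
    simp only [Set.mem_iUnion]
    exact ⟨e, hf he1, he2⟩

variable (C)

/-- The elementary families formed by toric transformations. -/
inductive IsToricFamily : ∀ {m n : ℕ}, Set (C.ElemTo m n) → Prop
  | ramification {m n : ℕ} (i : Fin m) (γ : ℝ≥0) (hK : γ ∈ C.K) (hpos : 0 < γ) :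
      IsToricFamily (m := m) (n := n) {⟨.ramification i γ hK hpos⟩}
  | linear {m n : ℕ} (i : Fin n) (c : Fin n → ℝ) :
      IsToricFamily (m := m) {⟨.linear i c⟩}
  | blowUp {m n : ℕ} (i : Fin (m + 1)) (j : Fin m) (hji : j.castSucc < i) :
      IsToricFamily (n := n)
        (Set.range (fun l : {l : ℝ // 0 < l} => ⟨.blowUp i j hji l.1 l.2⟩) ∪
          {⟨.blowUpZero i j.castSucc hji.ne'⟩, ⟨.blowUpZero j.castSucc i hji.ne⟩})

variable {C}

theorem IsToricFamily.isElementaryFamily {m n : ℕ} {E : Set (C.ElemTo m n)}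
    (h : C.IsToricFamily E) : C.IsElementaryFamily E := by
  cases h with
  | ramification i γ hK hpos => exact .ramification i γ hK hpos
  | linear i c => exact .linear i c
  | blowUp i j hji => exact .blowUp i j hji

theorem IsToricFamily.isToric {m n : ℕ} {E : Set (C.ElemTo m n)} (h : C.IsToricFamily E) :
    ∀ ν ∈ E, IsToric ν.map := by
  cases h with
  | ramification i γ hK hpos => rintro ν rfl; exact .ramification i γ hK hpos
  | linear i c => rintro ν rfl; exact .linear i c
  | blowUp i j hji =>
    rintro ν (⟨l, rfl⟩ | rfl | rfl)
    · exact .blowUp i j hji _ _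
    · exact .blowUpZero _ _ _
    · exact .blowUpZero _ _ _

/-- Properties of morphisms with a given source. -/
abbrev HomProp (m n : ℕ) : Type := ∀ m' n' : ℕ, (Series m n →ₐ[ℝ] Series m' n') → Prop

variable (C)

/-- `Q` holds after an admissible family of toric transformations. -/
inductive After : ∀ {m n : ℕ}, HomProp m n → Prop
  | base {m n : ℕ} {Q : HomProp m n} (h : Q m n (AlgHom.id ℝ _)) : After Q
  | step {m n : ℕ} {Q : HomProp m n} (E : Set (C.ElemTo m n)) (hE : C.IsToricFamily E)
      (h : ∀ ν ∈ E, After fun m' n' θ => Q m' n' (θ.comp (elemHom ν.map))) : After Q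

variable {C}

theorem After.bind {m n : ℕ} {P : HomProp m n} (h : C.After P) : ∀ {Q : HomProp m n},
    (∀ m' n' θ, TameHom (C := C) θ → P m' n' θ → C.After fun m'' n'' θ' => Q m'' n'' (θ'.comp θ)) →
    C.After Q := by
  induction h with
  | base h => intro Q hQ; exact hQ _ _ _ TameHom.id h
  | step E hE h ih =>
    intro Q hQ
    refine .step E hE fun ν hν => ih ν hν fun m' n' θ hθ hP => ?_
    exact hQ m' n' (θ.comp (elemHom ν.map)) (hθ.comp (hE.isToric ν hν).tameHom) hP

theorem After.mono {m n : ℕ} {P Q : HomProp m n} (h : C.After P)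
    (hPQ : ∀ m' n' θ, TameHom (C := C) θ → P m' n' θ → Q m' n' θ) : C.After Q :=
  h.bind fun m' n' θ hθ hP => .base (hPQ m' n' θ hθ hP)

theorem After.exists_family {m n : ℕ} {Q : HomProp m n} (h : C.After Q) :
    ∃ 𝓕 : Set (C.AdmTo m n), C.IsAdmissibleFamily 𝓕 ∧
      ∀ ρ ∈ 𝓕, Q ρ.m' ρ.n' (admHom ρ.map) := by
  classical
  induction h with
  | @base m n Q h => exact ⟨_, .refl m n, by rintro ρ rfl; exact h⟩
  | step E hE h ih =>
    choose! 𝓕 hF hQ using ih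
    refine ⟨_, .step E hE.isElementaryFamily 𝓕 hF, ?_⟩
    rintro ρ ⟨ν, hν, ρ', hρ', rfl⟩
    exact hQ ν hν ρ' hρ'

end GeneralisedQuasianalyticClass

section Reindex

variable {Γ Γ' : Type*} [PartialOrder Γ] [PartialOrder Γ']

/-- The series with coefficients `e ↦ f_{φ e}`, for a map `φ` with a monotone left inverse. -/
def reindex (φ : Γ → Γ') (ψ : Γ' → Γ) (hψ : Monotone ψ) (h : ∀ e, ψ (φ e) = e) :
    HahnSeries Γ' ℝ →ₗ[ℝ] HahnSeries Γ ℝ where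
  toFun f :=
    { coeff := fun e => f.coeff (φ e)
      isPWO_support' := (f.isPWO_support.image_of_monotone hψ).mono fun e he => ⟨φ e, he, h e⟩ }
  map_add' _ _ := rfl
  map_smul' _ _ := rfl

open Classical in
/-- The part of a series formed by the exponents satisfying `p`. -/
def restrictExp (p : Γ → Prop) : HahnSeries Γ ℝ →ₗ[ℝ] HahnSeries Γ ℝ where
  toFun f :=
    { coeff := fun e => if p e then f.coeff e else 0
      isPWO_support' := f.isPWO_support.mono fun e he => by
        rw [Function.mem_support] at he
        exact (ite_ne_right_iff.1 he).2 }
  map_add' f g := by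
    ext e
    by_cases h : p e <;> simp [h]
  map_smul' c f := by
    ext e
    by_cases h : p e <;> simp [h]

open Classical in
theorem coeff_restrictExp (p : Γ → Prop) (f : HahnSeries Γ ℝ) (e : Γ) :
    (restrictExp p f).coeff e = if p e then f.coeff e else 0 := rfl

theorem of_coeff_restrictExp_ne {p : Γ → Prop} {f : HahnSeries Γ ℝ} {e : Γ}
    (h : (restrictExp p f).coeff e ≠ 0) : p e ∧ f.coeff e ≠ 0 := by
  classical
  rw [coeff_restrictExp] at h
  exact ite_ne_right_iff.1 h

end Reindex

section Perturbation

variable {Γ : Type*} [PartialOrder Γ]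

/-- All exponents of `f` have weight at least `t`. -/
def WtGE (w : Γ → ℝ≥0) (t : ℝ≥0) (f : HahnSeries Γ ℝ) : Prop := ∀ e, f.coeff e ≠ 0 → t ≤ w e

theorem WtGE.coeff_eq_zero {w : Γ → ℝ≥0} {t : ℝ≥0} {f : HahnSeries Γ ℝ} (h : WtGE w t f) {e : Γ}
    (he : w e < t) : f.coeff e = 0 :=
  not_not.1 fun hne => (h e hne).not_gt he

variable {w : Γ → ℝ≥0} {δ : ℝ≥0} (hδ : 0 < δ) (L : HahnSeries Γ ℝ →+ HahnSeries Γ ℝ)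
  (hL : ∀ f t, WtGE w t f → WtGE w (t + δ) (L f))
include hδ hL

theorem eq_zero_of_add_map_eq_zero {g : HahnSeries Γ ℝ} (h : g + L g = 0) : g = 0 := by
  have hg : ∀ s : ℕ, WtGE w (s * δ) g := by
    intro s
    induction s with
    | zero => intro e _; simp
    | succ s ih =>
      have h1 := hL g _ ih
      intro e he
      have h2 : g = -L g := eq_neg_of_add_eq_zero_left h
      rw [h2, HahnSeries.coeff_neg] at he
      have := h1 e (neg_ne_zero.1 he)
      rw [Nat.cast_succ, add_mul, one_mul]
      exact this
  ext e
  obtain ⟨s, hs⟩ := exists_nat_gt (w e / δ)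
  exact (hg s).coeff_eq_zero ((div_lt_iff₀ hδ).1 hs)

theorem exists_add_map_eq {S : Set Γ} (hS : S.IsPWO)
    (hLS : ∀ f : HahnSeries Γ ℝ, f.support ⊆ S → (L f).support ⊆ S)
    {c : HahnSeries Γ ℝ} (hc : c.support ⊆ S) :
    ∃ g : HahnSeries Γ ℝ, g.support ⊆ S ∧ g + L g = c := by
  let u : ℕ → HahnSeries Γ ℝ := fun s => (fun f => -L f)^[s] c
  have hu0 : u 0 = c := rfl
  have hus : ∀ s, u (s + 1) = -L (u s) := fun s => Function.iterate_succ_apply' _ _ _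
  have huS : ∀ s, (u s).support ⊆ S := by
    intro s
    induction s with
    | zero => exact hc
    | succ s ih => rw [hus, HahnSeries.support_neg]; exact hLS _ ih
  have huw : ∀ s : ℕ, WtGE w (s * δ) (u s) := by
    intro s
    induction s with
    | zero => intro e _; simp
    | succ s ih =>
      intro e he
      rw [hus, HahnSeries.coeff_neg] at he
      rw [Nat.cast_succ, add_mul, one_mul]
      exact hL _ _ ih e (neg_ne_zero.1 he)
  let N : Γ → ℕ := fun e => ⌊w e / δ⌋₊ + 1
  have hN : ∀ e, w e < N e * δ := by
    intro e
    rw [← div_lt_iff₀ hδ]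
    exact_mod_cast Nat.lt_floor_add_one (w e / δ)
  have hN' : ∀ e (s : ℕ), w e < s * δ → N e ≤ s := by
    intro e s h
    rw [← div_lt_iff₀ hδ] at h
    exact Nat.succ_le_of_lt ((Nat.floor_lt zero_le).2 h)
  let G : ℕ → HahnSeries Γ ℝ := fun k => ∑ s ∈ Finset.range k, u s
  have hG : ∀ k, G k + L (G k) = c - u k := by
    intro k
    induction k with
    | zero => simp [G, hu0]
    | succ k ih =>
      have : G (k + 1) = G k + u k := Finset.sum_range_succ _ _
      rw [this, map_add, hus]
      rw [eq_sub_iff_add_eq] at ih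
      rw [← ih]
      abel
  let g : HahnSeries Γ ℝ :=
    { coeff := fun e => (G (N e)).coeff e
      isPWO_support' := hS.mono fun e he => by
        rw [Function.mem_support] at he
        simp only [G, HahnSeries.coeff_sum] at he
        obtain ⟨s, -, hs⟩ := Finset.exists_ne_zero_of_sum_ne_zero he
        exact huS s hs }
  have hgS : g.support ⊆ S := by
    intro e he
    change (G (N e)).coeff e ≠ 0 at he
    simp only [G, HahnSeries.coeff_sum] at he
    obtain ⟨s, -, hs⟩ := Finset.exists_ne_zero_of_sum_ne_zero he
    exact huS s hs
  have hgG : ∀ k : ℕ, WtGE w (k * δ) (g - G k) := by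
    intro k e he
    by_contra hlt
    rw [not_le] at hlt
    apply he
    have hk := hN' e k hlt
    have : (G k).coeff e = (G (N e)).coeff e := by
      simp only [G, HahnSeries.coeff_sum]
      refine (Finset.sum_subset (Finset.range_mono hk) fun s _ hs => ?_).symm
      refine (huw s).coeff_eq_zero ((hN e).trans_le ?_)
      rw [Finset.mem_range, not_lt] at hs
      gcongr
    rw [HahnSeries.coeff_sub, this]
    exact sub_self _
  refine ⟨g, hgS, ?_⟩
  ext e
  have h1 : g + L g = (g - G (N e)) + L (g - G (N e)) + c - u (N e) := by
    rw [map_sub, add_sub_assoc, ← hG]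
    abel
  have hlt : w e < N e * δ + δ := (hN e).trans_le le_self_add
  rw [h1, HahnSeries.coeff_sub, HahnSeries.coeff_add, HahnSeries.coeff_add,
    (hgG (N e)).coeff_eq_zero (hN e), (hL _ _ (hgG (N e))).coeff_eq_zero hlt,
    (huw (N e)).coeff_eq_zero (hN e)]
  ring

end Perturbation

theorem support_mul_subset_of {m n : ℕ} {M : AddSubmonoid (Expo m n)} {f g : Series m n}
    (hf : f.support ⊆ M) (hg : g.support ⊆ M) : (f * g).support ⊆ M := by
  intro e he
  obtain ⟨x, hx, y, hy, rfl⟩ := Set.mem_add.1 (HahnSeries.support_mul_subset he)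
  exact M.add_mem (hf hx) (hg hy)

/-- The series with support in a monoid of exponents. -/
def suppIn {m n : ℕ} (M : AddSubmonoid (Expo m n)) : Subalgebra ℝ (Series m n) where
  carrier := {f | f.support ⊆ M}
  mul_mem' := support_mul_subset_of
  add_mem' hf hg := (HahnSeries.support_add_subset _ _).trans (Set.union_subset hf hg)
  algebraMap_mem' r := by
    intro e he
    rw [HahnSeries.algebraMap_apply] at he
    rw [HahnSeries.eq_of_mem_support_single he]
    exact M.zero_mem

theorem exists_mul_eq_one {m n : ℕ} {M : AddSubmonoid (Expo m n)}
    (hM : (M : Set (Expo m n)).IsPWO) {f : Series m n} (hf : f ∈ suppIn M) (h0 : f.coeff 0 ≠ 0) :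
    ∃ g ∈ suppIn M, f * g = 1 := by
  set a : Series m n := HahnSeries.C (f.coeff 0)⁻¹ with ha
  have haM : a ∈ suppIn M := algebraMap_mem (suppIn M) (f.coeff 0)⁻¹
  set x : Series m n := a * f - 1 with hx
  have hx0 : x.coeff 0 = 0 := by
    rw [hx, HahnSeries.coeff_sub, ha, HahnSeries.C_mul_eq_smul, HahnSeries.coeff_smul,
      HahnSeries.coeff_one, if_pos rfl, smul_eq_mul, inv_mul_cancel₀ h0, sub_self]
  have hxM : x ∈ suppIn M := sub_mem (mul_mem haM hf) (one_mem _)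
  obtain ⟨δ, hδ, hδx⟩ := exists_wt_lower_bound x.isPWO_support
    (by rw [HahnSeries.mem_support]; exact fun h => h hx0)
  obtain ⟨g, hg, hgx⟩ := exists_add_map_eq hδ (AddMonoidHom.mulLeft x) (w := wt)
    (fun f t hft e he => by
      obtain ⟨a, ha, b, hb, rfl⟩ := Set.mem_add.1 (HahnSeries.support_mul_subset he)
      rw [wt_add, add_comm]
      exact add_le_add (hδx a ha) (hft b hb)) hM (fun f hf => support_mul_subset_of hxM hf)
    (c := 1) (one_mem (suppIn M))
  refine ⟨a * g, mul_mem haM hg, ?_⟩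
  change g + x * g = 1 at hgx
  rw [← hgx, hx]
  ring

theorem isUnit_of_coeff_zero_ne {m n : ℕ} {f : Series m n} (h0 : f.coeff 0 ≠ 0) : IsUnit f := by
  obtain ⟨g, -, hg⟩ := exists_mul_eq_one (M := AddSubmonoid.closure f.support)
    (Set.IsPWO.addSubmonoid_closure (fun _ _ => zero_le) f.isPWO_support)
    (AddSubmonoid.subset_closure (s := f.support)) h0
  exact IsUnit.of_mul_eq_one g hg

section LastStd

variable {m n : ℕ}

/-- Forgetting the exponent of the last standard variable. -/
def projStd (m n : ℕ) : Expo m (n + 1) →+ Expo m n where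
  toFun e := (e.1, Fin.init (α := fun _ => ℕ) e.2)
  map_zero' := rfl
  map_add' _ _ := rfl

theorem projStd_mono : Monotone (projStd m n) := fun _ _ h => ⟨h.1, fun k => h.2 k.castSucc⟩

theorem projStd_zStd (e : Expo m n) (q : ℕ) : projStd m n (zStd e q) = e :=
  Prod.ext rfl (Fin.init_snoc (α := fun _ => ℕ) _ _)

theorem zStd_last (e : Expo m n) (q : ℕ) : (zStd e q).2 (Fin.last n) = q :=
  Fin.snoc_last (α := fun _ => ℕ) _ _

theorem zStd_projStd (e : Expo m (n + 1)) : zStd (projStd m n e) (e.2 (Fin.last n)) = e :=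
  Prod.ext rfl (Fin.snoc_init_self (α := fun _ => ℕ) _)

theorem zStd_add (a b : Expo m n) (p q : ℕ) : zStd (a + b) (p + q) = zStd a p + zStd b q :=
  Prod.ext rfl (snoc_add _ _ _ _)

theorem zStd_zero_zero : zStd (0 : Expo m n) 0 = 0 := Prod.ext rfl snoc_zero_zero

theorem zStd_mono {a b : Expo m n} {p q : ℕ} (h : a ≤ b) (hpq : p ≤ q) : zStd a p ≤ zStd b q := by
  refine ⟨h.1, fun k => ?_⟩
  refine Fin.lastCases ?_ (fun k => ?_) k
  · simpa [zStd] using hpq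
  · simpa [zStd] using h.2 k

theorem zStd_inj {a b : Expo m n} {p q : ℕ} (h : zStd a p = zStd b q) : a = b ∧ p = q :=
  ⟨by rw [← projStd_zStd a p, h, projStd_zStd], by rw [← zStd_last a p, h, zStd_last]⟩

theorem coeff_liftStd (f : Series m n) (e : Expo m n) (q : ℕ) :
    (liftStd f).coeff (zStd e q) = if q = 0 then f.coeff e else 0 := by
  split_ifs with h
  · subst h
    exact HahnSeries.embDomain_coeff (f := embStd m n)
  · refine HahnSeries.embDomain_of_notMem_range ?_
    rintro ⟨a, ha⟩
    exact h (zStd_inj ha).2.symm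

theorem coeff_mul_single_of_not_le {Γ : Type*} [AddCommMonoid Γ] [PartialOrder Γ]
    [IsOrderedCancelAddMonoid Γ] {f : HahnSeries Γ ℝ} {a e : Γ} {c : ℝ} (h : ∀ x, x + a ≠ e) :
    (f * HahnSeries.single a c).coeff e = 0 := by
  by_contra hne
  rw [mul_comm] at hne
  obtain ⟨t, -, ht⟩ := exists_add_of_coeff_single_mul hne
  exact h t (by rw [add_comm, ht])

/-- The exponents whose part without the last standard variable is in `N`. -/
def cyl (N : AddSubmonoid (Expo m n)) : AddSubmonoid (Expo m (n + 1)) := N.comap (projStd m n)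

theorem mem_cyl {N : AddSubmonoid (Expo m n)} {e : Expo m (n + 1)} :
    e ∈ cyl N ↔ projStd m n e ∈ N := Iff.rfl

theorem isPWO_cyl {N : AddSubmonoid (Expo m n)} (hN : (N : Set (Expo m n)).IsPWO) :
    (cyl N : Set (Expo m (n + 1))).IsPWO := by
  have h2 : (Set.univ : Set ℕ).IsPWO := Set.isPWO_of_wellQuasiOrderedLE _
  refine ((hN.prod h2).image_of_monotone (f := fun x => zStd x.1 x.2) ?_).mono ?_
  · exact fun a b h => zStd_mono h.1 h.2
  · intro e he
    exact ⟨(projStd m n e, e.2 (Fin.last n)), ⟨he, trivial⟩, zStd_projStd e⟩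

/-- The series `∑_{q} f_{q+k} Z^q`. -/
def shiftStd (k : ℕ) : Series m (n + 1) →ₗ[ℝ] Series m (n + 1) :=
  reindex (fun e => e + zStd 0 k) (fun e => e - zStd 0 k) (fun _ _ h => tsub_le_tsub_right h _)
    fun _ => add_tsub_cancel_right _ _

/-- The part of degree less than `k` in `Z`. -/
def lowStd (k : ℕ) : Series m (n + 1) →ₗ[ℝ] Series m (n + 1) :=
  restrictExp fun e => e.2 (Fin.last n) < k

theorem coeff_shiftStd (k : ℕ) (f : Series m (n + 1)) (e : Expo m (n + 1)) :
    (shiftStd k f).coeff e = f.coeff (e + zStd 0 k) := rfl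

theorem low_add_shift (k : ℕ) (f : Series m (n + 1)) :
    lowStd k f + shiftStd k f * HahnSeries.single (zStd 0 k) 1 = f := by
  classical
  ext e
  rw [HahnSeries.coeff_add, lowStd, coeff_restrictExp]
  split_ifs with h
  · rw [coeff_mul_single_of_not_le, add_zero]
    intro x hx
    have := congrFun (congrArg Prod.snd hx) (Fin.last n)
    rw [Prod.snd_add, Pi.add_apply, zStd_last] at this
    omega
  · have hle : zStd 0 k ≤ e := by
      conv_rhs => rw [← zStd_projStd e]
      exact zStd_mono zero_le (not_lt.1 h)
    obtain ⟨x, rfl⟩ := exists_add_of_le hle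
    rw [add_comm (zStd 0 k) x, HahnSeries.coeff_mul_single_add, coeff_shiftStd, mul_one, zero_add]

theorem shift_mul_single (k : ℕ) (f : Series m (n + 1)) :
    shiftStd k (f * HahnSeries.single (zStd 0 k) 1) = f := by
  ext e
  rw [coeff_shiftStd, HahnSeries.coeff_mul_single_add, mul_one]

theorem projStd_add_zStd_zero (e : Expo m (n + 1)) (k : ℕ) :
    projStd m n (e + zStd 0 k) = projStd m n e := by
  rw [map_add, projStd_zStd, add_zero]

theorem shiftStd_mem {N : AddSubmonoid (Expo m n)} {f : Series m (n + 1)} (k : ℕ)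
    (hf : f ∈ suppIn (cyl N)) : shiftStd k f ∈ suppIn (cyl N) := by
  intro e he
  have := hf he
  rwa [SetLike.mem_coe, mem_cyl, projStd_add_zStd_zero] at this

theorem lowStd_mem {M : AddSubmonoid (Expo m (n + 1))} {f : Series m (n + 1)} (k : ℕ)
    (hf : f ∈ suppIn M) : lowStd k f ∈ suppIn M :=
  fun _ he => hf (of_coeff_restrictExp_ne he).2

/-- `d` is regular of order `k` in the last standard variable. -/
def RegularStd (k : ℕ) (d : Series m (n + 1)) : Prop :=
  (∀ j < k, d.coeff (zStd 0 j) = 0) ∧ d.coeff (zStd 0 k) ≠ 0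

theorem RegularStd.exists_inv {k : ℕ} {d : Series m (n + 1)} (hd : RegularStd k d)
    {N : AddSubmonoid (Expo m n)} (hN : (N : Set (Expo m n)).IsPWO) (hdN : d ∈ suppIn (cyl N)) :
    ∃ v ∈ suppIn (cyl N), shiftStd k d * v = 1 := by
  refine exists_mul_eq_one (isPWO_cyl hN) (shiftStd_mem k hdN) ?_
  rw [coeff_shiftStd, zero_add]
  exact hd.2

theorem RegularStd.exists_weight {k : ℕ} {d : Series m (n + 1)} (hd : RegularStd k d)
    (v : Series m (n + 1)) : ∃ δ : ℝ≥0, 0 < δ ∧ ∀ f t, WtGE (fun e => wt (projStd m n e)) t f →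
      WtGE (fun e => wt (projStd m n e)) (t + δ) (shiftStd k (lowStd k d * v * f)) := by
  obtain ⟨δ, hδ, hδP⟩ := exists_wt_lower_bound
    ((lowStd k d).isPWO_support.image_of_monotone projStd_mono) (by
      rintro ⟨e, he, he0⟩
      obtain ⟨h1, h2⟩ := of_coeff_restrictExp_ne he
      rw [← zStd_projStd e, he0] at h2
      exact h2 (hd.1 _ h1))
  refine ⟨δ, hδ, fun f t hf e he => ?_⟩
  rw [coeff_shiftStd] at he
  obtain ⟨a, ha, b, hb, hab⟩ := Set.mem_add.1 (HahnSeries.support_mul_subset he)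
  obtain ⟨a', ha', c, hc, rfl⟩ := Set.mem_add.1 (HahnSeries.support_mul_subset ha)
  change _ ≤ wt (projStd m n e)
  rw [← projStd_add_zStd_zero e k, ← hab, map_add, map_add, wt_add, wt_add, add_comm t]
  exact add_le_add ((hδP _ ⟨a', ha', rfl⟩).trans le_self_add) (hf b hb)

theorem RegularStd.division {k : ℕ} {d : Series m (n + 1)} (hd : RegularStd k d)
    {N : AddSubmonoid (Expo m n)} (hN : (N : Set (Expo m n)).IsPWO) (hdN : d ∈ suppIn (cyl N))
    {c : Series m (n + 1)} (hc : c ∈ suppIn (cyl N)) :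
    ∃ h, ∃ R ∈ suppIn (cyl N), c = d * h + R ∧ ∀ e, R.coeff e ≠ 0 → e.2 (Fin.last n) < k := by
  obtain ⟨v, hv, huv⟩ := hd.exists_inv hN hdN
  obtain ⟨δ, hδ, hL⟩ := hd.exists_weight v
  obtain ⟨g, hg, hgc⟩ := exists_add_map_eq hδ
    ((shiftStd k).toAddMonoidHom.comp (AddMonoidHom.mulLeft (lowStd k d * v))) hL (isPWO_cyl hN)
    (fun f hf => shiftStd_mem k (mul_mem (mul_mem (lowStd_mem k hdN) hv) hf)) (shiftStd_mem k hc)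
  refine ⟨v * g, lowStd k (c - lowStd k d * v * g), lowStd_mem k (sub_mem hc
    (mul_mem (mul_mem (lowStd_mem k hdN) hv) hg)), ?_, fun e he => (of_coeff_restrictExp_ne he).1⟩
  change g + shiftStd k (lowStd k d * v * g) = shiftStd k c at hgc
  have h1 := low_add_shift k c
  have h2 := low_add_shift k d
  have h3 := low_add_shift k (lowStd k d * v * g)
  rw [map_sub]
  linear_combination -h1 + v * g * h2 + h3 - HahnSeries.single (zStd 0 k) 1 * hgc -
    g * HahnSeries.single (zStd 0 k) 1 * huv

theorem RegularStd.eq_zero_of_mul {k : ℕ} {d : Series m (n + 1)} (hd : RegularStd k d)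
    {h : Series m (n + 1)} (hdh : d * h = 0) : h = 0 := by
  obtain ⟨v, -, huv⟩ := hd.exists_inv (N := AddSubmonoid.closure (projStd m n '' d.support))
    (Set.IsPWO.addSubmonoid_closure (fun _ _ => zero_le)
      (d.isPWO_support.image_of_monotone projStd_mono))
    (fun e he => AddSubmonoid.subset_closure ⟨e, he, rfl⟩)
  obtain ⟨δ, hδ, hL⟩ := hd.exists_weight v
  have hg : shiftStd k d * h = 0 := by
    refine eq_zero_of_add_map_eq_zero hδ
      ((shiftStd k).toAddMonoidHom.comp (AddMonoidHom.mulLeft (lowStd k d * v))) hL ?_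
    change shiftStd k d * h + shiftStd k (lowStd k d * v * (shiftStd k d * h)) = 0
    have h1 : lowStd k d * v * (shiftStd k d * h) +
        (shiftStd k d * h) * HahnSeries.single (zStd 0 k) 1 = 0 := by
      linear_combination hdh + h * low_add_shift k d + lowStd k d * h * huv
    have h2 := congrArg (shiftStd k) h1
    rw [map_add, shift_mul_single, map_zero] at h2
    exact (add_comm _ _).trans h2
  calc h = v * (shiftStd k d * h) := by linear_combination - h * huv
    _ = 0 := by rw [hg, mul_zero]

end LastStd

/-- A decomposition of the exponents in `Γ₁` into an exponent in `Γ` and the exponent in `Q` of a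
distinguished variable. -/
structure Splitting (Γ Q Γ₁ : Type*) [AddCommMonoid Γ] [PartialOrder Γ] [AddCommMonoid Q]
    [PartialOrder Q] [AddCommMonoid Γ₁] [PartialOrder Γ₁] where
  equiv : Γ × Q ≃o Γ₁
  map_add : ∀ a b, equiv (a + b) = equiv a + equiv b

namespace Splitting

variable {Γ Q Γ₁ : Type*} [AddCommMonoid Γ] [PartialOrder Γ] [IsOrderedCancelAddMonoid Γ]
  [AddCommMonoid Q] [PartialOrder Q] [IsOrderedCancelAddMonoid Q]
  [AddCommMonoid Γ₁] [PartialOrder Γ₁] [IsOrderedCancelAddMonoid Γ₁] (s : Splitting Γ Q Γ₁)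

/-- The coefficient of `Z^q`. -/
def slice (q : Q) : HahnSeries Γ₁ ℝ →ₗ[ℝ] HahnSeries Γ ℝ :=
  reindex (fun e => s.equiv (e, q)) (fun x => (s.equiv.symm x).1)
    (fun _ _ h => (s.equiv.symm.monotone h).1) fun e => by simp

theorem coeff_slice (q : Q) (f : HahnSeries Γ₁ ℝ) (e : Γ) :
    (s.slice q f).coeff e = f.coeff (s.equiv (e, q)) := rfl

theorem ext_slice {f g : HahnSeries Γ₁ ℝ} (h : ∀ q, s.slice q f = s.slice q g) : f = g := by
  ext x
  obtain ⟨⟨e, q⟩, rfl⟩ := s.equiv.surjective x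
  rw [← coeff_slice, h, coeff_slice]

theorem equiv_zero : s.equiv 0 = 0 := by
  have h := s.map_add 0 0
  rw [add_zero] at h
  exact left_eq_add.1 h

/-- Series in the other variables as series in all the variables. -/
def lift : HahnSeries Γ ℝ →ₐ[ℝ] HahnSeries Γ₁ ℝ :=
  HahnSeries.embDomainAlgHom
    { toFun := fun e => s.equiv (e, 0), map_zero' := s.equiv_zero,
      map_add' := fun a b => by rw [← s.map_add, Prod.mk_add_mk, add_zero] }
    (fun a b h => congrArg Prod.fst (s.equiv.injective h))
    (fun a b => s.equiv.le_iff_le.trans ⟨fun h => h.1, fun h => ⟨h, le_rfl⟩⟩)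

theorem coeff_lift_self (f : HahnSeries Γ ℝ) (e : Γ) :
    (s.lift f).coeff (s.equiv (e, 0)) = f.coeff e :=
  HahnSeries.embDomain_coeff (f := ⟨⟨fun e => s.equiv (e, 0), _⟩, _⟩)

theorem coeff_lift_of_ne (f : HahnSeries Γ ℝ) (e : Γ) {q : Q} (hq : q ≠ 0) :
    (s.lift f).coeff (s.equiv (e, q)) = 0 := by
  refine HahnSeries.embDomain_of_notMem_range ?_
  rintro ⟨a, ha⟩
  exact hq (congrArg Prod.snd (s.equiv.injective ha)).symm

theorem lift_single (a : Γ) (c : ℝ) :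
    s.lift (HahnSeries.single a c) = HahnSeries.single (s.equiv (a, 0)) c :=
  HahnSeries.embDomain_single

theorem coeff_lift_mul_single [DecidableEq Q] (f : HahnSeries Γ ℝ) (e : Γ) (p q : Q) :
    (s.lift f * HahnSeries.single (s.equiv (0, p)) 1).coeff (s.equiv (e, q)) =
      if q = p then f.coeff e else 0 := by
  by_cases h : ∃ r, r + p = q
  · obtain ⟨r, rfl⟩ := h
    have h1 : s.equiv (e, r + p) = s.equiv (e, r) + s.equiv (0, p) := by
      rw [← s.map_add, Prod.mk_add_mk, add_zero]
    rw [h1, HahnSeries.coeff_mul_single_add, mul_one]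
    by_cases hr : r = 0
    · subst hr
      rw [coeff_lift_self, if_pos (zero_add p)]
    · rw [coeff_lift_of_ne _ _ _ hr, if_neg fun h => hr (add_eq_right.1 h)]
  · rw [if_neg fun hqp => h ⟨0, by rw [zero_add, hqp]⟩]
    refine coeff_mul_single_of_not_le fun x hx => h ?_
    obtain ⟨⟨a, r⟩, rfl⟩ := s.equiv.surjective x
    rw [← s.map_add] at hx
    exact ⟨r, congrArg Prod.snd (s.equiv.injective hx)⟩

theorem single_equiv (e : Γ) (p : Q) (c : ℝ) :
    HahnSeries.single (s.equiv (e, p)) c =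
      s.lift (HahnSeries.single e c) * HahnSeries.single (s.equiv (0, p)) 1 := by
  rw [lift_single, HahnSeries.single_mul_single, ← s.map_add, Prod.mk_add_mk, add_zero, zero_add,
    mul_one]

/-- Composition of a splitting with an automorphism of the exponents. -/
def trans {Γ₂ : Type*} [AddCommMonoid Γ₂] [PartialOrder Γ₂] (t : Γ₁ ≃o Γ₂)
    (ht : ∀ a b, t (a + b) = t a + t b) : Splitting Γ Q Γ₂ where
  equiv := s.equiv.trans t
  map_add a b := by simp [s.map_add, ht]

end Splitting

theorem finsum_slice {Γ Q Γ₁ : Type*} [DecidableEq Q] (z : Γ × Q ≃ Γ₁) (c μ : Γ₁ → ℝ) (μ₀ : Γ → ℝ)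
    (q : Q) (h : ∀ e p, μ (z (e, p)) = if q = p then μ₀ e else 0) :
    ∑ᶠ x, c x * μ x = ∑ᶠ e, c (z (e, q)) * μ₀ e := by
  have hi : Function.Injective fun e => z (e, q) :=
    fun a b hab => congrArg Prod.fst (z.injective hab)
  have h1 : ∀ e, c (z (e, q)) * μ₀ e = (fun x => c x * μ x) (z (e, q)) := by
    intro e
    change _ = c (z (e, q)) * μ (z (e, q))
    rw [h, if_pos rfl]
  classical
  rw [finsum_congr h1, ← finsum_mem_range (f := fun x => c x * μ x) hi]
  refine finsum_congr fun x => ?_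
  obtain ⟨⟨e, p⟩, rfl⟩ := z.surjective x
  by_cases hp : q = p
  · subst hp
    rw [finsum_eq_if, if_pos ⟨e, rfl⟩]
  · rw [finsum_eq_if, if_neg, h, if_neg hp, mul_zero]
    rintro ⟨a, ha⟩
    exact hp (congrArg Prod.snd (z.injective ha))

/-- A substitution `mono₁` that acts as `mono` on the variables other than `Z`. -/
def Extends {Γ Γ' Q Γ₁ Γ₁' : Type*} [AddCommMonoid Γ] [PartialOrder Γ] [IsOrderedCancelAddMonoid Γ]
    [AddCommMonoid Γ'] [PartialOrder Γ'] [IsOrderedCancelAddMonoid Γ']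
    [AddCommMonoid Q] [PartialOrder Q] [IsOrderedCancelAddMonoid Q]
    [AddCommMonoid Γ₁] [PartialOrder Γ₁] [IsOrderedCancelAddMonoid Γ₁]
    [AddCommMonoid Γ₁'] [PartialOrder Γ₁'] [IsOrderedCancelAddMonoid Γ₁']
    (s : Splitting Γ Q Γ₁) (s' : Splitting Γ' Q Γ₁') (mono : Γ → HahnSeries Γ' ℝ)
    (mono₁ : Γ₁ → HahnSeries Γ₁' ℝ) : Prop :=
  ∀ e p, mono₁ (s.equiv (e, p)) = s'.lift (mono e) * HahnSeries.single (s'.equiv (0, p)) 1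

section

variable {Γ Γ' Q Γ₁ Γ₁' : Type*} [AddCommMonoid Γ] [PartialOrder Γ] [IsOrderedCancelAddMonoid Γ]
    [AddCommMonoid Γ'] [PartialOrder Γ'] [IsOrderedCancelAddMonoid Γ']
    [AddCommMonoid Q] [PartialOrder Q] [IsOrderedCancelAddMonoid Q]
    [AddCommMonoid Γ₁] [PartialOrder Γ₁] [IsOrderedCancelAddMonoid Γ₁]
    [AddCommMonoid Γ₁'] [PartialOrder Γ₁'] [IsOrderedCancelAddMonoid Γ₁']
    {s : Splitting Γ Q Γ₁} {s' : Splitting Γ' Q Γ₁'}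

theorem Extends.slice_hom {mono : Γ → HahnSeries Γ' ℝ} {mono₁ : Γ₁ → HahnSeries Γ₁' ℝ}
    (h : Extends s s' mono mono₁) (hm : IsSubst mono) (hm₁ : IsSubst mono₁) (q : Q)
    (f : HahnSeries Γ₁ ℝ) : s'.slice q (hm₁.hom f) = hm.hom (s.slice q f) := by
  classical
  ext e'
  rw [Splitting.coeff_slice, IsSubst.coeff_hom, IsSubst.coeff_hom]
  refine finsum_slice s.equiv.toEquiv f.coeff (fun x => (mono₁ x).coeff (s'.equiv (e', q)))
    (fun e => (mono e).coeff e') q fun e p => ?_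
  change (mono₁ (s.equiv (e, p))).coeff _ = _
  rw [h, Splitting.coeff_lift_mul_single]

theorem extends_single {φ : Γ → Γ'} {φ₁ : Γ₁ → Γ₁'} {χ : Γ → ℝ} {χ₁ : Γ₁ → ℝ}
    (hφ : ∀ e p, φ₁ (s.equiv (e, p)) = s'.equiv (φ e, p))
    (hχ : ∀ e p, χ₁ (s.equiv (e, p)) = χ e) :
    Extends s s' (fun e => HahnSeries.single (φ e) (χ e))
      (fun e => HahnSeries.single (φ₁ e) (χ₁ e)) := by
  intro e p
  dsimp only
  rw [hφ, hχ]
  exact s'.single_equiv _ _ _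

end

section Concrete

variable {m n : ℕ}

/-- The splitting given by a standard variable `Z` placed after `Y`. -/
def splitStd (m n : ℕ) : Splitting (Expo m n) ℕ (Expo m (n + 1)) where
  equiv :=
    { toFun := fun x => zStd x.1 x.2
      invFun := fun e => (projStd m n e, e.2 (Fin.last n))
      left_inv := fun x => Prod.ext (projStd_zStd _ _) (zStd_last _ _)
      right_inv := fun e => zStd_projStd e
      map_rel_iff' := by
        intro a b
        refine ⟨fun h => ⟨?_, ?_⟩, fun h => zStd_mono h.1 h.2⟩
        · have := projStd_mono h
          rwa [Equiv.coe_fn_mk, projStd_zStd, projStd_zStd] at this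
        · have := h.2 (Fin.last n)
          rwa [Equiv.coe_fn_mk, zStd_last, zStd_last] at this }
  map_add a b := zStd_add _ _ _ _

theorem splitStd_equiv (e : Expo m n) (q : ℕ) : (splitStd m n).equiv (e, q) = zStd e q := rfl

theorem zGen_add (a b : Expo m n) (p q : ℝ≥0) : zGen (a + b) (p + q) = zGen a p + zGen b q :=
  Prod.ext (snoc_add _ _ _ _) rfl

/-- The splitting given by a generalised variable `Z` placed after `X`. -/
def splitGen (m n : ℕ) : Splitting (Expo m n) ℝ≥0 (Expo (m + 1) n) where
  equiv :=
    { toFun := fun x => zGen x.1 x.2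
      invFun := fun e => ((Fin.init (α := fun _ => ℝ≥0) e.1, e.2), e.1 (Fin.last m))
      left_inv := fun x => by simp [zGen]
      right_inv := fun e => Prod.ext (Fin.snoc_init_self (α := fun _ => ℝ≥0) _) rfl
      map_rel_iff' := by
        intro a b
        simp only [Equiv.coe_fn_mk, zGen, Prod.le_def, Pi.le_def, Fin.forall_fin_succ',
          Fin.snoc_castSucc, Fin.snoc_last]
        tauto }
  map_add a b := zGen_add _ _ _ _

theorem splitGen_equiv (e : Expo m n) (q : ℝ≥0) : (splitGen m n).equiv (e, q) = zGen e q := rfl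

/-- The action of permutations of the variables on exponents. -/
def permExpo (σ : Equiv.Perm (Fin m)) (τ : Equiv.Perm (Fin n)) : Expo m n ≃o Expo m n where
  toFun e := (fun i => e.1 (σ i), fun j => e.2 (τ j))
  invFun e := (fun i => e.1 (σ.symm i), fun j => e.2 (τ.symm j))
  left_inv e := by simp
  right_inv e := by simp
  map_rel_iff' := by
    intro a b
    refine ⟨fun h => ⟨fun i => ?_, fun j => ?_⟩, fun h => ⟨fun i => h.1 _, fun j => h.2 _⟩⟩
    · simpa using h.1 (σ.symm i)
    · simpa using h.2 (τ.symm j)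

theorem permExpo_apply (σ : Equiv.Perm (Fin m)) (τ : Equiv.Perm (Fin n)) (e : Expo m n) :
    permExpo σ τ e = (fun i => e.1 (σ i), fun j => e.2 (τ j)) := rfl

/-- The transposition of the last two indices. -/
def swapLast (n : ℕ) : Equiv.Perm (Fin (n + 2)) :=
  Equiv.swap (Fin.last (n + 1)) (Fin.last n).castSucc

theorem swapLast_last (n : ℕ) : swapLast n (Fin.last (n + 1)) = (Fin.last n).castSucc :=
  Equiv.swap_apply_left _ _

theorem swapLast_castSucc_last (n : ℕ) : swapLast n (Fin.last n).castSucc = Fin.last (n + 1) :=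
  Equiv.swap_apply_right _ _

theorem swapLast_castSucc_castSucc {n : ℕ} (k : Fin n) :
    swapLast n k.castSucc.castSucc = k.castSucc.castSucc := by
  refine Equiv.swap_apply_of_ne_of_ne (Fin.castSucc_lt_last _).ne ?_
  exact fun h => (Fin.castSucc_lt_last k).ne (Fin.castSucc_injective _ h)

theorem swapLast_swapLast {n : ℕ} (k : Fin (n + 2)) : swapLast n (swapLast n k) = k :=
  Equiv.swap_apply_self _ _ _

/-- The splitting given by a standard variable `Z` placed before the last one. -/
def splitStd' (m n : ℕ) : Splitting (Expo m (n + 1)) ℕ (Expo m (n + 2)) :=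
  (splitStd m (n + 1)).trans (permExpo 1 (swapLast n)) fun _ _ => rfl

/-- The splitting given by a generalised variable `Z` placed before the last one. -/
def splitGen' (m n : ℕ) : Splitting (Expo (m + 1) n) ℝ≥0 (Expo (m + 2) n) :=
  (splitGen (m + 1) n).trans (permExpo (swapLast m) 1) fun _ _ => rfl

end Concrete

open QuasianalyticAlgebras GeneralisedQuasianalyticClass

section

variable {m n : ℕ}

theorem splitStd_lift_varStd (j : Fin n) :
    (splitStd m n).lift (varStd m j) = varStd m j.castSucc := by
  rw [varStd, Splitting.lift_single, splitStd_equiv, varStd, zStd]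
  refine congrArg (fun e => HahnSeries.single e (1 : ℝ)) (Prod.ext rfl ?_)
  ext k
  refine Fin.lastCases ?_ (fun k => ?_) k
  · simp [(Fin.castSucc_lt_last j).ne]
  · simp [Pi.single_apply]

theorem splitGen_lift_varStd (j : Fin n) :
    (splitGen m n).lift (varStd m j) = varStd (m + 1) j := by
  rw [varStd, Splitting.lift_single, splitGen_equiv, varStd, zGen]
  exact congrArg (fun e => HahnSeries.single e (1 : ℝ)) (Prod.ext snoc_zero_zero rfl)

theorem splitStd_lift_C (c : ℝ) :
    (splitStd m n).lift (HahnSeries.C c) = HahnSeries.C c := (splitStd m n).lift.commutes c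

theorem splitGen_lift_C (c : ℝ) :
    (splitGen m n).lift (HahnSeries.C c) = HahnSeries.C c := (splitGen m n).lift.commutes c

theorem embDomain_eq_of_comp {Γ Γ' Γ'' : Type*} [PartialOrder Γ] [PartialOrder Γ']
    [PartialOrder Γ''] (f : Γ ↪o Γ') (g : Γ' ↪o Γ'') (k : Γ ↪o Γ'') (h : ∀ e, g (f e) = k e)
    (x : HahnSeries Γ ℝ) :
    HahnSeries.embDomain g (HahnSeries.embDomain f x) = HahnSeries.embDomain k x := by
  ext e
  by_cases he : e ∈ Set.range k
  · obtain ⟨a, rfl⟩ := he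
    rw [HahnSeries.embDomain_coeff, ← h, HahnSeries.embDomain_coeff, HahnSeries.embDomain_coeff]
  · rw [HahnSeries.embDomain_of_notMem_range he]
    by_cases he' : e ∈ Set.range g
    · obtain ⟨a, rfl⟩ := he'
      rw [HahnSeries.embDomain_coeff]
      refine HahnSeries.embDomain_of_notMem_range ?_
      rintro ⟨b, rfl⟩
      exact he ⟨b, (h b).symm⟩
    · exact HahnSeries.embDomain_of_notMem_range he'

theorem splitStd_lift_binomSeries (l : ℝ) (a : ℝ≥0) :
    (splitStd m (n + 1)).lift (binomSeries m n l a) = binomSeries m (n + 1) l a := by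
  refine embDomain_eq_of_comp (embFirst m n) ⟨⟨fun e => (splitStd m (n + 1)).equiv (e, 0), _⟩, _⟩
    (embFirst m (n + 1)) (fun k => ?_) _
  refine Prod.ext rfl (funext fun j => ?_)
  change (Fin.snoc (α := fun _ => ℕ) (Pi.single 0 k : Fin (n + 1) → ℕ) 0 : Fin (n + 2) → ℕ) j =
      (Pi.single 0 k : Fin (n + 2) → ℕ) j
  refine Fin.lastCases ?_ (fun j => ?_) j
  · rw [Fin.snoc_last, Pi.single_eq_of_ne (Fin.last_pos).ne']
  · rw [Fin.snoc_castSucc, Pi.single_apply, Pi.single_apply]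
    simp

theorem splitGen_lift_binomSeries (l : ℝ) (a : ℝ≥0) :
    (splitGen m (n + 1)).lift (binomSeries m n l a) = binomSeries (m + 1) n l a := by
  refine embDomain_eq_of_comp (embFirst m n) ⟨⟨fun e => (splitGen m (n + 1)).equiv (e, 0), _⟩, _⟩
    (embFirst (m + 1) n) (fun k => ?_) _
  exact Prod.ext snoc_zero_zero rfl

end

section Extend

variable {A : QuasianalyticAlgebras} {m n : ℕ}

theorem extends_std_ramification (i : Fin m) (γ : ℝ≥0) (hK : γ ∈ A.K) (hpos : 0 < γ) :
    Extends (splitStd m n) (splitStd m n) (Elem.ramification (n := n) i γ hK hpos).mono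
      (Elem.ramification (n := n + 1) i γ hK hpos).mono :=
  extends_single (fun _ _ => rfl) (fun _ _ => rfl)

theorem extends_gen_ramification (i : Fin m) (γ : ℝ≥0) (hK : γ ∈ A.K) (hpos : 0 < γ) :
    Extends (splitGen m n) (splitGen m n) (Elem.ramification (n := n) i γ hK hpos).mono
      (Elem.ramification (n := n) i.castSucc γ hK hpos).mono := by
  refine extends_single (fun e p => Prod.ext ?_ rfl) (fun _ _ => rfl)
  simp only [splitGen_equiv, zGen, Fin.snoc_castSucc, Fin.snoc_update]

theorem extends_std_blowUpZero (i j : Fin m) (hij : i ≠ j) :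
    Extends (splitStd m n) (splitStd m n) (Elem.blowUpZero (A := A) (n := n) i j hij).mono
      (Elem.blowUpZero (A := A) (n := n + 1) i j hij).mono :=
  extends_single (fun _ _ => rfl) (fun _ _ => rfl)

theorem extends_gen_blowUpZero (i j : Fin m) (hij : i ≠ j) :
    Extends (splitGen m n) (splitGen m n) (Elem.blowUpZero (A := A) (n := n) i j hij).mono
      (Elem.blowUpZero (A := A) (n := n) i.castSucc j.castSucc
        fun h => hij (Fin.castSucc_injective _ h)).mono := by
  refine extends_single (fun e p => Prod.ext ?_ rfl) (fun _ _ => rfl)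
  simp only [splitGen_equiv, zGen, Fin.snoc_castSucc, Fin.snoc_update]

theorem snoc_insertNth_castSucc_succAbove {M : Type*} {n : ℕ} (a : Fin (n + 1) → M) (p : M)
    (i : Fin (n + 1)) : (fun k => (Fin.snoc (α := fun _ => M) a p : Fin (n + 2) → M)
      (i.castSucc.succAbove k)) =
      (Fin.snoc (α := fun _ => M) (fun k => a (i.succAbove k)) p : Fin (n + 1) → M) := by
  ext k
  refine Fin.lastCases ?_ (fun k => ?_) k
  · simp
  · simp

theorem extends_std_blowUpInfty (s : ℤˣ) (i : Fin (n + 1)) (j : Fin m) :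
    Extends (splitStd m (n + 1)) (splitStd (m + 1) n) (Elem.blowUpInfty (A := A) s i j).mono
      (Elem.blowUpInfty (A := A) s i.castSucc j).mono := by
  refine extends_single (fun e p => Prod.ext ?_ ?_) (fun e p => ?_)
  · simp only [splitStd_equiv, zStd, Fin.snoc_castSucc]
  · exact snoc_insertNth_castSucc_succAbove _ _ _
  · simp only [splitStd_equiv, zStd, Fin.snoc_castSucc]

theorem extends_std_reflection (s : ℤˣ) (i : Fin (n + 1)) :
    Extends (splitStd m (n + 1)) (splitStd (m + 1) n) (Elem.reflection (A := A) s i).mono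
      (Elem.reflection (A := A) s i.castSucc).mono := by
  refine extends_single (fun e p => Prod.ext ?_ ?_) (fun e p => ?_)
  · simp only [splitStd_equiv, zStd, Fin.snoc_castSucc]
  · exact snoc_insertNth_castSucc_succAbove _ _ _
  · simp only [splitStd_equiv, zStd, Fin.snoc_castSucc]

theorem snoc_snoc_swapLast {M : Type*} {n : ℕ} (a : Fin n → M) (p q : M) :
    (fun k => (Fin.snoc (α := fun _ => M) (Fin.snoc (α := fun _ => M) a p : Fin (n + 1) → M) q :
      Fin (n + 2) → M) (swapLast n k)) =
      Fin.snoc (α := fun _ => M) (Fin.snoc (α := fun _ => M) a q : Fin (n + 1) → M) p := by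
  ext k
  refine Fin.lastCases ?_ (fun k => Fin.lastCases ?_ (fun k => ?_) k) k
  · rw [swapLast_last]; simp
  · rw [swapLast_castSucc_last]; simp
  · rw [swapLast_castSucc_castSucc]; simp

theorem extends_gen_blowUpInfty (s : ℤˣ) (i : Fin (n + 1)) (j : Fin m) :
    Extends (splitGen m (n + 1)) (splitGen' m n) (Elem.blowUpInfty (A := A) s i j).mono
      (Elem.blowUpInfty (A := A) s i j.castSucc).mono := by
  refine extends_single (fun e p => Prod.ext ?_ rfl) (fun e p => rfl)
  refine Eq.trans ?_ (snoc_snoc_swapLast _ _ _).symm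
  simp only [splitGen_equiv, zGen, Fin.snoc_castSucc]

theorem extends_gen_reflection (s : ℤˣ) (i : Fin (n + 1)) :
    Extends (splitGen m (n + 1)) (splitGen' m n) (Elem.reflection (A := A) s i).mono
      (Elem.reflection (A := A) s i).mono := by
  refine extends_single (fun e p => Prod.ext ?_ rfl) (fun e p => rfl)
  exact (snoc_snoc_swapLast _ _ _).symm

section

variable {Γ Γ' Q Γ₁ Γ₁' : Type*} [AddCommMonoid Γ] [PartialOrder Γ] [IsOrderedCancelAddMonoid Γ]
    [AddCommMonoid Γ'] [PartialOrder Γ'] [IsOrderedCancelAddMonoid Γ']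
    [AddCommMonoid Q] [PartialOrder Q] [IsOrderedCancelAddMonoid Q]
    [AddCommMonoid Γ₁] [PartialOrder Γ₁] [IsOrderedCancelAddMonoid Γ₁]
    [AddCommMonoid Γ₁'] [PartialOrder Γ₁'] [IsOrderedCancelAddMonoid Γ₁']
    {s : Splitting Γ Q Γ₁} {s' : Splitting Γ' Q Γ₁'}

theorem extends_single_mul {φ : Γ → Γ'} {φ₁ : Γ₁ → Γ₁'} {g : Γ → HahnSeries Γ' ℝ}
    {g₁ : Γ₁ → HahnSeries Γ₁' ℝ}
    (hφ : ∀ e p, φ₁ (s.equiv (e, p)) = s'.equiv (φ e, p))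
    (hg : ∀ e p, g₁ (s.equiv (e, p)) = s'.lift (g e)) :
    Extends s s' (fun e => HahnSeries.single (φ e) 1 * g e)
      (fun e => HahnSeries.single (φ₁ e) 1 * g₁ e) := by
  intro e p
  dsimp only
  rw [hφ, hg, s'.single_equiv, map_mul]
  ring

end

theorem extends_std_blowUp (i : Fin (m + 1)) (j : Fin m) (hji : j.castSucc < i) (l : ℝ)
    (hl : 0 < l) :
    Extends (splitStd (m + 1) n) (splitStd m (n + 1))
      (Elem.blowUp (A := A) (n := n) i j hji l hl).mono
      (Elem.blowUp (A := A) (n := n + 1) i j hji l hl).mono := by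
  refine extends_single_mul (fun e p => Prod.ext rfl ?_)
    (fun e p => (splitStd_lift_binomSeries l _).symm)
  exact Fin.cons_snoc_eq_snoc_cons _ _ _

theorem extends_gen_blowUp (i : Fin (m + 1)) (j : Fin m) (hji : j.castSucc < i) (l : ℝ)
    (hl : 0 < l) :
    Extends (splitGen (m + 1) n) (splitGen m (n + 1))
      (Elem.blowUp (A := A) (n := n) i j hji l hl).mono
      (Elem.blowUp (A := A) (n := n) i.castSucc j.castSucc hji l hl).mono := by
  refine extends_single_mul (fun e p => Prod.ext ?_ rfl) (fun e p => ?_)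
  · simp only [splitGen_equiv, zGen, Fin.snoc_castSucc]
    rw [snoc_insertNth_castSucc_succAbove, ← add_zero p, snoc_add, add_zero]
    congr 1
    ext k
    refine Fin.lastCases ?_ (fun k => ?_) k
    · simp [(Fin.castSucc_lt_last j).ne]
    · simp [Pi.single_apply]
  · simp only [splitGen_lift_binomSeries, splitGen_equiv, zGen, Fin.snoc_castSucc]

theorem extends_std_blowUpStd (i : Fin n) (j : Fin m) (l : ℝ) :
    Extends (splitStd m n) (splitStd m n) (Elem.blowUpStd (A := A) i j l).mono
      (Elem.blowUpStd (A := A) i.castSucc j l).mono := by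
  refine extends_single_mul (fun e p => Prod.ext ?_ ?_) (fun e p => ?_)
  · simp only [splitStd_equiv, zStd, Fin.snoc_castSucc]
  · simp only [splitStd_equiv, zStd, Fin.snoc_update]
  · simp only [map_pow, map_add, splitStd_lift_varStd, splitStd_lift_C, splitStd_equiv, zStd,
      Fin.snoc_castSucc]

theorem extends_gen_blowUpStd (i : Fin n) (j : Fin m) (l : ℝ) :
    Extends (splitGen m n) (splitGen m n) (Elem.blowUpStd (A := A) i j l).mono
      (Elem.blowUpStd (A := A) i j.castSucc l).mono := by
  refine extends_single_mul (fun e p => Prod.ext ?_ rfl) (fun e p => ?_)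
  · simp only [splitGen_equiv, zGen]
    rw [← add_zero p, snoc_add, add_zero]
    congr 1
    ext k
    refine Fin.lastCases ?_ (fun k => ?_) k
    · simp [(Fin.castSucc_lt_last j).ne]
    · simp [Pi.single_apply]
  · rw [map_pow, map_add, splitGen_lift_varStd, splitGen_lift_C]; rfl

theorem lift_linForm_std (i : Fin n) (c : Fin n → ℝ) (k : Fin n) :
    (splitStd m n).lift (linForm m i c k) =
      linForm m i.castSucc (Fin.snoc (α := fun _ => ℝ) c 0) k.castSucc := by
  simp only [linForm, Fin.castSucc_lt_castSucc_iff, Fin.snoc_castSucc]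
  split_ifs
  · rw [map_add, map_smul, splitStd_lift_varStd, splitStd_lift_varStd]
  · rw [splitStd_lift_varStd]

theorem lift_linForm_gen (i : Fin n) (c : Fin n → ℝ) (k : Fin n) :
    (splitGen m n).lift (linForm m i c k) = linForm (m + 1) i c k := by
  simp only [linForm]
  split_ifs
  · rw [map_add, map_smul, splitGen_lift_varStd, splitGen_lift_varStd]
  · rw [splitGen_lift_varStd]

theorem varStd_pow (j : Fin n) (k : ℕ) :
    (varStd m j) ^ k = HahnSeries.single (0, Pi.single j k) 1 := by
  rw [varStd, HahnSeries.single_pow, one_pow]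
  refine congrArg (fun e => HahnSeries.single e (1 : ℝ)) (Prod.ext (by simp) ?_)
  change k • (Pi.single j 1 : Fin n → ℕ) = _
  rw [← Pi.single_smul]
  simp

theorem zStd_zero (q : ℕ) : zStd (0 : Expo m n) q = (0, Pi.single (Fin.last n) q) := by
  refine Prod.ext rfl ?_
  ext k
  refine Fin.lastCases ?_ (fun k => ?_) k
  · simp [zStd]
  · simp [zStd, (Fin.castSucc_lt_last k).ne]

theorem linear_mono (i : Fin n) (c : Fin n → ℝ) (e : Expo m n) :
    (Elem.linear (A := A) i c).mono e =
      (HahnSeries.single (e.1, 0) 1 : Series m n) * ∏ k, linForm m i c k ^ e.2 k := rfl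

theorem extends_std_linear (i : Fin n) (c : Fin n → ℝ) :
    Extends (splitStd m n) (splitStd m n) (Elem.linear (A := A) (m := m) i c).mono
      (Elem.linear (A := A) (m := m) i.castSucc (Fin.snoc (α := fun _ => ℝ) c 0)).mono := by
  intro e p
  rw [linear_mono, linear_mono, map_mul, map_prod, Fin.prod_univ_castSucc, Splitting.lift_single,
    splitStd_equiv, splitStd_equiv, splitStd_equiv]
  have h1 : zStd ((e.1, 0) : Expo m n) 0 = ((zStd e p).1, 0) := Prod.ext rfl snoc_zero_zero
  have h2 : linForm m i.castSucc (Fin.snoc (α := fun _ => ℝ) c 0) (Fin.last n) =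
      varStd m (Fin.last n) := by
    rw [linForm, if_neg (not_lt.2 (Fin.le_last _))]
  rw [h1, h2, varStd_pow, zStd_last, zStd_zero, mul_assoc]
  congr 3
  ext1 k
  rw [map_pow, lift_linForm_std]
  simp [zStd]

theorem extends_gen_linear (i : Fin n) (c : Fin n → ℝ) :
    Extends (splitGen m n) (splitGen m n) (Elem.linear (A := A) (m := m) i c).mono
      (Elem.linear (A := A) (m := m + 1) i c).mono := by
  refine extends_single_mul (fun e p => rfl) (fun e p => ?_)
  rw [map_prod]
  refine Finset.prod_congr rfl fun k _ => ?_
  rw [map_pow]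
  exact congrArg (· ^ e.2 k) (lift_linForm_gen i c k).symm

end Extend


namespace GeneralisedQuasianalyticClass

variable (C : GeneralisedQuasianalyticClass) {m n : ℕ}

theorem mem_hat {F : Series m n} : F ∈ C.hat m n ↔ ∃ f, C.T m n f = F := AlgHom.mem_range _

theorem exists_pad_std (H : C.germ m n) : ∃ H' : C.germ m (n + 1),
    (∀ p, H'.1 p = H.1 (p.1, Fin.init (α := fun _ => ℝ) p.2)) ∧
    C.T m (n + 1) H' = liftStd (C.T m n H) := by
  obtain ⟨h, hT⟩ := C.T_pad (k := 0) (l := 1) H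
  refine ⟨⟨_, h⟩, fun p => rfl, ?_⟩
  ext e
  rw [← zStd_projStd e, coeff_liftStd, zStd_projStd]
  refine (hT e).trans ?_
  have h1 : ((∀ i : Fin 0, e.1 (Fin.natAdd m i) = 0) ∧ ∀ j : Fin 1, e.2 (Fin.natAdd n j) = 0) ↔
      e.2 (Fin.last n) = 0 := by
    refine ⟨fun h => h.2 0, fun h => ⟨fun i => i.elim0, fun j => ?_⟩⟩
    rw [Subsingleton.elim j 0]
    exact h
  simp only [h1]
  rfl

theorem exists_pad_gen (H : C.germ m n) : ∃ H' : C.germ (m + 1) n,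
    (∀ p, H'.1 p = H.1 (Fin.init (α := fun _ => ℝ) p.1, p.2)) ∧
    C.T (m + 1) n H' = liftGen (C.T m n H) := by
  obtain ⟨h, hT⟩ := C.T_pad (k := 1) (l := 0) H
  refine ⟨⟨_, h⟩, fun p => rfl, ?_⟩
  ext e
  obtain ⟨⟨a, q⟩, rfl⟩ := (splitGen m n).equiv.surjective e
  refine (hT _).trans ?_
  have h1 : ((∀ i : Fin 1, ((splitGen m n).equiv (a, q)).1 (Fin.natAdd m i) = 0) ∧
      ∀ j : Fin 0, ((splitGen m n).equiv (a, q)).2 (Fin.natAdd n j) = 0) ↔ q = 0 := by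
    have h2 : ((splitGen m n).equiv (a, q)).1 (Fin.last m) = q :=
      Fin.snoc_last (α := fun _ => ℝ≥0) _ _
    refine ⟨fun h => h2.symm.trans (h.1 0), fun h => ⟨fun i => ?_, fun j => j.elim0⟩⟩
    rw [Subsingleton.elim i 0]
    exact h2.trans h
  simp only [h1]
  split_ifs with hq
  · subst hq
    refine Eq.trans ?_ ((splitGen m n).coeff_lift_self (C.T m n H) a).symm
    congr 1
    exact Prod.ext (Fin.init_snoc (α := fun _ => ℝ≥0) _ _) rfl
  · exact ((splitGen m n).coeff_lift_of_ne (C.T m n H) a hq).symm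

variable {C}

theorem tschirnhausen_mono (H : C.germ m n) (h0 : H.1 0 = 0) (e : Expo m (n + 1)) :
    (Elem.tschirnhausen H h0).mono e =
      (HahnSeries.single (e.1, Function.update e.2 (Fin.last n) 0) 1 : Series m (n + 1)) *
        (varStd m (Fin.last n) + liftStd (C.T m n H)) ^ e.2 (Fin.last n) := rfl

theorem exists_extends_gen_tschirnhausen (H : C.germ m n) (h0 : H.1 0 = 0) :
    ∃ ν₁ : C.Elem (m + 1) (n + 1) (m + 1) (n + 1), Extends (splitGen m (n + 1))
      (splitGen m (n + 1)) (Elem.tschirnhausen H h0).mono ν₁.mono := by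
  obtain ⟨H', hH', hT⟩ := C.exists_pad_gen H
  refine ⟨.tschirnhausen H' (by rw [hH']; exact h0), ?_⟩
  refine extends_single_mul (fun e p => rfl) (fun e p => ?_)
  rw [map_pow, map_add, splitGen_lift_varStd, hT]
  congr 2
  ext x
  obtain ⟨⟨a, q⟩, rfl⟩ := (splitGen m (n + 1)).equiv.surjective x
  rw [splitGen_equiv]
  have h1 : zGen a q = zStd (zGen (projStd m n a) q) (a.2 (Fin.last n)) := by
    refine Prod.ext rfl ?_
    exact (Fin.snoc_init_self (α := fun _ => ℕ) a.2).symm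
  rw [h1, coeff_liftStd, ← h1]
  by_cases hq : q = 0
  · subst hq
    have h2 := (splitGen m (n + 1)).coeff_lift_self (liftStd (C.T m n H)) a
    have h3 := (splitGen m n).coeff_lift_self (C.T m n H) (projStd m n a)
    rw [splitGen_equiv] at h2 h3
    rw [h2]
    conv_rhs => rw [← zStd_projStd a, coeff_liftStd]
    rw [← h3]; rfl
  · have h2 := (splitGen m (n + 1)).coeff_lift_of_ne (liftStd (C.T m n H)) a hq
    have h3 := (splitGen m n).coeff_lift_of_ne (C.T m n H) (projStd m n a) hq
    rw [splitGen_equiv] at h2 h3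
    rw [h2]
    split_ifs
    · exact h3
    · rfl

theorem splitStd'_apply (e : Expo m n) (q t : ℕ) :
    (splitStd' m n).equiv (zStd e t, q) = zStd (zStd e q) t :=
  Prod.ext rfl (snoc_snoc_swapLast _ _ _)

theorem update_snoc_last (a : Fin n → ℕ) (t : ℕ) :
    Function.update (Fin.snoc (α := fun _ => ℕ) a t : Fin (n + 1) → ℕ) (Fin.last n) 0 =
      Fin.snoc (α := fun _ => ℕ) a 0 := by
  rw [Fin.update_snoc_last]

theorem exists_extends_std_tschirnhausen (H : C.germ m n) (h0 : H.1 0 = 0) :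
    ∃ ν₁ : C.Elem m (n + 2) m (n + 2), Extends (splitStd' m n)
      (splitStd' m n) (Elem.tschirnhausen H h0).mono ν₁.mono := by
  obtain ⟨H', hH', hT⟩ := C.exists_pad_std H
  refine ⟨.tschirnhausen H' (by rw [hH']; exact h0), ?_⟩
  have hL : varStd m (Fin.last (n + 1)) + liftStd (C.T m (n + 1) H') =
      (splitStd' m n).lift (varStd m (Fin.last n) + liftStd (C.T m n H)) := by
    rw [map_add, hT]
    congr 1
    · rw [varStd, varStd, ← zStd_zero, ← zStd_zero, Splitting.lift_single, splitStd'_apply,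
        zStd_zero_zero]
    · ext x
      obtain ⟨⟨a, q⟩, rfl⟩ := (splitStd' m n).equiv.surjective x
      obtain ⟨⟨b, t⟩, rfl⟩ := (splitStd m n).equiv.surjective a
      rw [splitStd_equiv, splitStd'_apply, coeff_liftStd, coeff_liftStd, ← splitStd'_apply]
      by_cases hq : q = 0
      · subst hq
        rw [Splitting.coeff_lift_self, coeff_liftStd, if_pos rfl]
      · rw [Splitting.coeff_lift_of_ne _ _ _ hq, if_neg hq, ite_self]
  intro e p
  obtain ⟨⟨b, t⟩, rfl⟩ := (splitStd m n).equiv.surjective e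
  rw [splitStd_equiv, splitStd'_apply, tschirnhausen_mono, tschirnhausen_mono, hL, zStd_last,
    zStd_last, map_mul, map_pow, Splitting.lift_single]
  have h1 : ∀ (k : ℕ) (c : Expo m k), (((zStd c t).1, Function.update (zStd c t).2 (Fin.last k) 0) :
      Expo m (k + 1)) = zStd c 0 := fun k c => Prod.ext rfl (update_snoc_last _ _)
  rw [h1, h1, splitStd'_apply]
  have h2 : (0 : Expo m (n + 1)) = zStd 0 0 := zStd_zero_zero.symm
  have h3 : zStd (zStd b p) 0 = zStd (zStd b 0) 0 + zStd (zStd (0 : Expo m n) p) 0 := by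
    rw [← zStd_add, ← zStd_add, add_zero, zero_add]
  rw [h2, splitStd'_apply, h3]
  rw [show (HahnSeries.single (zStd (zStd b 0) 0 + zStd (zStd (0 : Expo m n) p) 0) (1 : ℝ)) =
    HahnSeries.single (zStd (zStd b 0) 0) 1 * HahnSeries.single (zStd (zStd 0 p) 0) 1 by
      rw [HahnSeries.single_mul_single, one_mul]]
  ring

variable (C)

theorem elemHom_mem_hat {m' n' : ℕ} (ν : C.Elem m' n' m n) {F : Series m n} (hF : F ∈ C.hat m n) :
    elemHom ν F ∈ C.hat m' n' := by
  obtain ⟨f, rfl⟩ := C.mem_hat.1 hF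
  obtain ⟨h, hT⟩ := C.elem ν f
  refine C.mem_hat.2 ⟨⟨_, h⟩, HahnSeries.coeff_injective ?_⟩
  rw [hT, coeff_elemHom]

theorem exists_perm (σ : Equiv.Perm (Fin m)) (τ : Equiv.Perm (Fin n)) {F : Series m n}
    (hF : F ∈ C.hat m n) : ∃ G ∈ C.hat m n, ∀ e, G.coeff e = F.coeff (permExpo σ τ e) := by
  obtain ⟨f, rfl⟩ := C.mem_hat.1 hF
  obtain ⟨h, hT⟩ := C.perm σ τ f
  exact ⟨_, C.mem_hat.2 ⟨_, rfl⟩, hT⟩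

theorem exists_slice_of_extends {m' n' M N M' N' : ℕ} {Q : Type*} [AddCommMonoid Q] [PartialOrder Q]
    [IsOrderedCancelAddMonoid Q] {s : Splitting (Expo m n) Q (Expo M N)}
    {s' : Splitting (Expo m' n') Q (Expo M' N')} {ν : C.Elem m' n' m n}
    {ν₁ : C.Elem M' N' M N} (h : Extends s s' ν.mono ν₁.mono) {F : Series M N}
    (hF : F ∈ C.hat M N) : ∃ G ∈ C.hat M' N', ∀ q, s'.slice q G = elemHom ν (s.slice q F) :=
  ⟨elemHom ν₁ F, C.elemHom_mem_hat ν₁ hF, fun q => h.slice_hom (isSubst ν) (isSubst ν₁) q F⟩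

theorem permExpo_swap_swap (σ : Equiv.Perm (Fin m)) (τ : Equiv.Perm (Fin n))
    (hσ : ∀ k, σ (σ k) = k) (hτ : ∀ k, τ (τ k) = k) (e : Expo m n) :
    permExpo σ τ (permExpo σ τ e) = e := by
  simp [permExpo_apply, hσ, hτ]

theorem exists_elem_slice_std {m' n' : ℕ} (ν : C.Elem m' n' m n) {F : Series m (n + 1)}
    (hF : F ∈ C.hat m (n + 1)) : ∃ G ∈ C.hat m' (n' + 1), ∀ q,
      (splitStd m' n').slice q G = elemHom ν ((splitStd m n).slice q F) := by
  cases ν with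
  | ramification i γ hK hpos =>
    exact C.exists_slice_of_extends (extends_std_ramification i γ hK hpos) hF
  | @tschirnhausen m n H h0 =>
    obtain ⟨ν₁, hν₁⟩ := exists_extends_std_tschirnhausen H h0
    obtain ⟨F', hF', hc⟩ := C.exists_perm 1 (swapLast n) hF
    obtain ⟨G', hG', hs⟩ := C.exists_slice_of_extends hν₁ hF'
    obtain ⟨G, hG, hc'⟩ := C.exists_perm 1 (swapLast n) hG'
    refine ⟨G, hG, fun q => ?_⟩
    have h1 : (splitStd m (n + 1)).slice q G = (splitStd' m n).slice q G' := by
      ext e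
      exact hc' _
    have h2 : (splitStd' m n).slice q F' = (splitStd m (n + 1)).slice q F := by
      ext e
      refine (hc _).trans (congrArg F.coeff ?_)
      exact permExpo_swap_swap 1 _ (fun _ => rfl) swapLast_swapLast _
    rw [h1, hs, h2]
  | linear i c => exact C.exists_slice_of_extends (extends_std_linear i c) hF
  | blowUp i j hji l hl => exact C.exists_slice_of_extends (extends_std_blowUp i j hji l hl) hF
  | blowUpZero i j hij => exact C.exists_slice_of_extends (extends_std_blowUpZero i j hij) hF
  | blowUpStd i j l => exact C.exists_slice_of_extends (extends_std_blowUpStd i j l) hF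
  | blowUpInfty s i j => exact C.exists_slice_of_extends (extends_std_blowUpInfty s i j) hF
  | reflection s i => exact C.exists_slice_of_extends (extends_std_reflection s i) hF

theorem exists_gen_swap {F : Series (m + 2) n} (hF : F ∈ C.hat (m + 2) n) :
    ∃ G ∈ C.hat (m + 2) n, ∀ q, (splitGen (m + 1) n).slice q G = (splitGen' m n).slice q F := by
  obtain ⟨G, hG, hc'⟩ := C.exists_perm (swapLast m) 1 hF
  refine ⟨G, hG, fun q => ?_⟩
  ext e
  exact hc' _

theorem exists_elem_slice_gen {m' n' : ℕ} (ν : C.Elem m' n' m n) {F : Series (m + 1) n}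
    (hF : F ∈ C.hat (m + 1) n) : ∃ G ∈ C.hat (m' + 1) n', ∀ q,
      (splitGen m' n').slice q G = elemHom ν ((splitGen m n).slice q F) := by
  cases ν with
  | ramification i γ hK hpos =>
    exact C.exists_slice_of_extends (extends_gen_ramification i γ hK hpos) hF
  | tschirnhausen H h0 =>
    obtain ⟨ν₁, hν₁⟩ := exists_extends_gen_tschirnhausen H h0
    exact C.exists_slice_of_extends hν₁ hF
  | linear i c => exact C.exists_slice_of_extends (extends_gen_linear i c) hF
  | blowUp i j hji l hl => exact C.exists_slice_of_extends (extends_gen_blowUp i j hji l hl) hF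
  | blowUpZero i j hij => exact C.exists_slice_of_extends (extends_gen_blowUpZero i j hij) hF
  | blowUpStd i j l => exact C.exists_slice_of_extends (extends_gen_blowUpStd i j l) hF
  | blowUpInfty s i j =>
    obtain ⟨G, hG, hs⟩ := C.exists_slice_of_extends (extends_gen_blowUpInfty s i j) hF
    obtain ⟨G', hG', hs'⟩ := C.exists_gen_swap hG
    exact ⟨G', hG', fun q => (hs' q).trans (hs q)⟩
  | reflection s i =>
    obtain ⟨G, hG, hs⟩ := C.exists_slice_of_extends (extends_gen_reflection s i) hF
    obtain ⟨G', hG', hs'⟩ := C.exists_gen_swap hG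
    exact ⟨G', hG', fun q => (hs' q).trans (hs q)⟩

theorem exists_adm_slice_std {m' n' : ℕ} (ρ : C.Adm m' n' m n) {F : Series m (n + 1)}
    (hF : F ∈ C.hat m (n + 1)) : ∃ G ∈ C.hat m' (n' + 1), ∀ q,
      (splitStd m' n').slice q G = admHom ρ ((splitStd m n).slice q F) := by
  induction ρ with
  | refl => exact ⟨F, hF, fun q => rfl⟩
  | comp ν ρ ih =>
    obtain ⟨G, hG, hs⟩ := C.exists_elem_slice_std ν hF
    obtain ⟨G', hG', hs'⟩ := ih hG
    exact ⟨G', hG', fun q => by rw [hs', hs]; rfl⟩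

theorem exists_adm_slice_gen {m' n' : ℕ} (ρ : C.Adm m' n' m n) {F : Series (m + 1) n}
    (hF : F ∈ C.hat (m + 1) n) : ∃ G ∈ C.hat (m' + 1) n', ∀ q,
      (splitGen m' n').slice q G = admHom ρ ((splitGen m n).slice q F) := by
  induction ρ with
  | refl => exact ⟨F, hF, fun q => rfl⟩
  | comp ν ρ ih =>
    obtain ⟨G, hG, hs⟩ := C.exists_elem_slice_gen ν hF
    obtain ⟨G', hG', hs'⟩ := ih hG
    exact ⟨G', hG', fun q => by rw [hs', hs]; rfl⟩

end GeneralisedQuasianalyticClass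


theorem coeff_mul_of_maps {Γ Γ' : Type*} [AddCommMonoid Γ] [PartialOrder Γ]
    [IsOrderedCancelAddMonoid Γ] [AddCommMonoid Γ'] [PartialOrder Γ'] [IsOrderedCancelAddMonoid Γ']
    {α β γ : Γ' → Γ} (hα : Function.Injective α) (hβ : Function.Injective β)
    (hγ : Function.Injective γ) (hadd : ∀ a b, α a + β b = γ (a + b))
    {f g : HahnSeries Γ ℝ} {f' g' : HahnSeries Γ' ℝ} (hf : ∀ a, f'.coeff a = f.coeff (α a))
    (hg : ∀ b, g'.coeff b = g.coeff (β b))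
    (h : ∀ x y e, f.coeff x ≠ 0 → g.coeff y ≠ 0 → x + y = γ e → ∃ a b, x = α a ∧ y = β b)
    (e : Γ') : (f * g).coeff (γ e) = (f' * g').coeff e := by
  rw [HahnSeries.coeff_mul, HahnSeries.coeff_mul]
  symm
  refine Finset.sum_bij (fun p _ => (α p.1, β p.2)) ?_ ?_ ?_ ?_
  · rintro ⟨a, b⟩ hab
    rw [Finset.mem_antidiagonal] at hab ⊢
    obtain ⟨ha, hb, rfl⟩ := hab
    refine ⟨?_, ?_, hadd a b⟩
    · rw [HahnSeries.mem_support, ← hf]; exact ha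
    · rw [HahnSeries.mem_support, ← hg]; exact hb
  · rintro ⟨a, b⟩ _ ⟨a', b'⟩ _ hab
    exact Prod.ext (hα (congrArg Prod.fst hab)) (hβ (congrArg Prod.snd hab))
  · rintro ⟨x, y⟩ hxy
    rw [Finset.mem_antidiagonal] at hxy
    obtain ⟨hx, hy, hxy⟩ := hxy
    obtain ⟨a, b, rfl, rfl⟩ := h x y e hx hy hxy
    refine ⟨(a, b), ?_, rfl⟩
    rw [Finset.mem_antidiagonal]
    refine ⟨?_, ?_, hγ ?_⟩
    · rw [HahnSeries.mem_support, hf]; exact hx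
    · rw [HahnSeries.mem_support, hg]; exact hy
    · exact (hadd a b).symm.trans hxy
  · rintro ⟨a, b⟩ _
    rw [hf, hg]

theorem Splitting.slice_lift_mul {Γ Q Γ₁ : Type*} [AddCommMonoid Γ] [PartialOrder Γ]
    [IsOrderedCancelAddMonoid Γ] [AddCommMonoid Q] [PartialOrder Q] [IsOrderedCancelAddMonoid Q]
    [AddCommMonoid Γ₁] [PartialOrder Γ₁] [IsOrderedCancelAddMonoid Γ₁] (s : Splitting Γ Q Γ₁)
    (u : HahnSeries Γ ℝ) (f : HahnSeries Γ₁ ℝ) (q : Q) :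
    s.slice q (s.lift u * f) = u * s.slice q f := by
  classical
  have hi : ∀ q, Function.Injective fun e => s.equiv (e, q) :=
    fun q a b hab => congrArg Prod.fst (s.equiv.injective hab)
  ext e
  rw [s.coeff_slice]
  refine coeff_mul_of_maps (α := fun e => s.equiv (e, 0)) (β := fun e => s.equiv (e, q))
    (γ := fun e => s.equiv (e, q)) (hi 0) (hi q) (hi q) (fun a b => ?_)
    (fun a => (s.coeff_lift_self u a).symm) (fun b => s.coeff_slice q f b) ?_ e
  · rw [← s.map_add, Prod.mk_add_mk, zero_add]
  · intro x y e hx _ hxy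
    obtain ⟨⟨a, p⟩, rfl⟩ := s.equiv.surjective x
    obtain ⟨⟨b, r⟩, rfl⟩ := s.equiv.surjective y
    have hp : p = 0 := not_not.1 fun hp => hx (s.coeff_lift_of_ne u a hp)
    subst hp
    rw [← s.map_add] at hxy
    have := congrArg Prod.snd (s.equiv.injective hxy)
    simp only [Prod.mk_add_mk, zero_add] at this
    exact ⟨a, b, rfl, by rw [this]⟩

section Cramer

variable {R W ι : Type*} [CommRing R]

/-- The minors of the matrix `F`. -/
def minor (F : W → ι → R) {r : ℕ} (I : Fin r → W) (J : Fin r → ι) : R :=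
  (Matrix.of fun a b => F (I a) (J b)).det

theorem minor_mul_eq_sum {F : W → ι → R} {r : ℕ}
    (h : ∀ (I : Fin (r + 1) → W) (J : Fin (r + 1) → ι), minor F I J = 0) (I : Fin r → W)
    (J : Fin r → ι) (w : W) (j : ι) :
    minor F I J * F w j = ∑ i : Fin r, (-1) ^ (i : ℕ) *
      minor F (fun a => (Fin.cons w I : Fin (r + 1) → W) (i.succ.succAbove a)) J * F (I i) j := by
  have h1 := h (Fin.cons w I) (Fin.cons j J)
  rw [minor, Matrix.det_succ_column_zero, Fin.sum_univ_succ] at h1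
  have h2 : ∀ k : Fin (r + 1), (Matrix.of fun a b => F ((Fin.cons w I : Fin (r + 1) → W) a)
      ((Fin.cons j J : Fin (r + 1) → ι) b)).submatrix k.succAbove Fin.succ =
      Matrix.of fun a b => F ((Fin.cons w I : Fin (r + 1) → W) (k.succAbove a)) (J b) := by
    intro k; ext a b; rfl
  simp only [h2, Matrix.of_apply, Fin.cons_zero, Fin.cons_succ, Fin.succAbove_zero, Fin.val_zero,
    pow_zero, one_mul, Fin.val_succ] at h1
  have h3 := eq_neg_of_add_eq_zero_left h1
  rw [mul_comm]
  refine h3.trans ?_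
  rw [← Finset.sum_neg_distrib]
  refine Finset.sum_congr rfl fun i _ => ?_
  rw [minor, pow_succ]
  ring

theorem exists_max_minor [Nontrivial R] [Fintype ι] (F : W → ι → R) :
    ∃ r : ℕ, (∃ (I : Fin r → W) (J : Fin r → ι), minor F I J ≠ 0) ∧
      ∀ (I : Fin (r + 1) → W) (J : Fin (r + 1) → ι), minor F I J = 0 := by
  classical
  by_contra hcon
  push Not at hcon
  have h1 : ∀ r : ℕ, ∃ (I : Fin r → W) (J : Fin r → ι), minor F I J ≠ 0 := by
    intro r
    induction r with
    | zero => exact ⟨Fin.elim0, Fin.elim0, by simp [minor]⟩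
    | succ r ih =>
      obtain ⟨I, J, h⟩ := ih
      exact hcon r ⟨I, J, h⟩
  obtain ⟨I, J, h⟩ := h1 (Fintype.card ι + 1)
  obtain ⟨a, b, hab, hJ⟩ := Fintype.exists_ne_map_eq_of_card_lt J (by simp)
  exact h (Matrix.det_zero_of_column_eq hab fun k => by simp [hJ])

theorem map_minor {S : Type*} [CommRing S] (θ : R →+* S) (F : W → ι → R) {r : ℕ} (I : Fin r → W)
    (J : Fin r → ι) : minor (fun w j => θ (F w j)) I J = θ (minor F I J) := by
  rw [minor, minor, RingHom.map_det]
  rfl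

theorem minor_mem {K : Type*} [CommRing K] [Algebra K R] (B : Subalgebra K R) {F : W → ι → R}
    (hF : ∀ w j, F w j ∈ B) {r : ℕ} (I : Fin r → W) (J : Fin r → ι) : minor F I J ∈ B := by
  have : minor F I J = B.val (minor (fun w j => (⟨F w j, hF w j⟩ : B)) I J) :=
    map_minor (B.val : B →+* R) (fun w j => (⟨F w j, hF w j⟩ : B)) I J
  rw [this]
  exact Subtype.mem _

end Cramer

/-- Finitely many rows of `F` span all of them. -/
def FinSpan {R W ι : Type*} [CommRing R] (F : W → ι → R) : Prop :=
  ∃ E : Finset W, ∀ w, F w ∈ Submodule.span R (F '' E)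

theorem FinSpan.of_isUnit {R W ι : Type*} [CommRing R] {F : W → ι → R} {r : ℕ} {I : Fin r → W}
    {δ : R} (hδ : IsUnit δ) (c : W → Fin r → R) (h : ∀ w j, δ * F w j = ∑ i, c w i * F (I i) j) :
    FinSpan F := by
  classical
  obtain ⟨v, hv⟩ := hδ.exists_left_inv
  refine ⟨Finset.univ.image I, fun w => ?_⟩
  have : F w = ∑ i, (v * c w i) • F (I i) := by
    ext j
    rw [Finset.sum_apply]
    calc F w j = v * (δ * F w j) := by rw [← mul_assoc, hv, one_mul]
      _ = _ := by
        rw [h, Finset.mul_sum]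
        exact Finset.sum_congr rfl fun i _ => by
          rw [Pi.smul_apply, smul_eq_mul, mul_assoc]
  rw [this]
  refine Submodule.sum_mem _ fun i _ => Submodule.smul_mem _ _ (Submodule.subset_span ⟨I i, ?_, rfl⟩)
  simp

namespace GeneralisedQuasianalyticClass

variable {C : GeneralisedQuasianalyticClass} {m n : ℕ}

/-- Morphisms extending, slice by slice in the last standard variable, a morphism that
satisfies `Q`. -/
inductive ExtStd (Q : HomProp m n) : HomProp m (n + 1)
  | mk {m' n' : ℕ} (θ : Series m n →ₐ[ℝ] Series m' n')
      (θ₁ : Series m (n + 1) →ₐ[ℝ] Series m' (n' + 1)) (h : Q m' n' θ)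
      (hs : ∀ q f, (splitStd m' n').slice q (θ₁ f) = θ ((splitStd m n).slice q f)) :
      ExtStd Q m' (n' + 1) θ₁

theorem ExtStd.comp_elemHom {m' n' : ℕ} {ν : C.Elem m' n' m n} {ν₁ : C.Elem m' (n' + 1) m (n + 1)}
    (hx : Extends (splitStd m n) (splitStd m' n') ν.mono ν₁.mono) {Q : HomProp m n}
    (h : C.After (ExtStd fun k l θ => Q k l (θ.comp (elemHom ν)))) :
    C.After fun k l θ => ExtStd Q k l (θ.comp (elemHom ν₁)) := by
  refine h.mono fun k l θ₁ _ hθ => ?_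
  obtain ⟨θ, _, hQ, hs⟩ := hθ
  refine .mk _ _ hQ fun q f => (hs _ _).trans ?_
  rw [AlgHom.comp_apply]
  congr 1
  exact hx.slice_hom (isSubst ν) (isSubst ν₁) q f

theorem After.extStd {Q : HomProp m n} (h : C.After Q) : C.After (ExtStd Q) := by
  induction h with
  | base h => exact .base (.mk (AlgHom.id ℝ _) _ h fun q f => rfl)
  | step E hE h ih =>
    cases hE with
    | ramification i γ hK hpos =>
      refine .step _ (.ramification i γ hK hpos) ?_
      rintro ν rfl
      exact ExtStd.comp_elemHom (extends_std_ramification i γ hK hpos) (ih _ rfl)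
    | linear i c =>
      refine .step _ (.linear i.castSucc (Fin.snoc (α := fun _ => ℝ) c 0)) ?_
      rintro ν rfl
      exact ExtStd.comp_elemHom (extends_std_linear i c) (ih _ rfl)
    | blowUp i j hji =>
      refine .step _ (.blowUp i j hji) ?_
      rintro ν (⟨l, rfl⟩ | rfl | rfl)
      · exact ExtStd.comp_elemHom (extends_std_blowUp i j hji l.1 l.2) (ih _ (.inl ⟨l, rfl⟩))
      · exact ExtStd.comp_elemHom (extends_std_blowUpZero _ _ _) (ih _ (.inr (.inl rfl)))
      · exact ExtStd.comp_elemHom (extends_std_blowUpZero _ _ _) (ih _ (.inr (.inr rfl)))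

variable (C)

/-- Every tame family of vectors of series is spanned by finitely many of its members after an
admissible family of toric transformations. -/
def FinSpanAfter (m n : ℕ) : Prop :=
  ∀ (W ι : Type) [Fintype ι] (F : W → ι → Series m n) (M : AddSubmonoid (Expo m n)),
    C.Tame M → (∀ w j, F w j ∈ suppIn M) →
      C.After fun _ _ θ => FinSpan fun w j => θ (F w j)

variable {C}

theorem FinSpanAfter.of_regular (ih : C.FinSpanAfter m n) {W ι : Type} [Fintype ι]
    (F : W → ι → Series m (n + 1)) {N : AddSubmonoid (Expo m n)} (hN : C.Tame N) {k r : ℕ}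
    {δ : Series m (n + 1)} (hδ : RegularStd k δ) (hδN : δ ∈ suppIn (cyl N)) (I : Fin r → W)
    (c : W → Fin r → Series m (n + 1)) (hc : ∀ w i, c w i ∈ suppIn (cyl N))
    (h : ∀ w j, δ * F w j = ∑ i, c w i * F (I i) j) :
    C.After fun _ _ θ => FinSpan fun w j => θ (F w j) := by
  classical
  choose g R hRN hcR hRk using fun w i => hδ.division hN.isPWO hδN (hc w i)
  have h1 := ih W (Fin r × Fin k) (fun w p => (splitStd m n).slice (p.2 : ℕ) (R w p.1)) N hN
    fun w p e he => hRN w p.1 he |> fun h2 => by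
      have : projStd m n (zStd e p.2) ∈ N := h2
      rwa [projStd_zStd] at this
  refine ((h1.mono (Q := fun _ _ θ => TameHom (C := C) θ ∧ FinSpan _)
    fun _ _ θ hθ hP => ⟨hθ, hP⟩).extStd).mono fun m₁ n₁ θ₁ _ hθ₁ => ?_
  obtain @⟨_, n₂, θ, θ₁, ⟨hθ, E, hE⟩, hs⟩ := hθ₁
  have hreg : RegularStd k (θ₁ δ) := by
    have h2 : ∀ q, (θ₁ δ).coeff (zStd 0 q) = δ.coeff (zStd 0 q) := by
      intro q
      have := congrArg (fun f : Series _ _ => f.coeff 0) (hs q δ)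
      rw [hθ.coeff_zero] at this
      exact this
    exact ⟨fun j hj => (h2 j).trans (hδ.1 j hj), fun h3 => hδ.2 ((h2 k).symm.trans h3)⟩
  have hR : ∀ w, ∃ u : W → Series _ _, ∀ i,
      θ₁ (R w i) = ∑ e ∈ E, (splitStd _ _).lift (u e) * θ₁ (R e i) := by
    intro w
    obtain ⟨u, hu⟩ := (Submodule.mem_span_image_finset_iff_exists_fun' _).1 (hE w)
    refine ⟨u, fun i => (splitStd _ _).ext_slice fun q => ?_⟩
    rw [hs, map_sum]
    simp only [Splitting.slice_lift_mul, hs]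
    by_cases hq : q < k
    · have := congrFun hu (i, ⟨q, hq⟩)
      rw [Finset.sum_apply] at this
      exact this.symm
    · have h0 : ∀ w, (splitStd m n).slice q (R w i) = 0 := by
        intro w
        ext e
        by_contra hne
        refine hq ?_
        have := hRk w i (zStd e q) hne
        rwa [zStd_last] at this
      simp [h0]
  choose u hu using hR
  refine ⟨E ∪ Finset.univ.image I, fun w => ?_⟩
  set V := Submodule.span (Series m₁ (n₂ + 1))
    ((fun w j => θ₁ (F w j)) '' ((E ∪ Finset.univ.image I : Finset W) : Set W)) with hV
  have hEV : ∀ e ∈ E, (fun j => θ₁ (F e j)) ∈ V := fun e he =>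
    Submodule.subset_span ⟨e, by simp [he], rfl⟩
  have hIV : ∀ i, (fun j => θ₁ (F (I i) j)) ∈ V := fun i =>
    Submodule.subset_span ⟨I i, by simp, rfl⟩
  have hres : ∀ w j, θ₁ δ * (θ₁ (F w j) - ∑ i, θ₁ (g w i) * θ₁ (F (I i) j)) =
      ∑ i, θ₁ (R w i) * θ₁ (F (I i) j) := by
    intro w j
    have h2 := congrArg θ₁ (h w j)
    rw [map_mul, map_sum] at h2
    rw [mul_sub, h2, Finset.mul_sum, ← Finset.sum_sub_distrib]
    refine Finset.sum_congr rfl fun i _ => ?_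
    rw [hcR w i]
    simp only [map_mul, map_add]
    ring
  have key : ∀ j, θ₁ (F w j) = ∑ i, θ₁ (g w i) * θ₁ (F (I i) j) +
      ∑ e ∈ E, (splitStd _ _).lift (u w e) *
        (θ₁ (F e j) - ∑ i, θ₁ (g e i) * θ₁ (F (I i) j)) := by
    intro j
    rw [← sub_eq_iff_eq_add', ← sub_eq_zero]
    refine hreg.eq_zero_of_mul ?_
    rw [mul_sub, hres, Finset.mul_sum]
    have h3 : ∀ e ∈ E, θ₁ δ * ((splitStd _ _).lift (u w e) *
        (θ₁ (F e j) - ∑ i, θ₁ (g e i) * θ₁ (F (I i) j))) =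
        ∑ i, (splitStd _ _).lift (u w e) * θ₁ (R e i) * θ₁ (F (I i) j) := by
      intro e _
      rw [mul_left_comm, hres, Finset.mul_sum]
      exact Finset.sum_congr rfl fun i _ => (mul_assoc _ _ _).symm
    rw [Finset.sum_congr rfl h3, Finset.sum_comm, sub_eq_zero]
    refine Finset.sum_congr rfl fun i _ => ?_
    rw [hu w i, Finset.sum_mul]
  have hw : (fun j => θ₁ (F w j)) = ∑ i, θ₁ (g w i) • (fun j => θ₁ (F (I i) j)) +
      ∑ e ∈ E, (splitStd _ _).lift (u w e) •
        ((fun j => θ₁ (F e j)) - ∑ i, θ₁ (g e i) • (fun j => θ₁ (F (I i) j))) := by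
    ext1 j
    rw [key j]
    simp [Finset.sum_apply, smul_eq_mul]
  change (fun j => θ₁ (F w j)) ∈ V
  rw [hw]
  refine add_mem (sum_mem fun i _ => V.smul_mem _ (hIV i)) (sum_mem fun e he => V.smul_mem _ ?_)
  exact sub_mem (hEV e he) (sum_mem fun i _ => V.smul_mem _ (hIV i))

end GeneralisedQuasianalyticClass


section MinimalExponents

variable {m n : ℕ} {V : Type*}

/-- `B` is a set of exponents of generalised variables occurring in the family `μ`, and each
exponent that occurs is bounded below by an element of `B`. -/
structure Corners (μ : V → Series m n) (B : Finset (Fin m → ℝ≥0)) : Prop where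
  exists_le : ∀ v e, (μ v).coeff e ≠ 0 → ∃ b ∈ B, b ≤ e.1
  exists_eq : ∀ b ∈ B, ∃ v e, (μ v).coeff e ≠ 0 ∧ e.1 = b

theorem exists_corners (μ : V → Series m n) {M : AddSubmonoid (Expo m n)}
    (hM : (M : Set (Expo m n)).IsPWO) (hμ : ∀ v, μ v ∈ suppIn M) : ∃ B, Corners μ B := by
  let T : Set (Fin m → ℝ≥0) := {a | ∃ v e, (μ v).coeff e ≠ 0 ∧ e.1 = a}
  have hT : T.IsPWO := by
    refine (hM.image_of_monotone (f := Prod.fst) monotone_fst).mono ?_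
    rintro a ⟨v, e, he, rfl⟩
    exact ⟨e, hμ v he, rfl⟩
  have hfin : {a | Minimal (· ∈ T) a}.Finite :=
    (setOfPred_minimal_antichain (· ∈ T)).finite_of_partiallyWellOrderedOn
      (Set.IsPWO.mono hT fun a ha => ha.1)
  refine ⟨hfin.toFinset, fun v e he => ?_, fun b hb => ?_⟩
  · obtain ⟨b, hb, hbm⟩ := hT.exists_le_minimal (a := e.1) ⟨v, e, he, rfl⟩
    exact ⟨b, hfin.mem_toFinset.2 hbm, hb⟩
  · exact (hfin.mem_toFinset.1 hb).1

/-- `a` is the least exponent of generalised variables occurring in `μ`. -/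
def HasLeastExp (μ : V → Series m n) (a : Fin m → ℝ≥0) : Prop :=
  (∀ v e, (μ v).coeff e ≠ 0 → a ≤ e.1) ∧ ∃ v e, (μ v).coeff e ≠ 0 ∧ e.1 = a

theorem coeff_isSubst_of_single {μ : Expo m n → Series m n} (h : IsSubst μ)
    {φ : (Fin m → ℝ≥0) → (Fin m → ℝ≥0)} (hφ : Function.Injective φ)
    (hμ : ∀ e, μ e = HahnSeries.single (φ e.1, e.2) 1) (f : Series m n) (e : Expo m n) :
    (h.hom f).coeff (φ e.1, e.2) = f.coeff e := by
  classical
  rw [h.coeff_hom, finsum_eq_single _ e]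
  · rw [hμ, HahnSeries.coeff_single_same, mul_one]
  · intro e' he'
    rw [hμ, HahnSeries.coeff_single_of_ne, mul_zero]
    intro h2
    exact he' (Prod.ext (hφ (congrArg Prod.fst h2)).symm (congrArg Prod.snd h2).symm)

theorem Corners.map {μ : V → Series m n} {B : Finset (Fin m → ℝ≥0)} (hB : Corners μ B)
    {ν : Expo m n → Series m n} (h : IsSubst ν) {φ : (Fin m → ℝ≥0) → (Fin m → ℝ≥0)}
    (hφ : Function.Injective φ) (hmono : Monotone φ)
    (hν : ∀ e, ν e = HahnSeries.single (φ e.1, e.2) 1) :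
    Corners (fun v => h.hom (μ v)) (B.image φ) := by
  refine ⟨fun v e he => ?_, fun b hb => ?_⟩
  · obtain ⟨e', he', hee⟩ := h.exists_of_coeff_hom_ne he
    rw [hν] at hee
    obtain ⟨b, hb, hbe⟩ := hB.exists_le v e' he'
    exact ⟨φ b, Finset.mem_image_of_mem _ hb, (coeff_single_ne_zero hee) ▸ hmono hbe⟩
  · obtain ⟨b, hbB, rfl⟩ := Finset.mem_image.1 hb
    obtain ⟨v, e, he, rfl⟩ := hB.exists_eq b hbB
    exact ⟨v, (φ e.1, e.2), by rwa [coeff_isSubst_of_single h hφ hν], rfl⟩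

theorem update_mul_injective (i : Fin m) {γ : ℝ≥0} (hγ : 0 < γ) :
    Function.Injective fun a : Fin m → ℝ≥0 => Function.update a i (γ * a i) := by
  intro a b hab
  ext k
  have := congrFun hab k
  by_cases hk : k = i
  · subst hk
    simp only [Function.update_self] at this
    rw [mul_left_cancel₀ hγ.ne' this]
  · simpa [hk] using congrArg NNReal.toReal this

theorem update_mul_monotone (i : Fin m) (γ : ℝ≥0) :
    Monotone fun a : Fin m → ℝ≥0 => Function.update a i (γ * a i) := by
  intro a b hab
  exact update_le_update_iff.2 ⟨mul_le_mul_right (hab i) _, fun k _ => hab k⟩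

theorem update_add_injective {i j : Fin m} (hij : i ≠ j) :
    Function.Injective fun a : Fin m → ℝ≥0 => Function.update a j (a j + a i) := by
  intro a b hab
  have hne : ∀ k, k ≠ j → a k = b k := by
    intro k hk
    simpa [hk] using congrFun hab k
  ext k
  by_cases hk : k = j
  · subst hk
    have := congrFun hab k
    simp only [Function.update_self] at this
    rw [hne i hij] at this
    rw [add_right_cancel this]
  · rw [hne k hk]

theorem update_add_monotone (i j : Fin m) :
    Monotone fun a : Fin m → ℝ≥0 => Function.update a j (a j + a i) := by
  intro a b hab
  exact update_le_update_iff.2 ⟨add_le_add (hab j) (hab i), fun k _ => hab k⟩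

end MinimalExponents

namespace GeneralisedQuasianalyticClass

variable {C : GeneralisedQuasianalyticClass} {m n : ℕ}

theorem After.of_ramification {Q : HomProp m n} (i : Fin m) (γ : ℝ≥0) (hK : γ ∈ C.K) (hpos : 0 < γ)
    (h : C.After fun k l θ => Q k l (θ.comp (elemHom (.ramification i γ hK hpos)))) :
    C.After Q := by
  refine .step _ (.ramification i γ hK hpos) ?_
  rintro ν rfl
  exact h

theorem After.of_blowUp {Q : HomProp m n} (i j : Fin m) (hij : i ≠ j)
    (h : ∀ k l θ, k < m → Q k l θ)
    (h₁ : C.After fun k l θ => Q k l (θ.comp (elemHom (C := C) (.blowUpZero i j hij))))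
    (h₂ : C.After fun k l θ => Q k l (θ.comp (elemHom (C := C) (.blowUpZero j i hij.symm)))) :
    C.After Q := by
  wlog hji : j < i generalizing i j
  · exact this j i hij.symm h₂ h₁ ((not_lt.1 hji).lt_of_ne hij)
  obtain ⟨m, rfl⟩ : ∃ m', m = m' + 1 := ⟨m - 1, by have := i.pos; omega⟩
  obtain ⟨j, rfl⟩ := Fin.exists_castSucc_eq.2 (hji.trans_le (Fin.le_last i)).ne
  refine .step _ (.blowUp i j hji) ?_
  rintro ν (⟨l, rfl⟩ | rfl | rfl)
  · exact .base (h _ _ _ (Nat.lt_succ_self m))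
  · exact h₁
  · exact h₂

/-- The number of generalised variables drops, or it does not and the family `μ` acquires a least
exponent. -/
def LeastExpProp {V : Type*} (μ : V → Series m n) : HomProp m n :=
  fun k l θ => k < m ∨ k = m ∧ l = n ∧ ∃ a, HasLeastExp (fun v => θ (μ v)) a

theorem after_leastExp_of_pair {V : Type*} {c : ℕ}
    (ih : ∀ (μ : V → Series m n) (B : Finset (Fin m → ℝ≥0)), Corners μ B → B.Nonempty →
      B.card ≤ c → (∀ v e, (μ v).coeff e ≠ 0 → e ∈ C.KExpo m n) → C.After (LeastExpProp μ)) :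
    ∀ (d : ℕ) (μ : V → Series m n) (B : Finset (Fin m → ℝ≥0)) (a b : Fin m → ℝ≥0), Corners μ B →
      a ∈ B → b ∈ B → a ≠ b → B.card ≤ c + 1 →
      (Finset.univ.filter fun i => a i ≠ b i).card ≤ d →
      (∀ v e, (μ v).coeff e ≠ 0 → e ∈ C.KExpo m n) → C.After (LeastExpProp μ) := by
  classical
  have hcomp : ∀ (μ : V → Series m n) (B : Finset (Fin m → ℝ≥0)) (a b : Fin m → ℝ≥0),
      Corners μ B → a ∈ B → b ∈ B → a ≠ b → B.card ≤ c + 1 → a ≤ b →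
      (∀ v e, (μ v).coeff e ≠ 0 → e ∈ C.KExpo m n) → C.After (LeastExpProp μ) := by
    intro μ B a b hB ha hb hab hc hle hK
    refine ih μ (B.erase b) ⟨fun v e he => ?_, fun x hx => hB.exists_eq x (Finset.mem_of_mem_erase hx)⟩
      ⟨a, Finset.mem_erase.2 ⟨hab, ha⟩⟩ (by rw [Finset.card_erase_of_mem hb]; omega) hK
    obtain ⟨x, hx, hxe⟩ := hB.exists_le v e he
    by_cases hxb : x = b
    · exact ⟨a, Finset.mem_erase.2 ⟨hab, ha⟩, hle.trans (hxb ▸ hxe)⟩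
    · exact ⟨x, Finset.mem_erase.2 ⟨hxb, hx⟩, hxe⟩
  intro d
  induction d with
  | zero =>
    intro μ B a b hB ha hb hab hc hd hK
    refine absurd (funext fun i => ?_) hab
    by_contra hne
    have : i ∈ Finset.univ.filter fun i => a i ≠ b i := by simpa using hne
    rw [Finset.card_eq_zero.1 (Nat.le_zero.1 hd)] at this
    simp at this
  | succ d ihd =>
    intro μ B a b hB ha hb hab hc hd hK
    by_cases h1 : a ≤ b
    · exact hcomp μ B a b hB ha hb hab hc h1 hK
    by_cases h2 : b ≤ a
    · exact hcomp μ B b a hB hb ha hab.symm hc h2 hK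
    obtain ⟨j, hj⟩ : ∃ j, b j < a j := by simpa [Pi.le_def] using h1
    obtain ⟨i, hi⟩ : ∃ i, a i < b i := by simpa [Pi.le_def] using h2
    have hij : i ≠ j := by rintro rfl; exact hi.asymm hj
    have hKB : ∀ x ∈ B, ∀ k, x k ∈ C.K := by
      intro x hx k
      obtain ⟨v, e, he, rfl⟩ := hB.exists_eq x hx
      exact hK v e he k
    set γ := a j - b j with hγ
    set γ' := b i - a i with hγ'
    have hpos : 0 < γ := tsub_pos_of_lt hj
    have hpos' : 0 < γ' := tsub_pos_of_lt hi
    have hγK : γ ∈ C.K := C.sub_mem_K (hKB a ha j) (hKB b hb j)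
    have hγK' : γ' ∈ C.K := C.sub_mem_K (hKB b hb i) (hKB a ha i)
    set φ : (Fin m → ℝ≥0) → (Fin m → ℝ≥0) := fun x => Function.update x i (γ * x i) with hφ
    set φ' : (Fin m → ℝ≥0) → (Fin m → ℝ≥0) := fun x => Function.update x j (γ' * x j) with hφ'
    have hφi := update_mul_injective i hpos
    have hφi' := update_mul_injective j hpos'
    refine .of_ramification i γ hγK hpos (.of_ramification j γ' hγK' hpos' ?_)
    have hB₂ := (hB.map (isSubst (.ramification (n := n) i γ hγK hpos)) hφi
      (update_mul_monotone i γ) fun e => rfl).map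
      (isSubst (.ramification (n := n) j γ' hγK' hpos')) hφi' (update_mul_monotone j γ') fun e => rfl
    have hsum : φ' (φ a) i + φ' (φ a) j = φ' (φ b) i + φ' (φ b) j := by
      have e1 : a j = b j + γ := (add_tsub_cancel_of_le hj.le).symm
      have e2 : b i = a i + γ' := (add_tsub_cancel_of_le hi.le).symm
      simp only [hφ, hφ', Function.update_self, Function.update_of_ne hij, Function.update_of_ne hij.symm]
      rw [e1, e2]
      ring
    have key : ∀ p q : Fin m, ∀ hpq : p ≠ q, a q ≠ b q →
        φ' (φ a) q + φ' (φ a) p = φ' (φ b) q + φ' (φ b) p →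
        C.After fun k l θ => LeastExpProp μ k l (((θ.comp (elemHom (C := C)
          (.blowUpZero p q hpq))).comp (elemHom (C := C) (.ramification j γ' hγK' hpos'))).comp
            (elemHom (C := C) (.ramification i γ hγK hpos))) := by
      intro p q hpq hab hsum
      have hB₃ := hB₂.map (isSubst (C := C) (.blowUpZero (n := n) p q hpq)) (update_add_injective hpq)
        (update_add_monotone p q) fun e => rfl
      refine ihd _ _ _ _ hB₃ (Finset.mem_image_of_mem _ (Finset.mem_image_of_mem _
        (Finset.mem_image_of_mem _ ha))) (Finset.mem_image_of_mem _ (Finset.mem_image_of_mem _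
        (Finset.mem_image_of_mem _ hb))) ?_ ?_ ?_ ?_
      · exact fun h => ‹a ≠ b› (hφi (hφi' (update_add_injective hpq h)))
      · exact Finset.card_image_le.trans (Finset.card_image_le.trans (Finset.card_image_le.trans hc))
      · refine Nat.lt_succ_iff.1 (lt_of_lt_of_le (Finset.card_lt_card ?_) hd)
        refine Finset.ssubset_iff_of_subset ?_ |>.2 ⟨q, by simpa using hab, ?_⟩
        · intro k hk
          simp only [Finset.mem_filter, Finset.mem_univ, true_and] at hk ⊢
          intro hk'
          refine hk ?_
          by_cases hkq : k = q
          · subst hkq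
            simp only [Function.update_self]
            exact hsum
          · rw [Function.update_of_ne hkq, Function.update_of_ne hkq]
            have h4 : ∀ x : Fin m → ℝ≥0, φ x k = if k = i then γ * x k else x k := by
              intro x
              by_cases hki : k = i
              · subst hki; simp [hφ]
              · simp [hφ, hki]
            have h5 : ∀ x : Fin m → ℝ≥0, φ' x k = if k = j then γ' * x k else x k := by
              intro x
              by_cases hki : k = j
              · subst hki; simp [hφ']
              · simp [hφ', hki]
            change φ' (φ a) k = φ' (φ b) k
            rw [h5, h5, h4, h4, hk']
        · simp only [Finset.mem_filter, Finset.mem_univ, true_and, not_not, Function.update_self]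
          exact hsum
      · intro v e he
        obtain ⟨e₁, he₁, h₁⟩ := (isSubst _).exists_of_coeff_hom_ne he
        obtain ⟨e₂, he₂, h₂⟩ := (isSubst _).exists_of_coeff_hom_ne he₁
        obtain ⟨e₃, he₃, h₃⟩ := (isSubst _).exists_of_coeff_hom_ne he₂
        exact (IsToric.blowUpZero p q hpq).mem_KExpo ((IsToric.ramification j γ' hγK' hpos').mem_KExpo
          ((IsToric.ramification i γ hγK hpos).mem_KExpo (hK v e₃ he₃) h₃) h₂) h₁
    refine .of_blowUp i j hij (fun k l θ hk => .inl hk) ?_ ?_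
    · exact key i j hij hj.ne' ((add_comm _ _).trans (hsum.trans (add_comm _ _)))
    · exact key j i hij.symm hi.ne hsum

theorem after_leastExp_of_corners {V : Type*} : ∀ (c : ℕ) (μ : V → Series m n)
    (B : Finset (Fin m → ℝ≥0)), Corners μ B → B.Nonempty → B.card ≤ c →
    (∀ v e, (μ v).coeff e ≠ 0 → e ∈ C.KExpo m n) → C.After (LeastExpProp μ) := by
  intro c
  induction c with
  | zero =>
    intro μ B _ hne hc _
    exact absurd (Finset.card_pos.2 hne) (by omega)
  | succ c ih =>
    intro μ B hB hne hc hK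
    obtain ⟨a, ha⟩ := hne
    by_cases h : ∃ b ∈ B, a ≠ b
    · obtain ⟨b, hb, hab⟩ := h
      exact after_leastExp_of_pair ih _ μ B a b hB ha hb hab hc le_rfl hK
    · push Not at h
      refine .base (.inr ⟨rfl, rfl, a, fun v e he => ?_, hB.exists_eq a ha⟩)
      obtain ⟨b, hb, hbe⟩ := hB.exists_le v e he
      exact (h b hb).le.trans hbe

theorem after_leastExp {V : Type*} {μ : V → Series m n} {M : AddSubmonoid (Expo m n)}
    (hM : C.Tame M) (hμ : ∀ v, μ v ∈ suppIn M) {v : V} (hv : μ v ≠ 0) :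
    C.After (LeastExpProp μ) := by
  obtain ⟨B, hB⟩ := exists_corners μ hM.isPWO hμ
  obtain ⟨e, he⟩ : ∃ e, (μ v).coeff e ≠ 0 := by
    by_contra! h
    exact hv (HahnSeries.ext (funext h))
  obtain ⟨b, hb, -⟩ := hB.exists_le v e he
  exact after_leastExp_of_corners _ μ B hB ⟨b, hb⟩ le_rfl fun v e he => hM.le_K (hμ v he)

end GeneralisedQuasianalyticClass


section Regular

variable {m n : ℕ}

/-- The restriction of a series to the axis of the last standard variable. -/
def axisStd (m n : ℕ) : Series m (n + 1) →ₗ[ℝ] HahnSeries ℕ ℝ :=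
  reindex (fun k => zStd (0 : Expo m n) k) (fun e => e.2 (Fin.last n)) (fun _ _ h => h.2 _)
    fun k => zStd_last 0 k

theorem coeff_axisStd (f : Series m (n + 1)) (k : ℕ) :
    (axisStd m n f).coeff k = f.coeff (zStd 0 k) := rfl

theorem axisStd_mul (f g : Series m (n + 1)) :
    axisStd m n (f * g) = axisStd m n f * axisStd m n g := by
  have hi : Function.Injective fun k => zStd (0 : Expo m n) k := fun a b h => (zStd_inj h).2
  ext k
  refine coeff_mul_of_maps (α := fun k => zStd (0 : Expo m n) k) hi hi hi
    (fun a b => by rw [← zStd_add, add_zero]) (fun _ => rfl) (fun _ => rfl) ?_ k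
  intro x y k _ _ hxy
  have h := congrArg (projStd m n) hxy
  rw [map_add, projStd_zStd, add_eq_zero] at h
  refine ⟨x.2 (Fin.last n), y.2 (Fin.last n), ?_, ?_⟩
  · conv_lhs => rw [← zStd_projStd x, h.1]
  · conv_lhs => rw [← zStd_projStd y, h.2]

theorem axisStd_single_zStd (k : ℕ) (c : ℝ) :
    axisStd m n (HahnSeries.single (zStd 0 k) c) = HahnSeries.single k c := by
  ext j
  rw [coeff_axisStd]
  by_cases h : j = k
  · subst h; rw [HahnSeries.coeff_single_same, HahnSeries.coeff_single_same]
  · rw [HahnSeries.coeff_single_of_ne h, HahnSeries.coeff_single_of_ne fun h' => h (zStd_inj h').2]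

theorem axisStd_single_of_ne {e : Expo m (n + 1)} (h : ∀ k, zStd 0 k ≠ e) (c : ℝ) :
    axisStd m n (HahnSeries.single e c) = 0 := by
  ext j
  rw [coeff_axisStd, HahnSeries.coeff_single_of_ne (h j), HahnSeries.coeff_zero]

/-- The restriction to the axis as a morphism of monoids. -/
def axisStdHom (m n : ℕ) : Series m (n + 1) →* HahnSeries ℕ ℝ where
  toFun := axisStd m n
  map_one' := by
    rw [← HahnSeries.single_zero_one, ← zStd_zero_zero, axisStd_single_zStd]
    rfl
  map_mul' := axisStd_mul

theorem axisStd_linForm (c : Fin n → ℝ) (k : Fin (n + 1)) :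
    axisStd m n (linForm m (Fin.last n) (Fin.snoc (α := fun _ => ℝ) c 0) k) =
      HahnSeries.single 1 ((Fin.snoc (α := fun _ => ℝ) c 1 : Fin (n + 1) → ℝ) k) := by
  have hlast : axisStd m n (varStd m (Fin.last n)) = HahnSeries.single 1 1 := by
    rw [varStd, ← zStd_zero, axisStd_single_zStd]
  refine Fin.lastCases ?_ (fun k => ?_) k
  · rw [linForm, if_neg (lt_irrefl _), Fin.snoc_last, hlast]
  · rw [linForm, if_pos (Fin.castSucc_lt_last k), map_add, map_smul, hlast, Fin.snoc_castSucc,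
      Fin.snoc_castSucc, varStd, axisStd_single_of_ne, zero_add]
    · ext j
      rw [HahnSeries.coeff_smul]
      by_cases h : j = 1
      · subst h; simp
      · rw [HahnSeries.coeff_single_of_ne h, HahnSeries.coeff_single_of_ne h, smul_zero]
    · intro j hj
      have := congrFun (congrArg Prod.snd hj) k.castSucc
      simp [zStd] at this

theorem coeff_linear_mono_axis {A : QuasianalyticAlgebras} (c : Fin n → ℝ) (e : Expo m (n + 1))
    (k : ℕ) : ((Elem.linear (A := A) (Fin.last n) (Fin.snoc (α := fun _ => ℝ) c 0)).mono e).coeff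
      (zStd 0 k) = if e.1 = 0 ∧ ∑ i, e.2 i = k then
        ∏ i : Fin n, c i ^ e.2 i.castSucc else 0 := by
  classical
  rw [linear_mono, ← coeff_axisStd]
  change (axisStdHom m n _).coeff k = _
  rw [map_mul, map_prod]
  simp only [map_pow]
  have h1 : ∀ i, axisStdHom m n (linForm m (Fin.last n) (Fin.snoc (α := fun _ => ℝ) c 0) i) =
    HahnSeries.single 1 ((Fin.snoc (α := fun _ => ℝ) c 1 : Fin (n + 1) → ℝ) i) := axisStd_linForm c
  have h2 : ∀ s : Finset (Fin (n + 1)), ∏ i ∈ s, (HahnSeries.single (1 : ℕ)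
      ((Fin.snoc (α := fun _ => ℝ) c 1 : Fin (n + 1) → ℝ) i)) ^ e.2 i =
      HahnSeries.single (∑ i ∈ s, e.2 i)
        (∏ i ∈ s, (Fin.snoc (α := fun _ => ℝ) c 1 : Fin (n + 1) → ℝ) i ^ e.2 i) := by
    intro s
    induction s using Finset.induction_on with
    | empty => rfl
    | insert i s his ih =>
      rw [Finset.prod_insert his, Finset.sum_insert his, Finset.prod_insert his, ih,
        HahnSeries.single_pow, HahnSeries.single_mul_single, smul_eq_mul, mul_one]
  simp only [h1]
  rw [h2, Fin.prod_univ_castSucc (n := n)]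
  simp only [Fin.snoc_castSucc, Fin.snoc_last, one_pow, mul_one]
  by_cases he : e.1 = 0
  · have h3 : axisStdHom m n (HahnSeries.single (e.1, 0) 1) = 1 := by
      rw [he, Prod.mk_zero_zero]
      exact map_one _
    rw [h3, one_mul, HahnSeries.coeff_single]
    by_cases hk : ∑ i, e.2 i = k
    · rw [if_pos hk.symm, if_pos ⟨he, hk⟩]
    · rw [if_neg (Ne.symm hk), if_neg fun h => hk h.2]
  · have h3 : axisStdHom m n (HahnSeries.single (e.1, 0) 1) = 0 :=
      axisStd_single_of_ne (e := (e.1, 0)) (fun j hj => he (congrArg Prod.fst hj).symm) 1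
    rw [h3, zero_mul, HahnSeries.coeff_zero, if_neg fun h => he h.1]

theorem exists_regular_linear {C : GeneralisedQuasianalyticClass} {f : Series m (n + 1)}
    {b : Fin (n + 1) → ℕ} (hb : f.coeff (0, b) ≠ 0) : ∃ (c : Fin (n + 1) → ℝ) (k : ℕ), RegularStd k
      (GeneralisedQuasianalyticClass.elemHom (C := C) (.linear (Fin.last n) c) f) := by
  classical
  have hex : ∃ k, ∃ b : Fin (n + 1) → ℕ, ∑ i, b i = k ∧ f.coeff (0, b) ≠ 0 := ⟨_, b, rfl, hb⟩
  set k := Nat.find hex with hk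
  obtain ⟨b, hbk, hb⟩ := Nat.find_spec hex
  have hmin : ∀ j < k, ∀ b : Fin (n + 1) → ℕ, ∑ i, b i = j → f.coeff (0, b) = 0 := by
    intro j hj b hbj
    by_contra hne
    exact Nat.find_min hex hj ⟨b, hbj, hne⟩
  let S : Finset (Fin (n + 1) → ℕ) := Finset.piAntidiag Finset.univ k
  have hS : ∀ b, b ∈ S ↔ ∑ i, b i = k := fun b => by simp [S]
  let P : MvPolynomial (Fin n) ℝ := ∑ b ∈ S, MvPolynomial.monomial
    (Finsupp.equivFunOnFinite.symm fun i : Fin n => b i.castSucc) (f.coeff (0, b))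
  have hP : P ≠ 0 := by
    intro h0
    have h1 := congrArg (MvPolynomial.coeff
      (Finsupp.equivFunOnFinite.symm fun i : Fin n => b i.castSucc)) h0
    rw [MvPolynomial.coeff_sum, MvPolynomial.coeff_zero, Finset.sum_eq_single b] at h1
    · rw [MvPolynomial.coeff_monomial, if_pos rfl] at h1
      exact hb h1
    · intro b' hb' hne
      rw [MvPolynomial.coeff_monomial, if_neg]
      intro h2
      have h3 := Finsupp.equivFunOnFinite.symm.injective h2
      refine hne (funext fun i => ?_)
      have h4 : ∀ i : Fin n, b' i.castSucc = b i.castSucc := congrFun h3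
      refine Fin.lastCases ?_ h4 i
      have h5 := ((hS b').1 hb').trans hbk.symm
      rw [Fin.sum_univ_castSucc, Fin.sum_univ_castSucc, Finset.sum_congr rfl fun i _ => h4 i] at h5
      exact Nat.add_left_cancel h5
    · intro h; exact absurd ((hS b).2 hbk) h
  obtain ⟨c, hc⟩ : ∃ c, MvPolynomial.eval c P ≠ 0 := by
    by_contra! h
    exact hP (MvPolynomial.funext fun c => by rw [h c, map_zero])
  refine ⟨Fin.snoc (α := fun _ => ℝ) c 0, k, fun j hj => ?_, ?_⟩
  · rw [GeneralisedQuasianalyticClass.coeff_elemHom]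
    refine finsum_eq_zero_of_forall_eq_zero fun e => ?_
    rw [coeff_linear_mono_axis]
    split_ifs with h
    · obtain ⟨x, b⟩ := e
      obtain ⟨rfl, h⟩ := h
      rw [hmin j hj b h, zero_mul]
    · rw [mul_zero]
  · rw [GeneralisedQuasianalyticClass.coeff_elemHom]
    change (∑ᶠ e, _) ≠ 0
    rw [finsum_eq_sum_of_support_subset (s := S.image fun b => ((0 : Fin m → ℝ≥0), b))]
    · rw [Finset.sum_image fun a _ b _ h => congrArg Prod.snd h]
      rw [map_sum] at hc
      convert hc using 1
      refine Finset.sum_congr rfl fun b hb => ?_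
      rw [coeff_linear_mono_axis, if_pos ⟨rfl, (hS b).1 hb⟩, MvPolynomial.eval_monomial]
      congr 1
      rw [Finsupp.prod_fintype _ _ fun i => pow_zero _]
      rfl
    · intro e he
      rw [Function.mem_support, coeff_linear_mono_axis] at he
      have he := right_ne_zero_of_mul he
      rw [ne_eq, ite_eq_right_iff, Classical.not_imp] at he
      obtain ⟨⟨h1, h2⟩, -⟩ := he
      rw [Finset.coe_image]
      exact ⟨e.2, (hS _).2 h2, Prod.ext h1.symm rfl⟩

end Regular


section ShiftExp

variable {m n : ℕ}

/-- Division by a monomial, discarding the terms that are not divisible. -/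
def shiftExp (a : Expo m n) : Series m n →ₗ[ℝ] Series m n :=
  reindex (fun e => e + a) (fun e => e - a) (fun _ _ h => tsub_le_tsub_right h _)
    fun _ => add_tsub_cancel_right _ _

theorem coeff_shiftExp (a : Expo m n) (f : Series m n) (e : Expo m n) :
    (shiftExp a f).coeff e = f.coeff (e + a) := rfl

theorem shiftExp_single_mul (a : Expo m n) (f : Series m n) :
    shiftExp a (HahnSeries.single a 1 * f) = f := by
  ext e
  rw [coeff_shiftExp, HahnSeries.coeff_single_mul_add, one_mul]

theorem single_mul_left_injective (a : Expo m n) :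
    Function.Injective fun f : Series m n => HahnSeries.single a (1 : ℝ) * f := fun f g h => by
  rw [← shiftExp_single_mul a f, ← shiftExp_single_mul a g]
  exact congrArg (shiftExp a) h

theorem single_mul_shiftExp {a : Expo m n} {f : Series m n} (h : ∀ e, f.coeff e ≠ 0 → a ≤ e) :
    HahnSeries.single a 1 * shiftExp a f = f := by
  ext e
  by_cases he : a ≤ e
  · obtain ⟨b, rfl⟩ := exists_add_of_le he
    rw [add_comm, HahnSeries.coeff_single_mul_add, one_mul, coeff_shiftExp]
  · rw [not_not.1 fun h' => he (h e h'), mul_comm]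
    exact coeff_mul_single_of_not_le fun x hx => he (hx ▸ le_add_self)

end ShiftExp

namespace GeneralisedQuasianalyticClass

variable {C : GeneralisedQuasianalyticClass} {m n : ℕ}

theorem tame_shift {M : AddSubmonoid (Expo m n)} (hM : C.Tame M) {a : Expo m n}
    (ha : a ∈ C.KExpo m n) : ∃ N : AddSubmonoid (Expo m n), C.Tame N ∧
      ∀ f ∈ suppIn M, shiftExp a f ∈ suppIn N := by
  refine ⟨_, tame_closure (S := {e | e + a ∈ M}) ?_ ?_, fun f hf e he =>
    AddSubmonoid.subset_closure (hf he)⟩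
  · refine (hM.isPWO.image_of_monotone (f := fun e => e - a)
      fun _ _ h => tsub_le_tsub_right h _).mono fun e he => ⟨e + a, he, add_tsub_cancel_right _ _⟩
  · intro e he i
    have h := C.sub_mem_K (hM.le_K he i) (ha i)
    have h2 : (e + a).1 i - a.1 i = e.1 i := add_tsub_cancel_right (e.1 i) (a.1 i)
    rwa [h2] at h

theorem tame_projStd {M : AddSubmonoid (Expo m (n + 1))} (hM : C.Tame M) :
    C.Tame (M.map (projStd m n)) := by
  refine ⟨hM.isPWO.image_of_monotone projStd_mono, ?_⟩
  rintro _ ⟨e, he, rfl⟩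
  exact hM.le_K he

variable (C)

/-- Vectors that become combinations of finitely many of them after multiplication by a series
`d` not divisible by any generalised variable are finitely spanned after an admissible family. -/
def DenominatorProp (m n : ℕ) : Prop :=
  ∀ (W ι : Type) [Fintype ι] (F : W → ι → Series m n) (N : AddSubmonoid (Expo m n)) (r : ℕ)
    (I : Fin r → W) (d : Series m n) (c : W → Fin r → Series m n) (b : Fin n → ℕ), C.Tame N →
    d ∈ suppIn N → (∀ w i, c w i ∈ suppIn N) → d.coeff (0, b) ≠ 0 →
    (∀ w j, d * F w j = ∑ i, c w i * F (I i) j) →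
      C.After fun _ _ θ => FinSpan fun w j => θ (F w j)

variable {C}

theorem denominatorProp_zero (m : ℕ) : C.DenominatorProp m 0 := by
  intro W ι _ F N r I d c b _ _ _ hd hrel
  refine .base (FinSpan.of_isUnit (isUnit_of_coeff_zero_ne ?_) c hrel)
  rwa [Subsingleton.elim b 0] at hd

theorem FinSpanAfter.denominatorProp (ih : C.FinSpanAfter m n) : C.DenominatorProp m (n + 1) := by
  intro W ι _ F N r I d c b hN hdN hcN hd hrel
  obtain ⟨x, p, hreg⟩ := exists_regular_linear (C := C) hd
  refine .step _ (.linear (Fin.last n) x) ?_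
  rintro ν rfl
  obtain ⟨N', hN', hNN⟩ :=
    (IsToric.linear (C := C) (m := m) (Fin.last n) x).tameHom.exists_tame N hN
  have hcyl : ∀ f ∈ suppIn N, elemHom (C := C) (.linear (Fin.last n) x) f ∈
      suppIn (cyl (N'.map (projStd m n))) := fun f hf e' he' => ⟨e', hNN f hf he', rfl⟩
  refine ih.of_regular (fun w j => elemHom (C := C) (.linear (Fin.last n) x) (F w j))
    (tame_projStd hN') hreg (hcyl _ hdN) I
    (fun w i => elemHom (C := C) (.linear (Fin.last n) x) (c w i))
    (fun w i => hcyl _ (hcN w i)) fun w j => ?_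
  rw [← map_mul, hrel, map_sum]
  exact Finset.sum_congr rfl fun i _ => map_mul _ _ _

theorem DenominatorProp.finSpanAfter (h : C.DenominatorProp m n)
    (ihm : ∀ k < m, ∀ l, C.FinSpanAfter k l) : C.FinSpanAfter m n := by
  intro W ι _ F M hM hF
  obtain ⟨r, ⟨I₀, J, hI₀⟩, hvan⟩ := exists_max_minor F
  have hμ : ∀ I : Fin r → W, minor F I J ∈ suppIn M := fun I => minor_mem _ hF I J
  refine (after_leastExp (μ := fun I => minor F I J) hM hμ hI₀).bind fun k l θ hθ hP => ?_
  obtain ⟨M', hM', hθM⟩ := hθ.exists_tame M hM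
  rcases hP with hk | ⟨rfl, rfl, a, hle, I, e, he, rfl⟩
  · exact ihm k hk l W ι (fun w j => θ (F w j)) M' hM' fun w j => hθM _ (hF w j)
  let a : Expo k l := (e.1, 0)
  have hle' : ∀ I e', (θ (minor F I J)).coeff e' ≠ 0 → a ≤ e' :=
    fun I e' h => ⟨hle I e' h, zero_le⟩
  have heK : a ∈ C.KExpo k l := fun i => hM'.le_K (hθM _ (hμ I) he) i
  obtain ⟨N, hN, hMN⟩ := tame_shift hM' heK
  set d : (Fin r → W) → Series k l := fun I => shiftExp a (θ (minor F I J)) with hd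
  have hdN : ∀ I, d I ∈ suppIn N := fun I => hMN _ (hθM _ (hμ I))
  set c : W → Fin r → Series k l := fun w i => (-1) ^ (i : ℕ) *
    d fun b => (Fin.cons w I : Fin (r + 1) → W) (i.succ.succAbove b) with hc
  refine h W ι (fun w j => θ (F w j)) N r I (d I) c e.2 hN (hdN I) (fun w i =>
      mul_mem (pow_mem (neg_mem (one_mem _)) _) (hdN _)) ?_ fun w j => ?_
  · have : ((0, e.2) : Expo k l) + a = e := Prod.ext (zero_add _) (add_zero _)
    rwa [hd, coeff_shiftExp, this]
  · refine single_mul_left_injective a ?_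
    have h1 := congrArg θ (minor_mul_eq_sum hvan I J w j)
    simp only [map_mul, map_sum, map_pow, map_neg, map_one] at h1
    change HahnSeries.single a 1 * (d I * _) = HahnSeries.single a 1 * _
    rw [← mul_assoc, hd, single_mul_shiftExp (hle' I), h1, Finset.mul_sum]
    refine Finset.sum_congr rfl fun i _ => ?_
    rw [hc, hd, ← mul_assoc, mul_left_comm, single_mul_shiftExp (hle' _)]

theorem finSpanAfter (m n : ℕ) : C.FinSpanAfter m n := by
  induction m using Nat.strong_induction_on generalizing n with
  | _ m ihm =>
  induction n with
  | zero => exact (denominatorProp_zero m).finSpanAfter ihm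
  | succ n ihn => exact ihn.denominatorProp.finSpanAfter ihm

end GeneralisedQuasianalyticClass


namespace GeneralisedQuasianalyticClass

variable {C : GeneralisedQuasianalyticClass} {m n : ℕ}

section Ordered

variable {W : Type} [LinearOrder W]

/-- Each member of `F` with index in `S` is a combination of members of `F` with smaller or equal
indices in `E`. -/
def OrderedSpan {R : Type*} [CommRing R] (F : W → R) (S : Set W) (E : Finset W) : Prop :=
  ∀ w ∈ S, F w ∈ Ideal.span (F '' {e | e ∈ E ∧ e ≤ w})

variable (C)

/-- Tame families have the ordered finiteness property on `S` after an admissible family of toric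
transformations. -/
def OrderedSpanAfter (S : Set W) : Prop :=
  ∀ (m n : ℕ) (F : W → Series m n) (M : AddSubmonoid (Expo m n)), C.Tame M →
    (∀ w, F w ∈ suppIn M) → C.After fun _ _ θ => ∃ E, OrderedSpan (fun w => θ (F w)) S E

variable {C}

theorem OrderedSpanAfter.of_iio {S : Set W} (ih : ∀ w ∈ S, C.OrderedSpanAfter (Set.Iio w)) :
    C.OrderedSpanAfter S := by
  classical
  intro m n F M hM hF
  refine (finSpanAfter m n S Unit (fun w _ => F w) M hM fun w _ => hF w).bind
    fun k l θ hθ ⟨E, hE⟩ => ?_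
  have hE' : ∀ w ∈ S, θ (F w) ∈ Ideal.span ((fun w => θ (F w)) '' (Subtype.val '' (E : Set S))) := by
    intro w hw
    have h1 := Submodule.mem_map_of_mem (f := LinearMap.proj (R := Series k l)
      (φ := fun _ : Unit => Series k l) ()) (hE ⟨w, hw⟩)
    rw [Submodule.map_span, ← Set.image_comp] at h1
    rw [← Set.image_comp]
    exact h1
  obtain ⟨M', hM', hθM⟩ := hθ.exists_tame M hM
  by_cases hne : E.Nonempty
  · set e := E.max' hne with he
    refine (ih e e.2 k l (fun w => θ (F w)) M' hM' fun w => hθM _ (hF w)).mono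
      fun k' l' θ' _ ⟨E', hE₂⟩ => ⟨E' ∪ E.image Subtype.val, fun w hw => ?_⟩
    rcases lt_or_ge w e with hlt | hge
    · refine Ideal.span_mono (Set.image_mono ?_) (hE₂ w hlt)
      exact fun x hx => ⟨Finset.mem_union_left _ hx.1, hx.2⟩
    · have h1 := Ideal.mem_map_of_mem θ' (hE' w hw)
      rw [Ideal.map_span, ← Set.image_comp] at h1
      refine Ideal.span_mono (Set.image_mono ?_) h1
      rintro _ ⟨x, hx, rfl⟩
      refine ⟨Finset.mem_union_right _ (Finset.mem_image_of_mem _ hx), ?_⟩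
      exact le_trans (Subtype.coe_le_coe.2 (E.le_max' x hx)) hge
  · rw [Finset.not_nonempty_iff_eq_empty] at hne
    subst hne
    refine .base ⟨∅, fun w hw => ?_⟩
    have := hE' w hw
    simp only [Finset.coe_empty, Set.image_empty] at this
    exact Ideal.span_mono (Set.empty_subset _) this

theorem orderedSpanAfter_univ [WellFoundedLT W] : C.OrderedSpanAfter (Set.univ : Set W) := by
  have h : ∀ w : W, C.OrderedSpanAfter (Set.Iio w) := fun w =>
    WellFoundedLT.induction (motive := fun w => C.OrderedSpanAfter (Set.Iio w)) w fun w ih => .of_iio ih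
  exact .of_iio fun w _ => h w

end Ordered

/-- Morphisms that preserve the number of variables and the algebras `Ĉ`, on which they are
injective. -/
structure GoodHom {m' n' : ℕ} (θ : Series m n →ₐ[ℝ] Series m' n') : Prop where
  dim : m' + n' = m + n
  mem_hat : ∀ f ∈ C.hat m n, θ f ∈ C.hat m' n'
  eq_zero : ∀ f ∈ C.hat m n, θ f = 0 → f = 0

theorem eq_zero_of_isSubst_of_single {μ : Expo m n → Series m n} (h : IsSubst μ)
    {φ : (Fin m → ℝ≥0) → (Fin m → ℝ≥0)} (hφ : Function.Injective φ)
    (hμ : ∀ e, μ e = HahnSeries.single (φ e.1, e.2) 1) {f : Series m n} (hf : h.hom f = 0) :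
    f = 0 := by
  ext e
  rw [← coeff_isSubst_of_single h hφ hμ, hf]
  rfl

theorem eq_zero_of_elemHom_linear (i : Fin n) (c : Fin n → ℝ) {f : Series m n} (hf : f ∈ C.hat m n)
    (h0 : elemHom (C := C) (.linear i c) f = 0) : f = 0 := by
  obtain ⟨g, rfl⟩ := C.mem_hat.1 hf
  obtain ⟨h1, hT1⟩ := C.elem (.linear i c) g
  obtain ⟨h2, hT2⟩ := C.elem (.linear i (-c)) ⟨_, h1⟩
  have e1 : C.T m n ⟨_, h1⟩ = 0 := by
    refine HahnSeries.coeff_injective ?_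
    rw [hT1, ← coeff_elemHom, h0]
  have e2 : C.T m n ⟨_, h2⟩ = 0 := by
    refine HahnSeries.coeff_injective ?_
    rw [hT2, e1, ← coeff_elemHom, map_zero]
  rw [← e2]
  refine C.T_congr _ _ (Filter.Eventually.of_forall fun p => ?_)
  have h3 : p = (Elem.linear (A := C.toQuasianalyticAlgebras) i c).toMap
      ((Elem.linear (A := C.toQuasianalyticAlgebras) i (-c)).toMap p) := by
    refine Prod.ext rfl (funext fun k => ?_)
    simp only [Elem.toMap, lt_irrefl, if_false]
    split_ifs
    · simp
    · rfl
  exact congrArg g.1 h3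

theorem sum_mul_prod_eq_zero {ι : Type*} (S : Finset ι) (d a : ι → ℝ)
    (h : ∀ k : ℕ, ∑ s ∈ S, d s * ∏ t ∈ Finset.range k, (a s - t) = 0) (B : Finset ι) :
    ∀ k : ℕ, ∑ s ∈ S, d s * (∏ t ∈ Finset.range k, (a s - t)) * ∏ b ∈ B, (a s - a b) = 0 := by
  classical
  induction B using Finset.induction_on with
  | empty => simpa using h
  | insert b B hb ih =>
    intro k
    have h1 := ih (k + 1)
    have h2 := ih k
    have h3 : ∀ s, d s * (∏ t ∈ Finset.range k, (a s - t)) * ∏ b ∈ insert b B, (a s - a b) =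
        d s * (∏ t ∈ Finset.range (k + 1), (a s - t)) * ∏ b ∈ B, (a s - a b) +
        (k - a b) * (d s * (∏ t ∈ Finset.range k, (a s - t)) * ∏ b ∈ B, (a s - a b)) := by
      intro s
      rw [Finset.prod_insert hb, Finset.prod_range_succ]
      ring
    simp only [h3]
    rw [Finset.sum_add_distrib, ← Finset.mul_sum, h1, h2, mul_zero, add_zero]

theorem eq_zero_of_sum_mul_prod {ι : Type*} (S : Finset ι) (d a : ι → ℝ) (ha : Set.InjOn a S)
    (h : ∀ k : ℕ, ∑ s ∈ S, d s * ∏ t ∈ Finset.range k, (a s - t) = 0) {s : ι} (hs : s ∈ S) :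
    d s = 0 := by
  classical
  have h1 := sum_mul_prod_eq_zero S d a h (S.erase s) 0
  rw [Finset.sum_eq_single s] at h1
  · rw [Finset.prod_range_zero, mul_one] at h1
    refine (mul_eq_zero.1 h1).resolve_right (Finset.prod_ne_zero_iff.2 fun b hb => ?_)
    rw [sub_ne_zero]
    exact fun hab => Finset.ne_of_mem_erase hb (ha hs (Finset.mem_of_mem_erase hb) hab).symm
  · intro b hb hbs
    rw [Finset.prod_eq_zero (Finset.mem_erase.2 ⟨hbs, hb⟩) (sub_self _), mul_zero]
  · exact fun h => absurd hs h

theorem eq_zero_of_elemHom_blowUp (i : Fin (m + 1)) (j : Fin m) (hji : j.castSucc < i) (l : ℝ)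
    (hl : 0 < l) {f : Series (m + 1) n} (h0 : elemHom (C := C) (.blowUp i j hji l hl) f = 0) :
    f = 0 := by
  classical
  ext e₀
  by_contra hne
  set ν : C.Elem m (n + 1) (m + 1) n := .blowUp i j hji l hl with hν
  set φ : Expo (m + 1) n → Expo m (n + 1) := fun e =>
    ((fun k => e.1 (i.succAbove k)) + Pi.single j (e.1 i), Fin.cons (α := fun _ => ℕ) 0 e.2) with hφ
  have hmono : ∀ e, ν.mono e = HahnSeries.single (φ e) 1 * binomSeries m n l (e.1 i) := fun e => rfl
  have hcoeff : ∀ e k, φ e = φ e₀ → (ν.mono e).coeff (φ e₀ + embFirst m n k) =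
      (∏ i_1 ∈ Finset.range k, ((e.1 i : ℝ) - i_1)) / (Nat.factorial k : ℝ) *
        l ^ ((e.1 i : ℝ) - k) := by
    intro e k he
    rw [hmono, he, add_comm (φ e₀), HahnSeries.coeff_single_mul_add, one_mul, coeff_binomSeries]
  have hsupp : ∀ e k, (ν.mono e).coeff (φ e₀ + embFirst m n k) ≠ 0 → φ e = φ e₀ := by
    intro e k he
    rw [hmono] at he
    obtain ⟨t, ht, hte⟩ := exists_add_of_coeff_single_mul he
    obtain ⟨k', rfl⟩ := fst_eq_zero_of_coeff_binomSeries ht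
    have h2 := congrFun (congrArg Prod.snd hte) 0
    have h3 : (0 : ℕ) + (Pi.single 0 k' : Fin (n + 1) → ℕ) 0 =
      0 + (Pi.single 0 k : Fin (n + 1) → ℕ) 0 := h2
    simp only [Pi.single_eq_same, zero_add] at h3
    subst h3
    exact add_right_cancel hte
  have hemb0 : embFirst m n 0 = 0 := Prod.ext rfl (Pi.single_zero _)
  have hfin := (isSubst ν).finite f.support f.isPWO_support (φ e₀)
  set S := hfin.toFinset with hS
  have hmemS : ∀ e, e ∈ S ↔ f.coeff e ≠ 0 ∧ φ e = φ e₀ := by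
    intro e
    rw [hS, Set.Finite.mem_toFinset]
    refine and_congr Iff.rfl ⟨fun h => hsupp e 0 (by rwa [hemb0, add_zero]), fun h => ?_⟩
    have h4 := hcoeff e 0 h
    rw [hemb0, add_zero] at h4
    rw [h4]
    simpa using (Real.rpow_pos_of_pos hl _).ne'
  have hinj : Set.InjOn (fun e : Expo (m + 1) n => (e.1 i : ℝ)) S := by
    intro e he e' he' hee
    have hee : e.1 i = e'.1 i := NNReal.coe_injective hee
    have h1 := ((hmemS e).1 he).2.trans ((hmemS e').1 he').2.symm
    refine Prod.ext (succAbove_ext (i := i) hee fun k => ?_) (funext fun k => ?_)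
    · have h2 := congrFun (congrArg Prod.fst h1) k
      simp only [hφ, Pi.add_apply, hee] at h2
      exact add_right_cancel h2
    · exact congrFun (congrArg Prod.snd h1) k.succ
  have key := eq_zero_of_sum_mul_prod S (fun e => f.coeff e * l ^ (e.1 i : ℝ))
    (fun e => (e.1 i : ℝ)) hinj (fun k => ?_) ((hmemS e₀).2 ⟨hne, rfl⟩)
  · exact (mul_ne_zero hne (Real.rpow_pos_of_pos hl _).ne') key
  · have h1 := congrArg (fun g : Series m (n + 1) => g.coeff (φ e₀ + embFirst m n k)) h0
    simp only [HahnSeries.coeff_zero] at h1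
    rw [coeff_elemHom] at h1
    change (∑ᶠ e, f.coeff e * (ν.mono e).coeff (φ e₀ + embFirst m n k)) = 0 at h1
    rw [finsum_eq_sum_of_support_subset (s := S)] at h1
    · have h2 : ∀ e ∈ S, f.coeff e * (ν.mono e).coeff (φ e₀ + embFirst m n k) =
          (f.coeff e * l ^ (e.1 i : ℝ) * ∏ t ∈ Finset.range k, ((e.1 i : ℝ) - t)) *
            ((Nat.factorial k : ℝ)⁻¹ * (l ^ k)⁻¹) := by
        intro e he
        rw [hcoeff e k ((hmemS e).1 he).2, Real.rpow_sub hl, Real.rpow_natCast]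
        field_simp
      rw [Finset.sum_congr rfl h2, ← Finset.sum_mul] at h1
      refine (mul_eq_zero.1 h1).resolve_right ?_
      have := Nat.factorial_ne_zero k
      positivity
    · intro e he
      rw [Function.mem_support] at he
      exact (hmemS e).2 ⟨left_ne_zero_of_mul he, hsupp e k (right_ne_zero_of_mul he)⟩

theorem IsToric.goodHom {m' n' : ℕ} {ν : C.Elem m' n' m n} (hν : IsToric ν) :
    GoodHom (C := C) (elemHom ν) := by
  refine ⟨?_, fun f hf => C.elemHom_mem_hat ν hf, fun f hf h0 => ?_⟩
  · cases hν <;> omega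
  · cases hν with
    | ramification i γ hK hpos =>
      exact eq_zero_of_isSubst_of_single _ (update_mul_injective i hpos) (fun _ => rfl) h0
    | linear i c => exact eq_zero_of_elemHom_linear i c hf h0
    | blowUp i j hji l hl => exact eq_zero_of_elemHom_blowUp i j hji l hl h0
    | blowUpZero i j hij =>
      exact eq_zero_of_isSubst_of_single _ (update_add_injective hij) (fun _ => rfl) h0

theorem After.goodHom {Q : HomProp m n} (h : C.After Q) :
    C.After fun k l θ => GoodHom (C := C) θ ∧ Q k l θ := by
  induction h with
  | base h => exact .base ⟨⟨rfl, fun _ h => h, fun _ _ h => h⟩, h⟩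
  | step E hE h ih =>
    refine .step E hE fun ν hν => (ih ν hν).mono fun k l θ _ hθ => ⟨?_, hθ.2⟩
    have h1 := (hE.isToric ν hν).goodHom
    exact ⟨hθ.1.dim.trans h1.dim, fun f hf => hθ.1.mem_hat _ (h1.mem_hat f hf),
      fun f hf h0 => h1.eq_zero f hf (hθ.1.eq_zero _ (h1.mem_hat f hf) h0)⟩

end GeneralisedQuasianalyticClass


theorem prod_single_one {Γ ι : Type*} [AddCommMonoid Γ] [PartialOrder Γ]
    [IsOrderedCancelAddMonoid Γ] (S : Finset ι) (x : ι → Γ) :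
    ∏ i ∈ S, HahnSeries.single (x i) (1 : ℝ) = HahnSeries.single (∑ i ∈ S, x i) 1 := by
  classical
  induction S using Finset.induction_on with
  | empty => rfl
  | insert i S hi ih =>
    rw [Finset.prod_insert hi, Finset.sum_insert hi, ih, HahnSeries.single_mul_single, mul_one]

theorem single_eq_prod {m n : ℕ} (e : Expo m n) :
    HahnSeries.single e (1 : ℝ) =
      (∏ i, HahnSeries.single ((Pi.single i (e.1 i), 0) : Expo m n) 1) *
        ∏ j, HahnSeries.single ((0, Pi.single j (e.2 j)) : Expo m n) 1 := by
  rw [prod_single_one, prod_single_one, HahnSeries.single_mul_single, mul_one]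
  refine congrArg (fun e => HahnSeries.single e (1 : ℝ)) (Prod.ext ?_ ?_)
  · rw [Prod.fst_add, Prod.fst_sum, Prod.fst_sum, Finset.univ_sum_single]
    simp
  · rw [Prod.snd_add, Prod.snd_sum, Prod.snd_sum, Finset.univ_sum_single]
    simp

namespace GeneralisedQuasianalyticClass

variable (C : GeneralisedQuasianalyticClass) {m n : ℕ}

theorem T_mem_hat (f : C.germ m n) : C.T m n f ∈ C.hat m n := C.mem_hat.2 ⟨f, rfl⟩

theorem hat_le_KExpo {f : Series m n} (hf : f ∈ C.hat m n) {e : Expo m n} (he : f.coeff e ≠ 0) :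
    e ∈ C.KExpo m n := by
  obtain ⟨g, rfl⟩ := C.mem_hat.1 hf
  exact fun i => C.admissibleExponents_subset_K ⟨m, n, g, e, he, .inl ⟨i, rfl⟩⟩

theorem exists_rpow (m n : ℕ) (i : Fin m) {a : ℝ≥0} (ha : a ∈ C.K) : ∃ H : C.germ m n,
    (∀ p, H.1 p = p.1 i ^ (a : ℝ)) ∧ C.T m n H = HahnSeries.single (Pi.single i a, 0) 1 := by
  induction n with
  | zero =>
    obtain ⟨h, hT⟩ := C.rpow i a ha
    exact ⟨_, fun _ => rfl, hT⟩
  | succ n ih =>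
    obtain ⟨H, hH, hT⟩ := ih
    obtain ⟨H', hH', hT'⟩ := C.exists_pad_std H
    refine ⟨H', fun p => (hH' p).trans (hH _), hT'.trans ?_⟩
    rw [hT]
    refine ((splitStd m n).lift_single _ _).trans ?_
    exact congrArg (fun e => HahnSeries.single e (1 : ℝ)) (Prod.ext rfl snoc_zero_zero)

theorem mem_hat_of_single_mul {e : Expo m n} (he : e ∈ C.KExpo m n) {h : Series m n}
    (hh : HahnSeries.single e 1 * h ∈ C.hat m n) : h ∈ C.hat m n := by
  let D : Submonoid (Series m n) :=
    { carrier := {u | ∀ h, u * h ∈ C.hat m n → h ∈ C.hat m n}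
      one_mem' := fun h hh => by rwa [one_mul] at hh
      mul_mem' := fun {u v} hu hv h hh => hv h (hu _ (by rwa [mul_assoc] at hh)) }
  have hgen : ∀ i, HahnSeries.single ((Pi.single i (e.1 i), 0) : Expo m n) (1 : ℝ) ∈ D := by
    intro i h hh
    obtain ⟨f, hf⟩ := C.mem_hat.1 hh
    obtain ⟨g, hg⟩ := C.div_gen f i (e.1 i) (he i) h hf
    obtain ⟨H, hH, hT⟩ := C.exists_rpow m n i (he i)
    have h1 : C.T m n f = C.T m n (H * g) := C.T_congr _ _ (hg.trans
      (Filter.Eventually.of_forall fun p => by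
        change _ = H.1 p * g.1 p
        rw [hH]))
    rw [map_mul, hT, hf] at h1
    rw [single_mul_left_injective _ h1]
    exact C.T_mem_hat g
  have hstd : ∀ j, HahnSeries.single ((0, Pi.single j (e.2 j)) : Expo m n) (1 : ℝ) ∈ D := by
    intro j h hh
    obtain ⟨f, hf⟩ := C.mem_hat.1 hh
    obtain ⟨g, hg⟩ := C.div_std f j (e.2 j) h hf
    obtain ⟨hH, hT⟩ := C.T_coord_std (m := m) j
    have h1 : C.T m n f = C.T m n (⟨_, hH⟩ ^ e.2 j * g) := C.T_congr _ _ hg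
    rw [map_mul, map_pow, hT, hf] at h1
    change _ = varStd m j ^ e.2 j * _ at h1
    rw [varStd_pow] at h1
    rw [single_mul_left_injective _ h1]
    exact C.T_mem_hat g
  have hD : HahnSeries.single e (1 : ℝ) ∈ D := by
    rw [single_eq_prod]
    exact mul_mem (prod_mem fun i _ => hgen i) (prod_mem fun j _ => hstd j)
  exact hD h hh

theorem exists_hat_inv {f : Series m n} (hf : f ∈ C.hat m n) (h0 : f.coeff 0 ≠ 0) :
    ∃ g ∈ C.hat m n, f * g = 1 := by
  obtain ⟨φ, rfl⟩ := C.mem_hat.1 hf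
  rw [C.coeff_zero_T] at h0
  set c := φ.1 0 with hc
  obtain ⟨φ', hφ', -⟩ := C.exists_pad_std φ
  obtain ⟨ht, -⟩ := C.T_coord_std (m := m) (Fin.last n)
  set t : C.germ m (n + 1) := ⟨_, ht⟩ with htd
  set Φ : C.germ m (n + 1) := φ' * (t + algebraMap ℝ _ c⁻¹) - 1 with hΦ
  have hΦv : ∀ p, Φ.1 p = φ.1 (p.1, Fin.init (α := fun _ => ℝ) p.2) * (p.2 (Fin.last n) + c⁻¹) - 1 := by
    intro p
    rw [← hφ']
    rfl
  have hline : ∀ x : ℝ, Φ.1 (0, Pi.single (Fin.last n) x) = c * (x + c⁻¹) - 1 := by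
    intro x
    have h1 : (Fin.init (α := fun _ => ℝ) (Pi.single (Fin.last n) x : Fin (n + 1) → ℝ)) = 0 :=
      funext fun k => by simp [Fin.init, (Fin.castSucc_lt_last k).ne]
    rw [hΦv]
    simp only [h1, Pi.single_eq_same]
    rfl
  obtain ⟨g, -, hg⟩ := C.implicit Φ (by
    have := hline 0
    rw [Pi.single_zero, Prod.mk_zero_zero, zero_add, mul_inv_cancel₀ h0, sub_self] at this
    exact this) (by
    simp only [hline]
    have : deriv (fun x : ℝ => c * (x + c⁻¹) - 1) 0 = c := by
      simp
    rw [this]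
    exact h0)
  refine ⟨C.T m n (g + algebraMap ℝ _ c⁻¹), C.T_mem_hat _, ?_⟩
  rw [← map_mul, ← map_one (C.T m n)]
  refine C.T_congr _ _ (hg.mono fun p hp => ?_)
  rw [hΦv] at hp
  simp only [Fin.init_snoc, Fin.snoc_last] at hp
  exact sub_eq_zero.1 hp

theorem exists_hat_units {f : Series m n} (hf : f ∈ C.hat m n) (h0 : f.coeff 0 ≠ 0) :
    ∃ U : (C.hat m n)ˣ, ((U : C.hat m n) : Series m n) = f := by
  obtain ⟨g, hg, hfg⟩ := C.exists_hat_inv hf h0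
  exact ⟨⟨⟨f, hf⟩, ⟨g, hg⟩, Subtype.ext hfg, Subtype.ext ((mul_comm _ _).trans hfg)⟩, rfl⟩

/-- A distinguished variable `Z`, together with the properties of the algebras `Ĉ` relative to
its powers. -/
structure HatSplitting {Q : Type} [AddCommMonoid Q] [LinearOrder Q] [IsOrderedCancelAddMonoid Q]
    {M N : ℕ} (s : Splitting (Expo m n) Q (Expo M N)) : Prop where
  lift_mem : ∀ f ∈ C.hat m n, s.lift f ∈ C.hat M N
  slice_zero_mem : ∀ f ∈ C.hat M N, s.slice 0 f ∈ C.hat m n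
  exists_truncation : ∀ f ∈ C.hat M N, ∀ b, ∃ g ∈ C.hat M N, ∀ q,
    s.slice q g = if q < b then s.slice q f else 0
  mem_KExpo : ∀ e e' q, e' ∈ C.KExpo m n → s.equiv (e, q) ∈ C.KExpo M N →
    s.equiv (e', q) ∈ C.KExpo M N

section

variable {C} {Q : Type} [AddCommMonoid Q] [LinearOrder Q] [IsOrderedCancelAddMonoid Q] {M N : ℕ}
  {s : Splitting (Expo m n) Q (Expo M N)}

theorem le_equiv {e e' : Expo m n} {p q : Q} :
    s.equiv (e, p) ≤ s.equiv (e', q) ↔ e ≤ e' ∧ p ≤ q := s.equiv.le_iff_le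

theorem HatSplitting.slice_mem (hs : C.HatSplitting s) {f : Series M N} (hf : f ∈ C.hat M N)
    (q : Q) : s.slice q f ∈ C.hat m n := by
  by_cases h0 : s.slice q f = 0
  · rw [h0]; exact zero_mem _
  obtain ⟨e, he⟩ : ∃ e, (s.slice q f).coeff e ≠ 0 := by
    by_contra! h
    exact h0 (HahnSeries.ext (funext h))
  have hK : s.equiv (0, q) ∈ C.KExpo M N :=
    hs.mem_KExpo e 0 q (zero_mem _) (C.hat_le_KExpo hf he)
  obtain ⟨g, hg, hgs⟩ := hs.exists_truncation f hf q
  have hle : ∀ x, (f - g).coeff x ≠ 0 → s.equiv (0, q) ≤ x := by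
    intro x hx
    obtain ⟨⟨e, p⟩, rfl⟩ := s.equiv.surjective x
    refine le_equiv.2 ⟨zero_le, not_lt.1 fun hp => hx ?_⟩
    rw [← s.coeff_slice, map_sub, hgs, if_pos hp, sub_self]
    rfl
  have hR := hs.slice_zero_mem _ (C.mem_hat_of_single_mul hK (h := shiftExp (s.equiv (0, q)) (f - g))
    (by rw [single_mul_shiftExp hle]; exact sub_mem hf hg))
  convert hR using 1
  ext e
  rw [s.coeff_slice 0, coeff_shiftExp, ← s.map_add, Prod.mk_add_mk, add_zero, zero_add,
    ← s.coeff_slice q (f - g), map_sub, hgs, if_neg (lt_irrefl q), sub_zero]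

end

theorem insertNth_last_eq_snoc {α : Type*} {n : ℕ} (x : α) (p : Fin n → α) :
    (Fin.last n).insertNth (α := fun _ => α) x p = Fin.snoc (α := fun _ => α) p x :=
  Fin.insertNth_last' x p

theorem sliceStd_zero_mem {f : Series m (n + 1)} (hf : f ∈ C.hat m (n + 1)) :
    (splitStd m n).slice 0 f ∈ C.hat m n := by
  obtain ⟨g, rfl⟩ := C.mem_hat.1 hf
  obtain ⟨h, hT⟩ := C.zero_std (Fin.last n) g
  refine C.mem_hat.2 ⟨⟨_, h⟩, HahnSeries.ext (funext fun e => (hT e).trans ?_)⟩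
  rw [insertNth_last_eq_snoc]
  rfl

theorem liftStd_mem {f : Series m n} (hf : f ∈ C.hat m n) :
    (splitStd m n).lift f ∈ C.hat m (n + 1) := by
  obtain ⟨g, rfl⟩ := C.mem_hat.1 hf
  obtain ⟨H, -, hT⟩ := C.exists_pad_std g
  exact C.mem_hat.2 ⟨H, hT⟩

theorem exists_truncation_std {f : Series m (n + 1)} (hf : f ∈ C.hat m (n + 1)) (b : ℕ) :
    ∃ g ∈ C.hat m (n + 1), ∀ q, (splitStd m n).slice q g =
      if q < b then (splitStd m n).slice q f else 0 := by
  induction b with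
  | zero => exact ⟨0, zero_mem _, fun q => by simp⟩
  | succ b ih =>
    obtain ⟨g, hg, hgs⟩ := ih
    have hle : ∀ x, (f - g).coeff x ≠ 0 → zStd 0 b ≤ x := by
      intro x hx
      obtain ⟨⟨e, p⟩, rfl⟩ := (splitStd m n).equiv.surjective x
      refine zStd_mono zero_le (not_lt.1 fun hp => hx ?_)
      rw [← (splitStd m n).coeff_slice, map_sub, hgs, if_pos hp, sub_self]
      rfl
    have hR := C.sliceStd_zero_mem (C.mem_hat_of_single_mul (e := zStd 0 b) (zero_mem (C.KExpo m n))
      (h := shiftExp (zStd 0 b) (f - g)) (by rw [single_mul_shiftExp hle]; exact sub_mem hf hg))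
    set u := (splitStd m n).slice 0 (shiftExp (zStd 0 b) (f - g)) with hu
    have hu' : u = (splitStd m n).slice b f := by
      ext e
      rw [hu, Splitting.coeff_slice, coeff_shiftExp, splitStd_equiv, ← zStd_add, add_zero, zero_add,
        ← splitStd_equiv, ← Splitting.coeff_slice, map_sub, hgs, if_neg (lt_irrefl b), sub_zero]
    obtain ⟨hz, hT⟩ := C.T_coord_std (m := m) (Fin.last n)
    have hZ : HahnSeries.single (zStd (0 : Expo m n) b) (1 : ℝ) ∈ C.hat m (n + 1) := by
      rw [zStd_zero, ← varStd_pow]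
      exact pow_mem (C.mem_hat.2 ⟨_, hT⟩) b
    refine ⟨g + (splitStd m n).lift u * HahnSeries.single (zStd 0 b) 1,
      add_mem hg (mul_mem (C.liftStd_mem hR) hZ), fun q => ?_⟩
    ext e
    rw [map_add, hgs, HahnSeries.coeff_add, Splitting.coeff_slice, ← splitStd_equiv,
      Splitting.coeff_lift_mul_single, hu']
    rcases lt_trichotomy q b with h | h | h
    · rw [if_pos h, if_neg h.ne, if_pos (by omega), add_zero]
    · subst h
      rw [if_neg (lt_irrefl q), if_pos rfl, if_pos (Nat.lt_succ_self q), HahnSeries.coeff_zero, zero_add]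
    · rw [if_neg h.not_gt, if_neg h.ne', if_neg (by omega), add_zero]

theorem hatSplitting_std (m n : ℕ) : C.HatSplitting (splitStd m n) where
  lift_mem _ hf := C.liftStd_mem hf
  slice_zero_mem _ hf := C.sliceStd_zero_mem hf
  exists_truncation _ hf b := C.exists_truncation_std hf b
  mem_KExpo _ _ _ he' _ := he'

theorem hatSplitting_gen (m n : ℕ) : C.HatSplitting (splitGen m n) where
  lift_mem f hf := by
    obtain ⟨g, rfl⟩ := C.mem_hat.1 hf
    obtain ⟨H, -, hT⟩ := C.exists_pad_gen g
    exact C.mem_hat.2 ⟨H, hT⟩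
  slice_zero_mem f hf := by
    obtain ⟨g, rfl⟩ := C.mem_hat.1 hf
    obtain ⟨h, hT⟩ := C.zero_gen (Fin.last m) g
    refine C.mem_hat.2 ⟨⟨_, h⟩, HahnSeries.ext (funext fun e => (hT e).trans ?_)⟩
    rw [insertNth_last_eq_snoc]
    rfl
  exists_truncation f hf b := by
    obtain ⟨g, rfl⟩ := C.mem_hat.1 hf
    obtain ⟨h, hT⟩ := C.truncation g b
    refine ⟨_, C.T_mem_hat h, fun q => ?_⟩
    ext e
    rw [Splitting.coeff_slice, hT]
    have : ((splitGen m n).equiv (e, q)).1 (Fin.last m) = q :=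
      Fin.snoc_last (α := fun _ => ℝ≥0) _ _
    rw [this]
    split_ifs <;> rfl
  mem_KExpo e e' q he' h i := by
    refine Fin.lastCases ?_ (fun i => ?_) i
    · have h1 := h (Fin.last m)
      simp only [splitGen_equiv, zGen, Fin.snoc_last] at h1 ⊢
      exact h1
    · simp only [splitGen_equiv, zGen, Fin.snoc_castSucc]
      exact he' i

end GeneralisedQuasianalyticClass


namespace GeneralisedQuasianalyticClass

variable {C : GeneralisedQuasianalyticClass} {m n : ℕ}

theorem coeff_zero_unit_ne (U : (C.hat m n)ˣ) : ((U : C.hat m n) : Series m n).coeff 0 ≠ 0 := by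
  obtain ⟨f, hf⟩ := C.mem_hat.1 (U : C.hat m n).2
  obtain ⟨g, hg⟩ := C.mem_hat.1 ((U⁻¹ : (C.hat m n)ˣ) : C.hat m n).2
  have h1 : C.T m n (f * g) = 1 := by
    rw [map_mul, hf, hg]
    exact congrArg Subtype.val U.mul_inv
  have h2 := C.coeff_zero_T (f * g)
  rw [h1, HahnSeries.coeff_one, if_pos rfl] at h2
  have h3 : (1 : ℝ) = f.1 0 * g.1 0 := h2
  rw [← hf, C.coeff_zero_T]
  exact left_ne_zero_of_mul (h3 ▸ one_ne_zero)

theorem coeff_single_mul_unit_ne (e : Expo m n) (U : (C.hat m n)ˣ) :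
    (HahnSeries.single e 1 * ((U : C.hat m n) : Series m n)).coeff e ≠ 0 := by
  have h := HahnSeries.coeff_single_mul_add (r := (1 : ℝ)) (x := ((U : C.hat m n) : Series m n))
    (a := 0) (b := e)
  rw [zero_add, one_mul] at h
  rw [h]
  exact coeff_zero_unit_ne U

theorem normal_ne_zero {F : Series m n} (h : C.IsNormal F) : F ≠ 0 := by
  obtain ⟨-, e, U, rfl⟩ := h
  intro h0
  apply coeff_single_mul_unit_ne e U
  rw [h0]
  rfl

theorem val_mul_inv (U : (C.hat m n)ˣ) : ((U : C.hat m n) : Series m n) *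
    (((U⁻¹ : (C.hat m n)ˣ) : C.hat m n) : Series m n) = 1 := congrArg Subtype.val U.mul_inv

theorem exists_normal_quotient {F G : Series m n} (hF : C.IsNormal F) (hG : C.IsNormal G)
    (h : F ∣ G) : ∃ H, C.IsNormal H ∧ G = F * H := by
  obtain ⟨k, hk⟩ := h
  obtain ⟨hFm, a, u, rfl⟩ := hF
  obtain ⟨hGm, b, v, rfl⟩ := hG
  have haK : a ∈ C.KExpo m n := C.hat_le_KExpo hFm (coeff_single_mul_unit_ne a u)
  have hab : a ≤ b := by
    have h1 := coeff_single_mul_unit_ne b v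
    rw [hk, mul_assoc] at h1
    obtain ⟨t, -, rfl⟩ := exists_add_of_coeff_single_mul h1
    exact le_self_add
  obtain ⟨c, rfl⟩ := exists_add_of_le hab
  have h1 : HahnSeries.single (a + c) (1 : ℝ) = HahnSeries.single a 1 * HahnSeries.single c 1 := by
    rw [HahnSeries.single_mul_single, mul_one]
  refine ⟨HahnSeries.single c 1 * (((v * u⁻¹ : (C.hat m n)ˣ) : C.hat m n) : Series m n),
    ⟨C.mem_hat_of_single_mul haK ?_, c, _, rfl⟩, ?_⟩
  · have h2 := mul_mem hGm ((u⁻¹ : (C.hat m n)ˣ) : C.hat m n).2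
    convert h2 using 1
    rw [h1, Units.val_mul, MulMemClass.coe_mul]
    ring
  · rw [h1, Units.val_mul, MulMemClass.coe_mul]
    linear_combination -HahnSeries.single a 1 * HahnSeries.single c 1 *
      ((v : C.hat m n) : Series m n) * val_mul_inv u

variable {Q : Type} [AddCommMonoid Q] [LinearOrder Q] [IsOrderedCancelAddMonoid Q] {M N : ℕ}
  {s : Splitting (Expo m n) Q (Expo M N)}

theorem HatSplitting.exists_block (hs : C.HatSplitting s) {D : Series M N} (hD : D ∈ C.hat M N)
    {b : Q} (hb : C.IsNormal (s.slice b D)) (hlt : ∀ q < b, s.slice q D = 0)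
    (hdvd : ∀ q, s.slice b D ∣ s.slice q D) : ∃ V : (C.hat M N)ˣ,
      D = s.lift (s.slice b D) * HahnSeries.single (s.equiv (0, b)) 1 *
        ((V : C.hat M N) : Series M N) := by
  obtain ⟨-, a, u, hau⟩ := hb
  set u₁ : Series m n := ((u : C.hat m n) : Series m n) with hu₁
  set u₂ : Series m n := (((u⁻¹ : (C.hat m n)ˣ) : C.hat m n) : Series m n) with hu₂
  have huu : u₁ * u₂ = 1 := val_mul_inv u
  have hD' : s.lift u₂ * D ∈ C.hat M N :=
    mul_mem (hs.lift_mem _ ((u⁻¹ : (C.hat m n)ˣ) : C.hat m n).2) hD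
  have hcoeff : (s.lift u₂ * D).coeff (s.equiv (a, b)) = 1 := by
    rw [← s.coeff_slice, s.slice_lift_mul, hau, mul_left_comm, mul_comm u₂, huu, mul_one,
      HahnSeries.coeff_single_same]
  have hle : ∀ x, (s.lift u₂ * D).coeff x ≠ 0 → s.equiv (a, b) ≤ x := by
    intro x hx
    obtain ⟨⟨e, q⟩, rfl⟩ := s.equiv.surjective x
    rw [← s.coeff_slice, s.slice_lift_mul] at hx
    refine le_equiv.2 ⟨?_, not_lt.1 fun hq => hx ?_⟩
    · obtain ⟨k, hk⟩ := hdvd q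
      have h1 : u₂ * s.slice q D = HahnSeries.single a 1 * k := by
        rw [hk, hau]
        linear_combination HahnSeries.single a 1 * k * huu
      rw [h1] at hx
      obtain ⟨t, -, rfl⟩ := exists_add_of_coeff_single_mul hx
      exact le_self_add
    · rw [hlt q hq, mul_zero]
      rfl
  have hmul := single_mul_shiftExp hle
  set V := shiftExp (s.equiv (a, b)) (s.lift u₂ * D) with hV
  have hVmem : V ∈ C.hat M N := by
    refine C.mem_hat_of_single_mul (C.hat_le_KExpo hD' (e := s.equiv (a, b)) ?_) (by rwa [hmul])
    rw [hcoeff]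
    exact one_ne_zero
  obtain ⟨V', hV'⟩ := C.exists_hat_units hVmem (by
    rw [hV, coeff_shiftExp, zero_add, hcoeff]
    exact one_ne_zero)
  refine ⟨V', ?_⟩
  rw [hV', hau, map_mul]
  have h1 := s.single_equiv a b 1
  rw [h1] at hmul
  have h2 : s.lift u₁ * s.lift u₂ = 1 := by rw [← map_mul, huu, map_one]
  linear_combination -D * h2 - s.lift u₁ * hmul

theorem HatSplitting.exists_decomposition (hs : C.HatSplitting s) (g : Q → Series m n)
    (E : Finset Q) : ∀ G ∈ C.hat M N,
    (∀ q, s.slice q G ∈ Ideal.span (g '' {e | e ∈ E ∧ e ≤ q})) → (∀ e ∈ E, s.slice e G = g e) →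
    (∀ e ∈ E, C.IsNormal (g e)) → (∀ e ∈ E, ∀ e' ∈ E, g e ∣ g e' ∨ g e' ∣ g e) →
    ∃ E' ⊆ E, ∃ V : Q → (C.hat M N)ˣ,
      G = ∑ e ∈ E', s.lift (g e) * HahnSeries.single (s.equiv (0, e)) 1 *
        ((V e : C.hat M N) : Series M N) ∧
      ∀ b ∈ E', (∀ e ∈ E', e ≤ b) → ∀ e ∈ E', g b ∣ g e := by
  classical
  induction E using Finset.induction_on_max with
  | empty =>
    intro G _ hspan _ _ _
    refine ⟨∅, le_rfl, fun _ => 1, ?_, fun b hb => absurd hb (Finset.notMem_empty b)⟩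
    refine s.ext_slice fun q => ?_
    have := hspan q
    simp only [Finset.notMem_empty, false_and, Set.ofPred_false, Set.image_empty, Ideal.span_empty,
      Ideal.mem_bot] at this
    rw [this, Finset.sum_empty, map_zero]
  | insert b E hlt ih =>
    intro G hG hspan hslice hnormal hchain
    have hE : E ⊆ insert b E := Finset.subset_insert b E
    have hbE : b ∈ insert b E := Finset.mem_insert_self b E
    by_cases hb : ∃ e ∈ E, g e ∣ g b
    · obtain ⟨e, he, heb⟩ := hb
      have hspan' : ∀ q, s.slice q G ∈ Ideal.span (g '' {e | e ∈ E ∧ e ≤ q}) := by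
        refine fun q => Ideal.span_le.2 ?_ (hspan q)
        rintro _ ⟨x, ⟨hx, hxq⟩, rfl⟩
        rcases Finset.mem_insert.1 hx with rfl | hx
        · exact Ideal.mem_of_dvd _ heb (Ideal.subset_span ⟨e, ⟨he, (hlt e he).le.trans hxq⟩, rfl⟩)
        · exact Ideal.subset_span ⟨x, ⟨hx, hxq⟩, rfl⟩
      obtain ⟨E', hE', h⟩ := ih G hG hspan' (fun e he => hslice e (hE he))
        (fun e he => hnormal e (hE he)) fun e he e' he' => hchain e (hE he) e' (hE he')
      exact ⟨E', hE'.trans hE, h⟩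
    · push Not at hb
      have hdvd : ∀ e ∈ insert b E, g b ∣ g e := by
        intro e he
        rcases Finset.mem_insert.1 he with rfl | he
        · exact dvd_rfl
        · exact (hchain b hbE e (hE he)).resolve_right (hb e he)
      obtain ⟨G₀, hG₀, hs₀⟩ := hs.exists_truncation G hG b
      have hspan₀ : ∀ q, s.slice q G₀ ∈ Ideal.span (g '' {e | e ∈ E ∧ e ≤ q}) := by
        intro q
        rw [hs₀]
        split_ifs with hq
        · refine Ideal.span_mono (Set.image_mono ?_) (hspan q)
          rintro x ⟨hx, hxq⟩
          exact ⟨(Finset.mem_insert.1 hx).resolve_left (hxq.trans_lt hq).ne, hxq⟩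
        · exact zero_mem _
      obtain ⟨E', hE', V, hV, -⟩ := ih G₀ hG₀ hspan₀
        (fun e he => by rw [hs₀, if_pos (hlt e he), hslice e (hE he)])
        (fun e he => hnormal e (hE he)) fun e he e' he' => hchain e (hE he) e' (hE he')
      have hD : ∀ q, s.slice q (G - G₀) = if q < b then 0 else s.slice q G := by
        intro q
        rw [map_sub, hs₀]
        split_ifs <;> simp
      have hDb : s.slice b (G - G₀) = g b := by
        rw [hD, if_neg (lt_irrefl b), hslice b hbE]
      obtain ⟨U, hU⟩ := hs.exists_block (sub_mem hG hG₀) (b := b) (hDb ▸ hnormal b hbE)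
        (fun q hq => by rw [hD, if_pos hq]) fun q => by
          rw [hDb, hD]
          split_ifs
          · exact dvd_zero _
          · refine Ideal.mem_span_singleton.1 (Ideal.span_le.2 ?_ (hspan q))
            rintro _ ⟨x, hx, rfl⟩
            exact Ideal.mem_span_singleton.2 (hdvd x hx.1)
      have hbE' : b ∉ E' := fun h => (hlt b (hE' h)).false
      refine ⟨insert b E', Finset.insert_subset_insert b hE', Function.update V b U, ?_, ?_⟩
      · rw [Finset.sum_insert hbE', Function.update_self, ← hDb, ← hU]
        rw [Finset.sum_congr rfl fun e he => by
          rw [Function.update_of_ne (ne_of_mem_of_not_mem he hbE')], ← hV, sub_add_cancel]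
      · intro b' hb' hmax e he
        rcases Finset.mem_insert.1 hb' with rfl | hb'
        · exact hdvd e (Finset.insert_subset_insert _ hE' he)
        · exact absurd (hlt b' (hE' hb')) (hmax b (Finset.mem_insert_self _ _)).not_gt

variable (C) in
/-- Finite presentations with respect to a distinguished variable. -/
def HasPresentation (s : Splitting (Expo m n) Q (Expo M N)) (d : ℕ) (F : Series M N) : Prop :=
  F ∈ C.hat M N ∧
  ∃ (α : Fin (d + 1) → Q) (H : Fin (d + 1) → Series m n) (U : Fin (d + 1) → (C.hat M N)ˣ),
    StrictAnti α ∧ (∀ i, s.equiv (0, α i) ∈ C.KExpo M N) ∧ (∀ i, C.IsNormal (H i)) ∧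
    F = s.lift (H 0) *
      (HahnSeries.single (s.equiv (0, α 0)) 1 * ((U 0 : C.hat M N) : Series M N) +
        ∑ i : Fin d, s.lift (H i.succ) * HahnSeries.single (s.equiv (0, α i.succ)) 1 *
          ((U i.succ : C.hat M N) : Series M N))

theorem HatSplitting.hasPresentation (hs : C.HatSplitting s) {G : Series M N} (hG : G ∈ C.hat M N)
    (hG0 : G ≠ 0) {E : Finset Q}
    (hspan : ∀ q, s.slice q G ∈ Ideal.span ((fun e => s.slice e G) '' {e | e ∈ E ∧ e ≤ q}))
    (hnormal : ∀ e ∈ E, C.IsNormal (s.slice e G))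
    (hchain : ∀ e ∈ E, ∀ e' ∈ E, s.slice e G ∣ s.slice e' G ∨ s.slice e' G ∣ s.slice e G) :
    ∃ d, C.HasPresentation s d G := by
  obtain ⟨E', hE', V, hV, hmax⟩ := hs.exists_decomposition (fun e => s.slice e G) E G hG hspan
    (fun _ _ => rfl) hnormal hchain
  have hne : E'.card ≠ 0 := by
    intro h0
    rw [Finset.card_eq_zero] at h0
    rw [h0, Finset.sum_empty] at hV
    exact hG0 hV
  obtain ⟨d, hd⟩ := Nat.exists_eq_succ_of_ne_zero hne
  let α : Fin (d + 1) → Q := fun i => E'.orderEmbOfFin hd i.rev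
  have hα : StrictAnti α := fun i j hij => (E'.orderEmbOfFin hd).strictMono (Fin.rev_lt_rev.2 hij)
  have hαE : ∀ i, α i ∈ E' := fun i => E'.orderEmbOfFin_mem hd _
  have hdvd : ∀ i : Fin (d + 1), s.slice (α 0) G ∣ s.slice (α i) G := by
    refine fun i => hmax (α 0) (hαE 0) (fun e he => ?_) _ (hαE i)
    have : e ∈ Set.range (E'.orderEmbOfFin hd) := by rw [Finset.range_orderEmbOfFin]; exact he
    obtain ⟨j, rfl⟩ := this
    rw [← Fin.rev_rev j]
    exact hα.antitone (Fin.zero_le _)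
  choose H hHn hH using fun i : Fin (d + 1) =>
    exists_normal_quotient (hnormal _ (hE' (hαE 0))) (hnormal _ (hE' (hαE i))) (hdvd i)
  refine ⟨d, hG, α, Fin.cons (s.slice (α 0) G) fun i => H i.succ, fun i => V (α i), hα, fun i => ?_,
    fun i => ?_, ?_⟩
  · have h1 := normal_ne_zero (hnormal _ (hE' (hαE i)))
    obtain ⟨e, he⟩ : ∃ e, (s.slice (α i) G).coeff e ≠ 0 := by
      by_contra! h
      exact h1 (HahnSeries.ext (funext h))
    exact hs.mem_KExpo e 0 _ (zero_mem _) (C.hat_le_KExpo hG he)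
  · refine Fin.cases ?_ (fun i => ?_) i
    · exact hnormal _ (hE' (hαE 0))
    · exact hHn i.succ
  · conv_lhs => rw [hV]
    have hsum : ∀ f : Q → Series M N, ∑ e ∈ E', f e = ∑ i, f (α i) := by
      intro f
      rw [← Equiv.sum_comp Fin.revPerm]
      simp only [α, Fin.revPerm_apply, Fin.rev_rev]
      rw [← Finset.sum_coe_sort E', ← Equiv.sum_comp (E'.orderIsoOfFin hd).toEquiv]
      rfl
    rw [hsum, Fin.sum_univ_succ, mul_add, Finset.mul_sum]
    simp only [Fin.cons_zero, Fin.cons_succ]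
    congr 1
    · ring
    · refine Finset.sum_congr rfl fun i _ => ?_
      rw [hH i.succ, map_mul]
      ring

end GeneralisedQuasianalyticClass


namespace GeneralisedQuasianalyticClass

variable {C : GeneralisedQuasianalyticClass}

/-- Composition of admissible transformations. -/
def append {m' n' m n : ℕ} : C.Adm m' n' m n → ∀ {m'' n'' : ℕ}, C.Adm m'' n'' m' n' →
    C.Adm m'' n'' m n
  | .refl _ _, _, _, σ => σ
  | .comp ν ρ, _, _, σ => .comp ν (append ρ σ)

theorem admHom_append {m'' n'' m' n' m n : ℕ} (ρ : C.Adm m' n' m n) (σ : C.Adm m'' n'' m' n')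
    (f : Series m n) : admHom (append ρ σ) f = admHom σ (admHom ρ f) := by
  induction ρ with
  | refl => rfl
  | comp ν ρ ih => exact ih (elemHom ν f)

theorem exists_isAdmissibleFamily_append {m n : ℕ} {𝓕 : Set (C.AdmTo m n)}
    (h𝓕 : C.IsAdmissibleFamily 𝓕) : ∀ {P : C.AdmTo m n → Prop},
    (∀ ρ ∈ 𝓕, ∃ 𝓖 : Set (C.AdmTo ρ.m' ρ.n'), C.IsAdmissibleFamily 𝓖 ∧
      ∀ σ ∈ 𝓖, P ⟨append ρ.map σ.map⟩) →
    ∃ 𝓗 : Set (C.AdmTo m n), C.IsAdmissibleFamily 𝓗 ∧ ∀ ρ ∈ 𝓗, P ρ := by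
  classical
  induction h𝓕 with
  | refl m n =>
    intro P h
    exact h _ rfl
  | step E hE 𝓕 _ ih =>
    intro P h
    have h1 := fun (ν : C.ElemTo _ _) (hν : ν ∈ E) =>
      ih ν hν (P := fun ρ => P ⟨.comp ν.map ρ.map⟩) fun ρ hρ => h _ ⟨ν, hν, ρ, hρ, rfl⟩
    choose! 𝓗 h𝓗 hP using h1
    refine ⟨_, .step E hE 𝓗 h𝓗, ?_⟩
    rintro _ ⟨ν, hν, ρ, hρ, rfl⟩
    exact hP ν hν ρ hρ

theorem isWF_slice_ne_zero {m n M N : ℕ} {Q : Type} [AddCommMonoid Q] [LinearOrder Q]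
    [IsOrderedCancelAddMonoid Q] (s : Splitting (Expo m n) Q (Expo M N)) (F : Series M N) :
    {q | s.slice q F ≠ 0}.IsWF := by
  refine ((F.isPWO_support.image_of_monotone (f := fun x => (s.equiv.symm x).2)
    fun _ _ h => (s.equiv.symm.monotone h).2).mono fun q hq => ?_).isWF
  obtain ⟨e, he⟩ : ∃ e, (s.slice q F).coeff e ≠ 0 := by
    by_contra! h
    exact hq (HahnSeries.ext (funext h))
  exact ⟨s.equiv (e, q), he, by simp⟩

theorem exists_tame_slices {m n M N : ℕ} {Q : Type} [AddCommMonoid Q] [LinearOrder Q]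
    [IsOrderedCancelAddMonoid Q] {s : Splitting (Expo m n) Q (Expo M N)} (hs : C.HatSplitting s)
    {F : Series M N} (hF : F ∈ C.hat M N) : ∃ L : AddSubmonoid (Expo m n), C.Tame L ∧
      ∀ q, s.slice q F ∈ suppIn L := by
  refine ⟨_, tame_closure (S := {e | ∃ q, (s.slice q F).coeff e ≠ 0}) ?_ ?_,
    fun q e he => AddSubmonoid.subset_closure ⟨q, he⟩⟩
  · refine (F.isPWO_support.image_of_monotone (f := fun x => (s.equiv.symm x).1)
      fun _ _ h => (s.equiv.symm.monotone h).1).mono ?_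
    rintro e ⟨q, he⟩
    exact ⟨s.equiv (e, q), he, by simp⟩
  · rintro e ⟨q, he⟩
    exact C.hat_le_KExpo (hs.slice_mem hF q) he

theorem exists_family_hasPresentation {m n : ℕ} (hIH : C.InductiveHypothesis (m + n)) {Q : Type}
    [AddCommMonoid Q] [LinearOrder Q] [IsOrderedCancelAddMonoid Q] {p r : ℕ → ℕ}
    (s : ∀ m n, Splitting (Expo m n) Q (Expo (p m) (r n))) (hs : ∀ m n, C.HatSplitting (s m n))
    (hext : ∀ {m' n' m n : ℕ} (ρ : C.Adm m' n' m n), ∀ F ∈ C.hat (p m) (r n),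
      ∃ G ∈ C.hat (p m') (r n'), ∀ q, (s m' n').slice q G = admHom ρ ((s m n).slice q F))
    {F : Series (p m) (r n)} (hF : F ∈ C.hat (p m) (r n)) (hF0 : F ≠ 0) :
    ∃ 𝓕 : Set (C.AdmTo m n), C.IsAdmissibleFamily 𝓕 ∧ ∀ ρ ∈ 𝓕, ∃ G : Series (p ρ.m') (r ρ.n'),
      (∀ q, (s ρ.m' ρ.n').slice q G = admHom ρ.map ((s m n).slice q F)) ∧
      ∃ d, C.HasPresentation (s ρ.m' ρ.n') d G := by
  classical
  let W : Type := {q | (s m n).slice q F ≠ 0}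
  have : WellFoundedLT W := ⟨isWF_slice_ne_zero (s m n) F⟩
  obtain ⟨L, hL, hFL⟩ := exists_tame_slices (hs m n) hF
  obtain ⟨𝓕, h𝓕, hρ⟩ := (orderedSpanAfter_univ (W := W) m n (fun w => (s m n).slice w.1 F) L hL
    fun w => hFL _).goodHom.exists_family
  refine exists_isAdmissibleFamily_append h𝓕 fun ρ hρ𝓕 => ?_
  obtain ⟨hgood, E, hE⟩ := hρ ρ hρ𝓕
  let e : Fin E.card ≃ E := E.equivFin.symm
  obtain ⟨𝓖, h𝓖, hσ⟩ := hIH ρ.m' ρ.n' hgood.dim E.card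
    (fun i => admHom ρ.map ((s m n).slice (e i).1.1 F))
    (fun i => hgood.mem_hat _ ((hs m n).slice_mem hF _))
    fun i h0 => (e i).1.2 (hgood.eq_zero _ ((hs m n).slice_mem hF _) h0)
  refine ⟨𝓖, h𝓖, fun σ hσ𝓖 => ?_⟩
  obtain ⟨G', hG', hnormal, hchain⟩ := hσ σ hσ𝓖
  obtain ⟨G, hG, hGs⟩ := hext (append ρ.map σ.map) F hF
  refine ⟨G, hGs, ?_⟩
  have hslice : ∀ i, (s σ.m' σ.n').slice (e i).1.1 G = G' i := by
    intro i
    rw [hGs, admHom_append]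
    refine HahnSeries.coeff_injective ?_
    rw [coeff_admHom, hG' i]
  have hmem : ∀ q ∈ E.image Subtype.val, ∃ i, (s σ.m' σ.n').slice q G = G' i := by
    intro q hq
    obtain ⟨w, hw, rfl⟩ := Finset.mem_image.1 hq
    refine ⟨e.symm ⟨w, hw⟩, ?_⟩
    rw [← hslice, Equiv.apply_symm_apply]
  refine (hs σ.m' σ.n').hasPresentation hG ?_ (E := E.image Subtype.val) (fun q => ?_) (fun q hq => ?_)
    fun q hq q' hq' => ?_
  · intro h0
    obtain ⟨w⟩ : Nonempty W := by
      by_contra hW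
      rw [not_nonempty_iff] at hW
      refine hF0 ((s m n).ext_slice fun q => ?_)
      rw [map_zero]
      by_contra hq
      exact hW.elim ⟨q, hq⟩
    have hEne : E.Nonempty := by
      by_contra hne
      rw [Finset.not_nonempty_iff_eq_empty] at hne
      have h1 := hE w trivial
      simp only [hne, Finset.notMem_empty, false_and, Set.ofPred_false, Set.image_empty,
        Ideal.span_empty, Ideal.mem_bot] at h1
      exact w.2 (hgood.eq_zero _ ((hs m n).slice_mem hF _) h1)
    obtain ⟨w, hw⟩ := hEne
    obtain ⟨i, hi⟩ := hmem w.1 (Finset.mem_image_of_mem _ hw)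
    rw [h0, map_zero] at hi
    exact normal_ne_zero (hnormal i) hi.symm
  · by_cases hq : (s m n).slice q F = 0
    · rw [hGs, hq, map_zero]
      exact zero_mem _
    · have h1 := Ideal.mem_map_of_mem (admHom σ.map) (hE ⟨q, hq⟩ trivial)
      rw [Ideal.map_span, ← Set.image_comp] at h1
      rw [hGs, admHom_append]
      refine Ideal.span_mono ?_ h1
      rintro _ ⟨w, ⟨hw, hwq⟩, rfl⟩
      refine ⟨w.1, ⟨Finset.mem_image_of_mem _ hw, hwq⟩, ?_⟩
      change (s σ.m' σ.n').slice w.1 G = _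
      rw [hGs, admHom_append]
      rfl
  · obtain ⟨i, hi⟩ := hmem q hq
    rw [hi]
    exact hnormal i
  · obtain ⟨i, hi⟩ := hmem q hq
    obtain ⟨j, hj⟩ := hmem q' hq'
    rw [hi, hj]
    exact hchain i j

theorem isPullbackStd_of_slice {m' n' m n : ℕ} {ρ : C.Adm m' n' m n} {F : Series m (n + 1)}
    {G : Series m' (n' + 1)}
    (h : ∀ q, (splitStd m' n').slice q G = admHom ρ ((splitStd m n).slice q F)) :
    IsPullbackStd ρ F G := fun q =>
  (congrArg HahnSeries.coeff (h q)).trans (coeff_admHom ρ _)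

theorem isPullbackGen_of_slice {m' n' m n : ℕ} {ρ : C.Adm m' n' m n} {F : Series (m + 1) n}
    {G : Series (m' + 1) n'}
    (h : ∀ q, (splitGen m' n').slice q G = admHom ρ ((splitGen m n).slice q F)) :
    IsPullbackGen ρ F G := fun q =>
  (congrArg HahnSeries.coeff (h q)).trans (coeff_admHom ρ _)

theorem HasPresentation.std {m n d : ℕ} {F : Series m (n + 1)}
    (h : C.HasPresentation (splitStd m n) d F) : C.HasFinitePresentationStd d F := by
  obtain ⟨hF, α, H, U, hα, _, hH, h⟩ := h
  exact ⟨hF, α, H, U, hα, fun i => C.natCast_mem_K _, hH, h⟩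

theorem HasPresentation.gen {m n d : ℕ} {F : Series (m + 1) n}
    (h : C.HasPresentation (splitGen m n) d F) : C.HasFinitePresentationGen d F := by
  obtain ⟨hF, α, H, U, hα, hK, hH, h⟩ := h
  refine ⟨hF, α, H, U, hα, fun i => ?_, hH, h⟩
  have h1 := hK i (Fin.last m)
  simp only [splitGen_equiv, zGen, Fin.snoc_last] at h1
  exact h1

end GeneralisedQuasianalyticClass

end GenQA

end

theorem mainTheorem3 (C : GenQA.GeneralisedQuasianalyticClass) (m n : ℕ)
    (hIH : C.InductiveHypothesis (m + n)) :
    (∀ F ∈ C.hat m (n + 1), F ≠ 0 →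
      ∃ 𝓕 : Set (C.AdmTo m n), C.IsAdmissibleFamily 𝓕 ∧
        ∀ ρ ∈ 𝓕, ∃ G : GenQA.Series ρ.m' (ρ.n' + 1),
          GenQA.QuasianalyticAlgebras.IsPullbackStd ρ.map F G ∧
          ∃ d : ℕ, C.HasFinitePresentationStd d G) ∧
    (∀ F ∈ C.hat (m + 1) n, F ≠ 0 →
      ∃ 𝓕 : Set (C.AdmTo m n), C.IsAdmissibleFamily 𝓕 ∧
        ∀ ρ ∈ 𝓕, ∃ G : GenQA.Series (ρ.m' + 1) ρ.n',
          GenQA.QuasianalyticAlgebras.IsPullbackGen ρ.map F G ∧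
          ∃ d : ℕ, C.HasFinitePresentationGen d G) := by
  open GenQA GenQA.GeneralisedQuasianalyticClass in
  constructor
  · intro F hF hF0
    obtain ⟨𝓕, h𝓕, h⟩ := exists_family_hasPresentation (p := fun m => m) (r := fun n => n + 1) hIH
      splitStd C.hatSplitting_std (fun ρ F hF => C.exists_adm_slice_std ρ hF) hF hF0
    refine ⟨𝓕, h𝓕, fun ρ hρ => ?_⟩
    obtain ⟨G, hG, d, hd⟩ := h ρ hρ
    exact ⟨G, isPullbackStd_of_slice hG, d, HasPresentation.std hd⟩
  · intro F hF hF0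
    obtain ⟨𝓕, h𝓕, h⟩ := exists_family_hasPresentation (p := fun m => m + 1) (r := fun n => n) hIH
      splitGen C.hatSplitting_gen (fun ρ F hF => C.exists_adm_slice_gen ρ hF) hF hF0
    refine ⟨𝓕, h𝓕, fun ρ hρ => ?_⟩
    obtain ⟨G, hG, d, hd⟩ := h ρ hρ
    exact ⟨G, isPullbackGen_of_slice hG, d, HasPresentation.gen hd⟩
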